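/- Let $m \ge 2$, $\mathfrak g = \mathfrak{gl}_m(\mathbb C)$ with matrix units $e_{ij}$, $\mathfrak b$ and $\mathfrak n_+$ the subalgebras of upper and of strictly upper triangular matrices, $\Lambda = \mathbb Z^m$, $\rho = (0,-1,\dots,-m+1)$ and $R = \mathbb C[\![z_1,\dots,z_m]\!]$. For a $(\mathfrak g,R)$-bimodule $M$ (a left module over $U(\mathfrak g)\otimes_{\mathbb C}R$) and $\lambda\in\Lambda$ put $M_{(\lambda)} = \{v\in M \mid (e_{ii}-\lambda_i)v = v z_i,\ 1\le i\le m\}$. Let $\widetilde{\mathcal O}$ be the full subcategory of the category of $(\mathfrak g,R)$-bimodules consisting of those $M$ that are finitely generated as bimodules, are locally finite over $U(\mathfrak n_+)$, and satisfy $M = \bigoplus_{\lambda\in\Lambda}M_{(\lambda)}$; it is an abelian category. For $\lambda\in\Lambda$ let $\widetilde M(\lambda) = U(\mathfrak g)\otimes_{U(\mathfrak b)}R_{\lambda-\rho}$ be the deformed Verma module, where $R_\mu = R$ as an $R$-module, with $e_{ii}$ acting by $\mu_i+z_i$ and $e_{ij}$ $(i<j)$ by $0$. Let $M(\lambda) =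 U(\mathfrak g)\otimes_{U(\mathfrak b)}\mathbb C_{\lambda-\rho}$ be the Verma module, where $e_{ii}$ acts on $\mathbb C_\mu=\mathbb C$ by $\mu_i$ and $e_{ij}$ $(i<j)$ by $0$, and each $z_i$ acts on $M(\lambda)$ by $0$. Let $M(\lambda)^\vee = \bigoplus_{\nu\in\Lambda}\operatorname{Hom}_{\mathbb C}(M(\lambda)_{(\nu)},\mathbb C)$ be the dual Verma module, with $(xf)(v) = f(x^{T}v)$ for $x\in\mathfrak g$ and $(fr)(v)=f(vr)$ for $r\in R$. Then for all $\lambda,\mu\in\Lambda$ the modules $\widetilde M(\lambda)$ and $M(\mu)^\vee$ belong to $\widetilde{\mathcal O}$, and for all $i\ge 0$, as complex vector spaces, $$\operatorname{Ext}^i_{\widetilde{\mathcal O}}\bigl(\widetilde M(\lambda),M(\mu)^\vee\bigr) \cong \begin{cases}\mathbb C & \text{if } i=0 \text{ and } \lambda=\mu,\\ 0 & \text{otherwise.}\end{cases}$$ -/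

import Mathlib

section NoetherianCriterion

/-- A left ideal is determined by its ideal of leading symbols. -/
theorem isNoetherianRing_of_commutators {k A ι : Type*} [CommRing k] [IsNoetherianRing k]
    [Ring A] [Algebra k A] [Finite ι] (x : ι → A)
    (hgen : Algebra.adjoin k (Set.range x) = ⊤)
    (hcomm : ∀ i j, x i * x j - x j * x i ∈ Submodule.span k (Set.range x)) :
    IsNoetherianRing A := by
  classical
  set V : Submodule k A := Submodule.span k (insert 1 (Set.range x)) with hV
  have h1V : (1 : A) ∈ V := Submodule.subset_span (by simp)
  have hxV : ∀ i, x i ∈ V := fun i => Submodule.subset_span (by simp)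
  have hsV : Submodule.span k (Set.range x) ≤ V := Submodule.span_mono (by simp)
  have mem_add : ∀ {p q : ℕ} {a b : A}, a ∈ V ^ p → b ∈ V ^ q → a * b ∈ V ^ (p + q) := by
    intro p q a b ha hb
    rw [pow_add]; exact Submodule.mul_mem_mul ha hb
  have mono : ∀ {p q : ℕ}, p ≤ q → V ^ p ≤ V ^ q := by
    intro p q h
    obtain ⟨r, rfl⟩ := Nat.exists_eq_add_of_le h
    intro a ha
    have : a * 1 ∈ V ^ (p + r) := mem_add ha (by
      have := Submodule.pow_subset_pow V (n := r)
      have h2 := Submodule.pow_mem_pow V h1V r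
      simpa using h2)
    simpa using this
  -- `G d` is the filtration shifted by one
  set G : ℕ → Submodule k A := fun d => Nat.casesOn d ⊥ (fun e => V ^ e) with hG
  have G0 : G 0 = ⊥ := rfl
  have GS : ∀ d, G (d + 1) = V ^ d := fun d => rfl
  have GmulV : ∀ {d : ℕ} {a b : A}, a ∈ V → b ∈ G d → a * b ∈ G (d + 1) := by
    intro d a b ha hb
    cases d with
    | zero => rw [G0, Submodule.mem_bot] at hb; subst hb; simp
    | succ e =>
      rw [GS] at hb ⊢
      have := mem_add (p := 1) (by simpa using ha) hb
      rwa [add_comm] at this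
  -- words
  have word_mem : ∀ l : List ι, (l.map x).prod ∈ V ^ l.length := by
    intro l
    induction l with
    | nil => simpa using (⟨1, map_one _⟩ : ∃ y, algebraMap k A y = 1)
    | cons i l ih =>
      rw [List.map_cons, List.prod_cons, List.length_cons, add_comm]
      exact mem_add (by simpa using hxV i) ih
  have word_perm : ∀ l l' : List ι, l.Perm l' → (l.map x).prod - (l'.map x).prod ∈ G l.length := by
    intro l l' h
    induction h with
    | nil => simp
    | cons i h ih =>
      rw [List.map_cons, List.prod_cons, List.map_cons, List.prod_cons, ← mul_sub]
      exact GmulV (hxV i) ih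
    | swap i j l =>
      simp only [List.map_cons, List.prod_cons, List.length_cons]
      rw [GS]
      have := mem_add (p := 1) (by simpa using hsV (hcomm j i)) (word_mem l)
      rw [add_comm] at this
      convert this using 1
      noncomm_ring
    | trans h1 h2 ih1 ih2 =>
      rw [← h1.length_eq] at ih2
      have := add_mem ih1 ih2
      simpa using this
  -- evaluation of monomials in some chosen order
  set ord : (ι →₀ ℕ) → A := fun s => ((Finsupp.toMultiset s).toList.map x).prod with hord
  have len : ∀ s : ι →₀ ℕ, (Finsupp.toMultiset s).toList.length = s.degree := by
    intro s
    rw [Multiset.length_toList, Finsupp.card_toMultiset, Finsupp.degree]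
    rfl
  have ord_list : ∀ l : List ι, (l.map x).prod - ord (Multiset.toFinsupp (l : Multiset ι)) ∈ G l.length := by
    intro l
    apply word_perm
    rw [← Multiset.coe_eq_coe]
    simp
  have ord_mul : ∀ i s, x i * ord s - ord (Finsupp.single i 1 + s) ∈ G (s.degree + 1) := by
    intro i s
    have := word_perm (i :: (Finsupp.toMultiset s).toList)
      (Finsupp.toMultiset (Finsupp.single i 1 + s)).toList (by
        rw [← Multiset.coe_eq_coe, ← Multiset.cons_coe]
        simp [Finsupp.toMultiset_single])
    simpa only [List.map_cons, List.prod_cons, List.length_cons, len] using this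
  set ev : MvPolynomial ι k →ₗ[k] A := (MvPolynomial.basisMonomials ι k).constr k ord with hev
  have ev_mon : ∀ s c, ev (MvPolynomial.monomial s c) = c • ord s := by
    intro s c
    have : MvPolynomial.monomial s c = c • (MvPolynomial.basisMonomials ι k s) := by
      simp [MvPolynomial.smul_monomial]
    rw [this, map_smul, hev, Module.Basis.constr_basis]
  have ev_X : ∀ (i : ι) (d : ℕ) (p : MvPolynomial ι k), p.IsHomogeneous d →
      x i * ev p - ev (MvPolynomial.X i * p) ∈ G (d + 1) := by
    intro i d p hp
    rw [p.as_sum, Finset.mul_sum, map_sum, map_sum, Finset.mul_sum, ← Finset.sum_sub_distrib]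
    refine sum_mem fun s hs => ?_
    rw [MvPolynomial.X, MvPolynomial.monomial_mul, ev_mon, ev_mon, one_mul, mul_smul_comm,
      ← smul_sub]
    have hd : s.degree = d := by
      by_contra hne
      exact (MvPolynomial.mem_support_iff.mp hs) (hp.coeff_eq_zero hne)
    rw [← hd]
    exact Submodule.smul_mem _ _ (ord_mul i s)
  have lead : ∀ d, ∀ a ∈ V ^ d, ∃ p : MvPolynomial ι k, p.IsHomogeneous d ∧ a - ev p ∈ G d := by
    intro d
    induction d with
    | zero =>
      intro a ha
      rw [pow_zero, Submodule.mem_one] at ha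
      obtain ⟨c, rfl⟩ := ha
      refine ⟨MvPolynomial.monomial 0 c, MvPolynomial.isHomogeneous_monomial _ (by simp), ?_⟩
      rw [ev_mon]
      simp [hord, Algebra.algebraMap_eq_smul_one]
    | succ d ih =>
      intro a ha
      rw [pow_succ'] at ha
      refine Submodule.mul_induction_on ha ?_ ?_
      · intro v hv w hw
        obtain ⟨p, hp, hpw⟩ := ih w hw
        rw [GS]
        refine Submodule.span_induction (p := fun v _ => ∃ p : MvPolynomial ι k,
          p.IsHomogeneous (d + 1) ∧ v * w - ev p ∈ V ^ d) ?_ ?_ ?_ ?_ hv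
        · rintro v (rfl | ⟨i, rfl⟩)
          · exact ⟨0, MvPolynomial.isHomogeneous_zero _ _ _, by simpa using hw⟩
          · refine ⟨MvPolynomial.X i * p, ?_, ?_⟩
            · rw [add_comm]; exact (MvPolynomial.isHomogeneous_X _ _).mul hp
            · have e1 := GmulV (hxV i) hpw
              have e2 := ev_X i d p hp
              rw [GS] at e1 e2
              have := add_mem e1 e2
              rw [mul_sub] at this
              simpa using this
        · exact ⟨0, MvPolynomial.isHomogeneous_zero _ _ _, by simp⟩
        · rintro v v' _ _ ⟨p, hp, h⟩ ⟨p', hp', h'⟩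
          refine ⟨p + p', hp.add hp', ?_⟩
          have := add_mem h h'
          rw [map_add, add_mul]
          convert this using 1; abel
        · rintro c v _ ⟨p, hp, h⟩
          refine ⟨c • p, (MvPolynomial.homogeneousSubmodule ι k (d+1)).smul_mem c hp, ?_⟩
          rw [map_smul, smul_mul_assoc, ← smul_sub]
          exact Submodule.smul_mem _ _ h
      · rintro v v' ⟨p, hp, h⟩ ⟨p', hp', h'⟩
        refine ⟨p + p', hp.add hp', ?_⟩
        have := add_mem h h'
        rw [map_add]
        convert this using 1; abel
  have exhaust : ∀ a : A, ∃ d, a ∈ V ^ d := by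
    intro a
    have ha : a ∈ Algebra.adjoin k (Set.range x) := by rw [hgen]; trivial
    induction ha using Algebra.adjoin_induction with
    | mem y hy =>
      obtain ⟨i, rfl⟩ := hy
      exact ⟨1, by simpa using hxV i⟩
    | algebraMap r => exact ⟨0, by simp⟩
    | add y z _ _ hy hz =>
      obtain ⟨p, hp⟩ := hy
      obtain ⟨q, hq⟩ := hz
      exact ⟨max p q, add_mem (mono (le_max_left _ _) hp) (mono (le_max_right _ _) hq)⟩
    | mul y z _ _ hy hz =>
      obtain ⟨p, hp⟩ := hy
      obtain ⟨q, hq⟩ := hz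
      exact ⟨p + q, mem_add hp hq⟩
  have hc : ∀ (d : ℕ) (p : MvPolynomial ι k) (i : ι),
      MvPolynomial.homogeneousComponent (d + 1) (MvPolynomial.X i * p) =
        MvPolynomial.X i * MvPolynomial.homogeneousComponent d p := by
    intro d p i
    ext s
    rw [MvPolynomial.coeff_homogeneousComponent, MvPolynomial.coeff_X_mul',
      MvPolynomial.coeff_X_mul', MvPolynomial.coeff_homogeneousComponent]
    by_cases hs : i ∈ s.support
    · have : s.degree = (s - Finsupp.single i 1).degree + 1 := by
        have h2 : s = (s - Finsupp.single i 1) + Finsupp.single i 1 := by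
          rw [tsub_add_cancel_of_le]
          simpa [Finsupp.single_le_iff, Nat.one_le_iff_ne_zero] using hs
        conv_lhs => rw [h2]
        simp
      simp [hs, this]
    · simp [hs]
  let lt : Submodule A A → Ideal (MvPolynomial ι k) := fun I =>
    { carrier := {p | ∀ d, ∃ a ∈ I, a - ev (MvPolynomial.homogeneousComponent d p) ∈ G d}
      zero_mem' := fun d => ⟨0, I.zero_mem, by simp⟩
      add_mem' := by
        intro p q hp hq d
        obtain ⟨a, ha, ha'⟩ := hp d
        obtain ⟨b, hb, hb'⟩ := hq d
        refine ⟨a + b, add_mem ha hb, ?_⟩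
        have := add_mem ha' hb'
        rw [map_add, map_add]
        convert this using 1; abel
      smul_mem' := by
        intro c p hp
        rw [smul_eq_mul]
        induction c using MvPolynomial.induction_on with
        | C r =>
          intro d
          obtain ⟨a, ha, ha'⟩ := hp d
          refine ⟨algebraMap k A r • a, I.smul_mem _ ha, ?_⟩
          rw [MvPolynomial.homogeneousComponent_C_mul, ← MvPolynomial.smul_eq_C_mul, map_smul,
            algebraMap_smul, ← smul_sub]
          exact Submodule.smul_mem _ _ ha'
        | add c c' hc hc' =>
          intro d
          obtain ⟨a, ha, ha'⟩ := hc d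
          obtain ⟨b, hb, hb'⟩ := hc' d
          refine ⟨a + b, add_mem ha hb, ?_⟩
          have := add_mem ha' hb'
          rw [add_mul, map_add, map_add]
          convert this using 1; abel
        | mul_X c i h =>
          intro d
          rw [mul_comm c, mul_assoc]
          cases d with
          | zero =>
            refine ⟨0, I.zero_mem, ?_⟩
            have : MvPolynomial.homogeneousComponent 0 (MvPolynomial.X i * (c * p)) = 0 := by
              rw [MvPolynomial.homogeneousComponent_zero, MvPolynomial.coeff_X_mul']
              simp
            rw [this]; simp
          | succ d =>
            obtain ⟨a, ha, ha'⟩ := h d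
            refine ⟨x i • a, I.smul_mem _ ha, ?_⟩
            rw [hc, smul_eq_mul]
            have e1 := GmulV (hxV i) ha'
            have e2 := ev_X i d _ (MvPolynomial.homogeneousComponent_isHomogeneous d (c * p))
            have := add_mem e1 e2
            rw [mul_sub] at this
            simpa using this }
  have key : ∀ I J : Submodule A A, I ≤ J → lt J ≤ lt I → J ≤ I := by
    intro I J hIJ hlt
    have main : ∀ d, ∀ a ∈ J, a ∈ G d → a ∈ I := by
      intro d
      induction d with
      | zero =>
        intro a _ ha
        rw [G0, Submodule.mem_bot] at ha
        subst ha; exact I.zero_mem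
      | succ d ih =>
        intro a haJ ha
        rw [GS] at ha
        obtain ⟨p, hp, hap⟩ := lead d a ha
        have hpJ : p ∈ lt J := by
          intro e
          rw [MvPolynomial.homogeneousComponent_of_mem hp]
          split_ifs with h
          · subst h; exact ⟨a, haJ, hap⟩
          · exact ⟨0, J.zero_mem, by simp⟩
        obtain ⟨b, hb, hb'⟩ := hlt hpJ d
        rw [MvPolynomial.homogeneousComponent_eq_self hp] at hb'
        have : a - b ∈ I := ih (a - b) (sub_mem haJ (hIJ hb)) (by
          have := sub_mem hap hb'
          simpa using this)
        simpa using add_mem this hb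
    intro a ha
    obtain ⟨d, hd⟩ := exhaust a
    exact main (d + 1) a ha (by rw [GS]; exact hd)
  have hmono : StrictMono lt := by
    intro I J hIJ
    refine lt_of_le_not_ge ?_ ?_
    · intro p hp d
      obtain ⟨a, ha, h⟩ := hp d
      exact ⟨a, hIJ.le ha, h⟩
    · intro h
      exact not_le_of_gt hIJ (key I J hIJ.le h)
  have : WellFoundedGT (Submodule A A) := hmono.wellFoundedGT
  exact isNoetherian_iff'.mpr this

end NoetherianCriterion

open CategoryTheory
open scoped TensorProduct ModuleCat
attribute [local instance 100] LieRing.ofAssociativeRing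

noncomputable section

namespace DeformedBGG

/-- The general linear Lie algebra `𝔤 = 𝔤𝔩ₘ(ℂ)`. -/
abbrev Gl (m : ℕ) : Type := Matrix (Fin m) (Fin m) ℂ

/-- The universal enveloping algebra `U(𝔤)`. -/
abbrev Ug (m : ℕ) : Type := UniversalEnvelopingAlgebra ℂ (Gl m)

/-- The ring `R = ℂ⟦z₁, …, zₘ⟧`. -/
abbrev R (m : ℕ) : Type := MvPowerSeries (Fin m) ℂ

/-- The algebra `U(𝔤) ⊗ R`; since `R` is commutative, its left modules are the
`(𝔤, R)`-bimodules on which the two actions of `ℂ` agree. -/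
abbrev A (m : ℕ) : Type := Ug m ⊗[ℂ] R m

/-- An element of `𝔤`, viewed in `U(𝔤) ⊗ R`. -/
def lieElt {m : ℕ} (x : Gl m) : A m := UniversalEnvelopingAlgebra.ι ℂ x ⊗ₜ 1

/-- An element of `R`, viewed in `U(𝔤) ⊗ R`. -/
def coeffElt {m : ℕ} (r : R m) : A m := 1 ⊗ₜ r

/-- The matrix unit `e_{ij}`. -/
abbrev unitMat {m : ℕ} (i j : Fin m) : Gl m := Matrix.single i j 1

theorem adjoin_range_ι (L : Type) [LieRing L] [LieAlgebra ℂ L] :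
    Algebra.adjoin ℂ (Set.range (UniversalEnvelopingAlgebra.ι ℂ : L → _)) = ⊤ := by
  set S := Algebra.adjoin ℂ (Set.range (UniversalEnvelopingAlgebra.ι ℂ : L → _))
  let f : L →ₗ⁅ℂ⁆ S :=
    { toFun := fun x => ⟨UniversalEnvelopingAlgebra.ι ℂ x, Algebra.subset_adjoin ⟨x, rfl⟩⟩
      map_add' := fun x y => by ext; simp
      map_smul' := fun c x => by ext; simp
      map_lie' := fun {x y} => by
        ext
        simp only [LieHom.map_lie, LieRing.of_associative_ring_bracket]
        rfl }
  have h : S.val.comp (UniversalEnvelopingAlgebra.lift ℂ f) = AlgHom.id ℂ _ := by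
    apply UniversalEnvelopingAlgebra.hom_ext
    ext x
    simp only [LieHom.coe_comp, Function.comp_apply, AlgHom.coe_toLieHom, AlgHom.coe_comp,
      UniversalEnvelopingAlgebra.lift_ι_apply, AlgHom.coe_id, id]
    rfl
  rw [eq_top_iff]
  intro u _
  have := congrArg (fun g => g u) h
  simp only [AlgHom.coe_comp, Function.comp_apply, AlgHom.coe_id, id] at this
  rw [← this]
  exact (UniversalEnvelopingAlgebra.lift ℂ f u).2

theorem coeffElt_commute {m : ℕ} (r : R m) (a : A m) : coeffElt r * a = a * coeffElt r := by
  induction a using TensorProduct.induction_on with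
  | zero => simp
  | tmul u s => simp [coeffElt, mul_comm]
  | add a b ha hb => rw [mul_add, add_mul, ha, hb]

theorem lieElt_add {m : ℕ} (x y : Gl m) : lieElt (x + y) = lieElt x + lieElt y := by
  simp only [lieElt, map_add, TensorProduct.add_tmul]

theorem lieElt_smul {m : ℕ} (c : ℂ) (x : Gl m) : lieElt (c • x) = c • lieElt x := by
  simp only [lieElt, map_smul, TensorProduct.smul_tmul']

theorem lieElt_comm {m : ℕ} (x y : Gl m) :
    lieElt x * lieElt y - lieElt y * lieElt x = lieElt (x * y - y * x) := by
  have h : UniversalEnvelopingAlgebra.ι ℂ (x * y - y * x) =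
      UniversalEnvelopingAlgebra.ι ℂ x * UniversalEnvelopingAlgebra.ι ℂ y -
      UniversalEnvelopingAlgebra.ι ℂ y * UniversalEnvelopingAlgebra.ι ℂ x := by
    have := LieHom.map_lie (UniversalEnvelopingAlgebra.ι ℂ (L := Gl m)) x y
    rwa [LieRing.of_associative_ring_bracket, LieRing.of_associative_ring_bracket] at this
  simp only [lieElt, h, TensorProduct.sub_tmul, Algebra.TensorProduct.tmul_mul_tmul, mul_one]

/-- Induction along the generators of the algebra `U(𝔤) ⊗ R`. -/
theorem A_induction {m : ℕ} {p : A m → Prop} (hl : ∀ x, p (lieElt x)) (hr : ∀ r, p (coeffElt r))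
    (hadd : ∀ a b, p a → p b → p (a + b)) (hmul : ∀ a b, p a → p b → p (a * b)) (a : A m) : p a := by
  have hu : ∀ u : Ug m, p (u ⊗ₜ 1) := by
    intro u
    have hm : u ∈ Algebra.adjoin ℂ (Set.range (UniversalEnvelopingAlgebra.ι ℂ : Gl m → _)) := by
      rw [adjoin_range_ι]; trivial
    induction hm using Algebra.adjoin_induction with
    | mem y hy => obtain ⟨x, rfl⟩ := hy; exact hl x
    | algebraMap c =>
      have : (algebraMap ℂ (Ug m) c) ⊗ₜ[ℂ] (1 : R m) = coeffElt (algebraMap ℂ (R m) c) := by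
        rw [coeffElt, Algebra.algebraMap_eq_smul_one, Algebra.algebraMap_eq_smul_one,
          TensorProduct.smul_tmul]
      rw [this]; exact hr _
    | add y z _ _ hy hz => rw [TensorProduct.add_tmul]; exact hadd _ _ hy hz
    | mul y z _ _ hy hz =>
      have := hmul _ _ hy hz
      rwa [Algebra.TensorProduct.tmul_mul_tmul, one_mul] at this
  induction a using TensorProduct.induction_on with
  | zero => simpa using hu 0
  | tmul u s =>
    have := hmul _ _ (hu u) (hr s)
    rwa [coeffElt, Algebra.TensorProduct.tmul_mul_tmul, one_mul, mul_one] at this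
  | add a b ha hb => exact hadd _ _ ha hb

instance isNoetherianRing_A (m : ℕ) : IsNoetherianRing (A m) := by
  let _ : Algebra (R m) (A m) := Algebra.TensorProduct.rightAlgebra
  have halg : ∀ r : R m, algebraMap (R m) (A m) r = coeffElt r := fun r => rfl
  have hspan : ∀ x : Gl m, lieElt x ∈ Submodule.span (R m)
      (Set.range fun p : Fin m × Fin m => lieElt (unitMat p.1 p.2)) := by
    intro x
    have hx : lieElt x = ∑ i, ∑ j, algebraMap (R m) (A m) (algebraMap ℂ (R m) (x i j)) *
        lieElt (unitMat i j) := by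
      have h1 : ∀ i j, algebraMap (R m) (A m) (algebraMap ℂ (R m) (x i j)) *
        lieElt (unitMat i j) = lieElt (Matrix.single i j (x i j)) := by
        intro i j
        have : Matrix.single i j (x i j) = x i j • unitMat i j := by
          simp [unitMat, Matrix.smul_single]
        rw [this, lieElt_smul, halg, coeffElt, Algebra.algebraMap_eq_smul_one, lieElt,
          Algebra.TensorProduct.tmul_mul_tmul, TensorProduct.smul_tmul', one_mul, mul_one,
          TensorProduct.tmul_smul, TensorProduct.smul_tmul']
      simp_rw [h1]
      let f : Gl m →+ A m := ⟨⟨lieElt, by simp [lieElt]⟩, lieElt_add⟩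
      conv_lhs => rw [Matrix.matrix_eq_sum_single x]
      change f _ = ∑ i, ∑ j, f _
      simp [map_sum]
    rw [hx]
    refine sum_mem fun i _ => sum_mem fun j _ => ?_
    rw [← Algebra.smul_def]
    exact Submodule.smul_mem _ _ (Submodule.subset_span ⟨(i, j), rfl⟩)
  refine isNoetherianRing_of_commutators (k := R m)
    (fun p : Fin m × Fin m => lieElt (unitMat p.1 p.2)) ?_ ?_
  · rw [eq_top_iff]
    intro a _
    induction a using A_induction with
    | hl x => exact Algebra.span_le_adjoin _ _ (hspan x)
    | hr r => rw [← halg]; exact Subalgebra.algebraMap_mem _ _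
    | hadd a b ha hb => exact add_mem (ha trivial) (hb trivial)
    | hmul a b ha hb => exact mul_mem (ha trivial) (hb trivial)
  · intro i j
    rw [lieElt_comm]
    exact hspan _


/-! ### The category -/

/-- The subspace `𝔫₊` of strictly upper triangular matrices. -/
def nPlus (m : ℕ) : Submodule ℂ (Gl m) where
  carrier := {x | ∀ i j, j ≤ i → x i j = 0}
  zero_mem' := by intro i j _; rfl
  add_mem' := by
    intro x y hx hy i j h
    rw [Matrix.add_apply, hx i j h, hy i j h, add_zero]
  smul_mem' := by
    intro c x hx i j h
    rw [Matrix.smul_apply, hx i j h, smul_zero]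

section Modules

variable {m : ℕ} (M : Type) [AddCommGroup M] [Module ℂ M] [Module (A m) M]
  [IsScalarTower ℂ (A m) M]

/-- The generalized weight space `M_(λ) = {v | (e_{ii} - λ_i) v = v z_i for all i}`. -/
def weightSpace (l : Fin m → ℤ) : Submodule ℂ M where
  carrier := {v | ∀ i, lieElt (unitMat i i) • v - (l i : ℂ) • v =
    (coeffElt (MvPowerSeries.X i) : A m) • v}
  zero_mem' := by intro i; simp
  add_mem' := by
    intro v w hv hw i
    rw [smul_add, smul_add, smul_add, ← hv i, ← hw i]; abel
  smul_mem' := by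
    intro c v hv i
    rw [smul_comm _ c v, smul_comm _ c v, smul_comm _ c v, ← smul_sub, hv i]

variable (m) in
/-- The conditions for a `(𝔤, R)`-bimodule to belong to the deformed category `Õ`. -/
structure IsOtil : Prop where
  /-- `M` is finitely generated over `U(𝔤) ⊗ R` -/
  finite : Module.Finite (A m) M
  /-- `M` is locally finite over `U(𝔫₊)`: every vector lies in a finite-dimensional
  `𝔫₊`-stable subspace -/
  locallyFinite : ∀ v : M, ∃ W : Submodule ℂ M, FiniteDimensional ℂ W ∧ v ∈ W ∧
    ∀ x ∈ nPlus m, ∀ w ∈ W, lieElt x • w ∈ W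
  /-- `M` is the direct sum of its generalized weight spaces of integral weight -/
  weight : DirectSum.IsInternal (weightSpace M : (Fin m → ℤ) → Submodule ℂ M)

variable {M}

/-- The weight components of an element of a submodule belong to the submodule. -/
theorem component_mem (N : Submodule (A m) M) (S : Finset (Fin m → ℤ)) :
    ∀ f : (Fin m → ℤ) → M, (∀ l, f l ∈ weightSpace M l) → ∑ l ∈ S, f l ∈ N →
      ∀ l ∈ S, f l ∈ N := by
  classical
  induction S using Finset.induction_on with
  | empty => simp
  | insert k S hk ih =>
    intro f hf hsum
    have h1 : ∀ l ∈ S, f l ∈ N := by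
      intro l hl
      obtain ⟨i, hi⟩ : ∃ i, l i ≠ k i := by
        by_contra! h
        exact hk (by rwa [← funext h])
      set h : A m := lieElt (unitMat i i) - coeffElt (MvPowerSeries.X i) with hh
      have hact : ∀ l' v, v ∈ weightSpace M l' → h • v = (l' i : ℂ) • v := by
        intro l' v hv
        rw [hh, sub_smul, ← hv i]; abel
      have hN : h • (∑ l ∈ insert k S, f l) - (k i : ℂ) • (∑ l ∈ insert k S, f l) ∈ N := by
        refine sub_mem (N.smul_mem _ hsum) ?_
        rw [← algebraMap_smul (A m) (k i : ℂ)]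
        exact N.smul_mem _ hsum
      have he : h • (∑ l ∈ insert k S, f l) - (k i : ℂ) • (∑ l ∈ insert k S, f l) =
          ∑ l ∈ S, ((l i : ℂ) - (k i : ℂ)) • f l := by
        rw [Finset.smul_sum, Finset.smul_sum, ← Finset.sum_sub_distrib,
          Finset.sum_insert hk, hact k _ (hf k), sub_self, zero_add]
        refine Finset.sum_congr rfl fun l' _ => ?_
        rw [hact l' _ (hf l'), sub_smul]
      rw [he] at hN
      have := ih (fun l => ((l i : ℂ) - (k i : ℂ)) • f l)
        (fun l => Submodule.smul_mem _ _ (hf l)) hN l hl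
      have hne : ((l i : ℂ) - (k i : ℂ)) ≠ 0 := sub_ne_zero.mpr (by exact_mod_cast hi)
      have h2 : (algebraMap ℂ (A m) ((l i : ℂ) - (k i : ℂ))⁻¹) •
          (((l i : ℂ) - (k i : ℂ)) • f l) ∈ N := N.smul_mem _ this
      rwa [algebraMap_smul, smul_smul, inv_mul_cancel₀ hne, one_smul] at h2
    intro l hl
    rcases Finset.mem_insert.mp hl with rfl | hl
    · rw [Finset.sum_insert hk] at hsum
      have := sub_mem hsum (sum_mem h1)
      simpa using this
    · exact h1 l hl

theorem exists_sum_of_iSup_eq_top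
    (h : ⨆ l, weightSpace M (l : Fin m → ℤ) = ⊤) (v : M) :
    ∃ (S : Finset (Fin m → ℤ)) (f : (Fin m → ℤ) → M),
      (∀ l, f l ∈ weightSpace M l) ∧ ∑ l ∈ S, f l = v := by
  have hv : v ∈ ⨆ l, weightSpace M (l : Fin m → ℤ) := by rw [h]; trivial
  obtain ⟨f, hf, hsum⟩ := (Submodule.mem_iSup_iff_exists_finsupp _ _).mp hv
  exact ⟨f.support, f, hf, hsum⟩

theorem weight_isInternal_iff :
    DirectSum.IsInternal (weightSpace M : (Fin m → ℤ) → Submodule ℂ M) ↔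
      ⨆ l, weightSpace M (l : Fin m → ℤ) = ⊤ := by
  classical
  rw [DirectSum.isInternal_submodule_iff_iSupIndep_and_iSup_eq_top]
  refine ⟨fun h => h.2, fun h => ⟨?_, h⟩⟩
  rw [iSupIndep_def]
  intro k
  rw [Submodule.disjoint_def]
  intro x hx hx'
  obtain ⟨f, hf, hsum⟩ := (Submodule.mem_iSup_iff_exists_finsupp _ _).mp hx'
  have hfk : f k = 0 := by
    have := hf k
    simpa using this
  have hk : k ∉ f.support := by simpa using hfk
  have hsum' : ∑ l ∈ f.support, f l = x := hsum
  have := component_mem (⊥ : Submodule (A m) M) (insert k f.support)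
    (fun l => if l = k then -x else f l) (by
      intro l
      by_cases hl : l = k
      · subst hl; simpa using hx
      · have h2 := hf l
        simp only [hl, if_false]
        simpa [hl] using h2) (by
      rw [Finset.sum_insert hk, if_pos rfl]
      have : ∑ l ∈ f.support, (if l = k then -x else f l) = x := by
        rw [← hsum']
        refine Finset.sum_congr rfl fun l hl => ?_
        rw [if_neg (by rintro rfl; exact hk hl)]
      rw [this]; simp) k (Finset.mem_insert_self _ _)
  simpa using this

variable {N : Type} [AddCommGroup N] [Module ℂ N] [Module (A m) N] [IsScalarTower ℂ (A m) N]

theorem map_mem_weightSpace (f : M →ₗ[A m] N) {l : Fin m → ℤ} {v : M}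
    (hv : v ∈ weightSpace M l) : f v ∈ weightSpace N l := by
  intro i
  have := congrArg f (hv i)
  rw [map_sub, ← algebraMap_smul (A m) (l i : ℂ) v, map_smul, map_smul, map_smul,
    algebraMap_smul] at this
  exact this

theorem IsOtil.of_surjective (hM : IsOtil m M) (f : M →ₗ[A m] N) (hf : Function.Surjective f) :
    IsOtil m N where
  finite := have := hM.finite; Module.Finite.of_surjective f hf
  locallyFinite := by
    intro v
    obtain ⟨v, rfl⟩ := hf v
    obtain ⟨W, hW, hv, hst⟩ := hM.locallyFinite v
    refine ⟨W.map (f.restrictScalars ℂ), inferInstance, ⟨v, hv, rfl⟩, ?_⟩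
    rintro x hx _ ⟨w, hw, rfl⟩
    refine ⟨lieElt x • w, hst x hx w hw, ?_⟩
    exact f.map_smul _ _
  weight := by
    rw [weight_isInternal_iff, eq_top_iff]
    intro v _
    obtain ⟨v, rfl⟩ := hf v
    obtain ⟨S, g, hg, rfl⟩ := exists_sum_of_iSup_eq_top (weight_isInternal_iff.mp hM.weight) v
    rw [map_sum]
    exact sum_mem fun l _ => Submodule.mem_iSup_of_mem l (map_mem_weightSpace f (hg l))

theorem IsOtil.of_injective (hM : IsOtil m M) (f : N →ₗ[A m] M) (hf : Function.Injective f) :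
    IsOtil m N where
  finite := have := hM.finite; Module.Finite.of_injective f hf
  locallyFinite := by
    intro v
    obtain ⟨W, hW, hv, hst⟩ := hM.locallyFinite (f v)
    refine ⟨W.comap (f.restrictScalars ℂ), ?_, hv, ?_⟩
    · exact Module.Finite.of_injective
        ((f.restrictScalars ℂ).restrict (p := W.comap (f.restrictScalars ℂ)) (q := W)
          (fun _ h => h)) (by
            intro a b h
            apply Subtype.ext
            exact hf (congrArg Subtype.val h))
    · intro x hx w hw
      change f (lieElt x • w) ∈ W
      rw [map_smul]
      exact hst x hx _ hw
  weight := by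
    rw [weight_isInternal_iff, eq_top_iff]
    intro v _
    obtain ⟨S, g, hg, hsum⟩ :=
      exists_sum_of_iSup_eq_top (weight_isInternal_iff.mp hM.weight) (f v)
    have hmem := component_mem (LinearMap.range f) S g hg (by rw [hsum]; exact ⟨v, rfl⟩)
    have : ∀ l ∈ S, ∃ w ∈ weightSpace N l, f w = g l := by
      intro l hl
      obtain ⟨w, hw⟩ := hmem l hl
      refine ⟨w, ?_, hw⟩
      intro i
      apply hf
      have := hg l i
      rw [map_sub, ← algebraMap_smul (A m) (l i : ℂ) w, map_smul, map_smul, map_smul,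
        algebraMap_smul, hw]
      exact this
    choose! w hw hfw using this
    have hv : v = ∑ l ∈ S, w l := by
      apply hf
      rw [map_sum, ← hsum]
      exact Finset.sum_congr rfl fun l hl => (hfw l hl).symm
    rw [hv]
    exact sum_mem fun l hl => Submodule.mem_iSup_of_mem l (hw l hl)

theorem IsOtil.prod (hM : IsOtil m M) (hN : IsOtil m N) : IsOtil m (M × N) where
  finite := have := hM.finite; have := hN.finite; inferInstance
  locallyFinite := by
    rintro ⟨v, w⟩
    obtain ⟨V, hV, hv, hVst⟩ := hM.locallyFinite v
    obtain ⟨W, hW, hw, hWst⟩ := hN.locallyFinite w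
    refine ⟨V.prod W, ?_, ⟨hv, hw⟩, ?_⟩
    · exact Module.Finite.iff_fg.mpr
        ((Module.Finite.iff_fg.mp hV).prod (Module.Finite.iff_fg.mp hW))
    · rintro x hx ⟨a, b⟩ ⟨ha, hb⟩
      exact ⟨hVst x hx a ha, hWst x hx b hb⟩
  weight := by
    rw [weight_isInternal_iff, eq_top_iff]
    rintro ⟨v, w⟩ _
    obtain ⟨S, g, hg, rfl⟩ := exists_sum_of_iSup_eq_top (weight_isInternal_iff.mp hM.weight) v
    obtain ⟨T, h, hh, rfl⟩ := exists_sum_of_iSup_eq_top (weight_isInternal_iff.mp hN.weight) w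
    have : ((∑ l ∈ S, g l, ∑ l ∈ T, h l) : M × N) =
        LinearMap.inl (A m) M N (∑ l ∈ S, g l) + LinearMap.inr (A m) M N (∑ l ∈ T, h l) := by
      rw [LinearMap.inl_apply, LinearMap.inr_apply, Prod.mk_add_mk, add_zero, zero_add]
    rw [this, map_sum, map_sum]
    refine add_mem ?_ ?_
    · exact sum_mem fun l _ => Submodule.mem_iSup_of_mem l (map_mem_weightSpace _ (hg l))
    · exact sum_mem fun l _ => Submodule.mem_iSup_of_mem l (map_mem_weightSpace _ (hh l))

end Modules

/-- The objects of the deformed category `Õ` among all `(𝔤, R)`-bimodules. -/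
def otilProp (m : ℕ) : ObjectProperty (ModuleCat.{0} (A m)) := fun M => IsOtil m M

/-- The deformed category `Õ`, a full subcategory of the category of `(𝔤, R)`-bimodules. -/
abbrev Otil (m : ℕ) : Type 1 := (otilProp m).FullSubcategory

instance (m : ℕ) : (otilProp m).IsClosedUnderSubobjects where
  prop_of_mono f _ hY :=
    IsOtil.of_injective hY f.hom ((ModuleCat.mono_iff_injective f).mp inferInstance)

instance (m : ℕ) : (otilProp m).IsClosedUnderQuotients where
  prop_of_epi f _ hX :=
    IsOtil.of_surjective hX f.hom ((ModuleCat.epi_iff_surjective f).mp inferInstance)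

instance (m : ℕ) : (otilProp m).ContainsZero where
  exists_zero := by
    refine ⟨ModuleCat.of (A m) PUnit, ModuleCat.isZero_of_subsingleton _, ?_⟩
    refine ⟨inferInstance, fun v => ⟨⊤, ?_, trivial, fun _ _ _ _ => trivial⟩, ?_⟩
    · exact Module.Finite.of_surjective (0 : ℂ →ₗ[ℂ] _) (fun x => ⟨0, rfl⟩)
    · rw [weight_isInternal_iff, eq_top_iff]
      intro v _
      have : v = 0 := rfl
      rw [this]; exact zero_mem _

instance (m : ℕ) : (otilProp m).IsClosedUnderBinaryProducts where
  limitsOfShape_le := by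
    rintro X ⟨p⟩
    have e : ModuleCat.of (A m) (p.diag.obj ⟨.left⟩ × p.diag.obj ⟨.right⟩) ≅ X :=
      Limits.IsLimit.conePointUniqueUpToIso
        ((Limits.IsLimit.postcomposeInvEquiv (Limits.diagramIsoPair p.diag) _).symm
          (ModuleCat.binaryProductLimitCone _ _).isLimit) p.isLimit
    exact (otilProp m).prop_of_iso e
      (IsOtil.prod (p.prop_diag_obj ⟨.left⟩) (p.prop_diag_obj ⟨.right⟩))

instance (m : ℕ) : (otilProp m).IsClosedUnderFiniteProducts := .mk'

/-- `Õ` is an abelian category. -/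
instance (m : ℕ) : Abelian (Otil m) := inferInstance

instance (m : ℕ) : Linear ℂ (Otil m) := inferInstance

instance (m : ℕ) : HasExt.{1} (Otil m) := HasExt.standard _

/-! ### Deformed Verma modules and Verma modules -/

/-- The Borel subalgebra `𝔟` of upper triangular matrices. -/
def borel (m : ℕ) : LieSubalgebra ℂ (Gl m) where
  carrier := {x | ∀ i j, j < i → x i j = 0}
  zero_mem' := by intro i j _; rfl
  add_mem' := by
    intro x y hx hy i j h
    rw [Matrix.add_apply, hx i j h, hy i j h, add_zero]
  smul_mem' := by
    intro c x hx i j h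
    rw [Matrix.smul_apply, hx i j h, smul_zero]
  lie_mem' := by
    have hmul : ∀ x y : Gl m, (∀ i j, j < i → x i j = 0) → (∀ i j, j < i → y i j = 0) →
        ∀ i j, j < i → (x * y) i j = 0 := by
      intro x y hx hy i j h
      rw [Matrix.mul_apply]
      refine Finset.sum_eq_zero fun k _ => ?_
      rcases lt_or_ge k i with hk | hk
      · rw [hx i k hk, zero_mul]
      · rw [hy k j (lt_of_lt_of_le h hk), mul_zero]
    intro x y hx hy i j h
    rw [LieRing.of_associative_ring_bracket, Matrix.sub_apply, hmul x y hx hy i j h,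
      hmul y x hy hx i j h, sub_zero]

/-- The universal enveloping algebra `U(𝔟)`. -/
abbrev Ub (m : ℕ) : Type := UniversalEnvelopingAlgebra ℂ (borel m)

/-- The map `U(𝔟) → U(𝔤)` induced by the inclusion. -/
def borelIncl (m : ℕ) : Ub m →ₐ[ℂ] Ug m :=
  UniversalEnvelopingAlgebra.lift ℂ ((UniversalEnvelopingAlgebra.ι ℂ).comp (borel m).incl)

/-- For a commutative `ℂ`-algebra `S` and `c : Fin m → S`, the algebra map `U(𝔟) → S` with
`e_{ii} ↦ c i` and `e_{ij} ↦ 0` for `i < j`. -/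
def borelChar {m : ℕ} {S : Type} [CommRing S] [Algebra ℂ S] (c : Fin m → S) : Ub m →ₐ[ℂ] S :=
  UniversalEnvelopingAlgebra.lift ℂ
    { toFun := fun x => ∑ i, (x : Gl m) i i • c i
      map_add' := by
        intro x y
        simp [add_smul, Finset.sum_add_distrib]
      map_smul' := by
        intro t x
        simp [Finset.smul_sum, mul_smul]
      map_lie' := by
        have hdiag : ∀ x y : borel m, ∀ i, ((x : Gl m) * (y : Gl m)) i i =
            (x : Gl m) i i * (y : Gl m) i i := by
          intro x y i
          rw [Matrix.mul_apply]
          refine Finset.sum_eq_single i (fun k _ hk => ?_) (by simp)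
          rcases lt_or_gt_of_ne hk with h | h
          · rw [x.2 i k h, zero_mul]
          · rw [y.2 k i h, mul_zero]
        intro x y
        rw [LieRing.of_associative_ring_bracket, mul_comm, sub_self]
        refine Finset.sum_eq_zero fun i _ => ?_
        rw [LieSubalgebra.coe_bracket, LieRing.of_associative_ring_bracket, Matrix.sub_apply,
          hdiag, hdiag, mul_comm, sub_self, zero_smul] }

/-- The weight `ρ = (0, -1, …, -m+1)`. -/
def rho (m : ℕ) : Fin m → ℤ := fun i => -(i : ℤ)

/-- The left action of `U(𝔟)` on the bimodule `R_μ`, which is `R` as an `R`-module: the element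
`b` acts as multiplication by `defChar μ b`, so `e_{ii}` acts by `μ_i + z_i` and `e_{ij}`, for
`i < j`, by zero. -/
def defChar {m : ℕ} (mu : Fin m → ℤ) : Ub m →ₐ[ℂ] R m :=
  borelChar fun i => (mu i : R m) + MvPowerSeries.X i

/-- The relations `u b ⊗ r = u ⊗ b r` that define `U(𝔤) ⊗_{U(𝔟)} R_μ` as a quotient of
`U(𝔤) ⊗_ℂ R`. -/
def defVermaRel {m : ℕ} (mu : Fin m → ℤ) : Submodule (A m) (A m) :=
  Submodule.span (A m) {t | ∃ (u : Ug m) (b : Ub m) (r : R m),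
    t = (u * borelIncl m b) ⊗ₜ[ℂ] r - u ⊗ₜ[ℂ] (defChar mu b * r)}

/-- The deformed Verma module `M̃(λ) = U(𝔤) ⊗_{U(𝔟)} R_{λ-ρ}`. -/
def defVerma {m : ℕ} (l : Fin m → ℤ) : ModuleCat.{0} (A m) :=
  ModuleCat.of (A m) (A m ⧸ defVermaRel (l - rho m))

/-- The `𝔤`-module `U(𝔤) ⊗_{U(𝔟)} ℂ_μ`, where `e_{ii}` acts on `ℂ_μ = ℂ` by `μ_i` and `e_{ij}`,
for `i < j`, by zero. It is the quotient of `U(𝔤) ⊗_ℂ ℂ = U(𝔤)` by the relations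
`u b ⊗ 1 = u ⊗ b 1`. -/
def vermaRel {m : ℕ} (mu : Fin m → ℤ) : Submodule (Ug m) (Ug m) :=
  Submodule.span (Ug m) {t | ∃ (u : Ug m) (b : Ub m),
    t = u * borelIncl m b - (borelChar (fun i => (mu i : ℂ)) b) • u}

/-- The map `U(𝔤) ⊗ R → U(𝔤)` given by the residue map `R → ℂ`. -/
def residue (m : ℕ) : A m →ₐ[ℂ] Ug m :=
  (Algebra.TensorProduct.rid ℂ ℂ (Ug m)).toAlgHom.comp
    (Algebra.TensorProduct.map (AlgHom.id ℂ (Ug m))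
      ({ MvPowerSeries.constantCoeff (σ := Fin m) (R := ℂ) with
          commutes' := fun c => by simp [MvPowerSeries.algebraMap_apply] } : R m →ₐ[ℂ] ℂ))

/-- The Verma module `M(λ) = U(𝔤) ⊗_{U(𝔟)} ℂ_{λ-ρ}`, with the trivial action of `R`, i.e. `R`
acts through its residue field `ℂ`. -/
def verma {m : ℕ} (l : Fin m → ℤ) : ModuleCat.{0} (A m) :=
  (ModuleCat.restrictScalars (residue m).toRingHom).obj
    (ModuleCat.of (Ug m) (Ug m ⧸ vermaRel (l - rho m)))

/-! ### The restricted dual -/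

section Dual

variable {m : ℕ} (M : Type) [AddCommGroup M] [Module ℂ M] [Module (A m) M]
  [IsScalarTower ℂ (A m) M]

variable {M} in
theorem single_smul_mem {l : Fin m → ℤ} {v : M} (hv : v ∈ weightSpace M l) (a b : Fin m) (c : ℂ) :
    lieElt (Matrix.single a b c) • v ∈
      weightSpace M (l + (Pi.single a 1 - Pi.single b 1)) := by
  intro i
  have hcomm : lieElt (unitMat i i) * lieElt (Matrix.single a b c) =
      lieElt (Matrix.single a b c) * lieElt (unitMat i i) +
      (((Pi.single a 1 - Pi.single b 1 : Fin m → ℤ) i : ℤ) : ℂ) •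
        lieElt (Matrix.single a b c) := by
    rw [← sub_eq_iff_eq_add', lieElt_comm, ← lieElt_smul]
    congr 1
    ext p q
    by_cases hia : i = a <;> by_cases hib : i = b <;>
      by_cases hpa : a = p <;> by_cases hqb : b = q <;>
      simp_all [Matrix.mul_apply, Matrix.single_apply, Pi.single_apply, eq_comm]
  have := congrArg (fun w => lieElt (Matrix.single a b c) • w) (hv i)
  simp only [smul_sub, ← mul_smul, ← coeffElt_commute] at this
  rw [← mul_smul, ← mul_smul, hcomm, ← this, add_smul, smul_assoc, smul_comm (lieElt _) (l i : ℂ) v,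
    Pi.add_apply, Int.cast_add, add_smul]
  abel

/-- The restricted dual `⨁_λ Hom_ℂ(M_(λ), ℂ)` of a module with a weight space decomposition,
realized as the space of the linear forms on `M` that vanish on all but finitely many of the
weight spaces. -/
def dualSubspace : Submodule ℂ (Module.Dual ℂ M) where
  carrier := {f | {l : Fin m → ℤ | ∃ v ∈ weightSpace M l, f v ≠ 0}.Finite}
  zero_mem' := by simp
  add_mem' := by
    intro f g hf hg
    refine (Set.Finite.union hf hg).subset ?_
    rintro l ⟨v, hv, h⟩
    by_cases hfv : f v = 0
    · refine Or.inr ⟨v, hv, fun hgv => h ?_⟩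
      rw [LinearMap.add_apply, hfv, hgv, add_zero]
    · exact Or.inl ⟨v, hv, hfv⟩
  smul_mem' := by
    intro c f hf
    refine Set.Finite.subset hf ?_
    rintro l ⟨v, hv, h⟩
    refine ⟨v, hv, fun hfv => h ?_⟩
    rw [LinearMap.smul_apply, hfv, smul_zero]

variable {M}

/-- Composing linear forms with the action of `a`. -/
def precomp (a : A m) (f : Module.Dual ℂ M) : Module.Dual ℂ M :=
  f.comp (Algebra.lsmul ℂ ℂ M a)

theorem precomp_lieElt_mem (x : Gl m) (f : Module.Dual ℂ M) (hf : f ∈ dualSubspace (m := m) M) :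
    precomp (lieElt x) f ∈ dualSubspace (m := m) M := by
  induction x using Matrix.induction_on' with
  | h_zero =>
    have : precomp (lieElt (0 : Gl m)) f = 0 := by
      ext v; simp [precomp, lieElt]
    rw [this]; exact zero_mem _
  | h_add x y hx hy =>
    have : precomp (lieElt (x + y)) f = precomp (lieElt x) f + precomp (lieElt y) f := by
      ext v; simp [precomp, lieElt_add]
    rw [this]; exact add_mem hx hy
  | h_std_basis a b c =>
    have hinj : Set.InjOn (fun l : Fin m → ℤ => l + (Pi.single a 1 - Pi.single b 1))
        ((fun l : Fin m → ℤ => l + (Pi.single a 1 - Pi.single b 1)) ⁻¹'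
          {l | ∃ v ∈ weightSpace M l, f v ≠ 0}) := fun _ _ _ _ h => add_right_cancel h
    refine (Set.Finite.preimage hinj hf).subset ?_
    rintro l ⟨v, hv, h⟩
    exact ⟨_, single_smul_mem hv a b c, h⟩

theorem precomp_coeffElt_mem (r : R m) (f : Module.Dual ℂ M) (hf : f ∈ dualSubspace (m := m) M) :
    precomp (coeffElt r : A m) f ∈ dualSubspace (m := m) M := by
  refine Set.Finite.subset hf ?_
  rintro l ⟨v, hv, h⟩
  refine ⟨_, ?_, h⟩
  intro i
  change lieElt (unitMat i i) • (coeffElt r : A m) • v - (l i : ℂ) • (coeffElt r : A m) • v =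
    (coeffElt (MvPowerSeries.X i) : A m) • (coeffElt r : A m) • v
  rw [← mul_smul, ← mul_smul, ← coeffElt_commute, coeffElt_commute (MvPowerSeries.X i), mul_smul,
    mul_smul, ← hv i, smul_sub, smul_comm (l i : ℂ)]

variable (M)

/-- The `𝔤`-action on the restricted dual: `(x f)(v) = f(xᵀ v)`. -/
def dualLie : Gl m →ₗ⁅ℂ⁆ Module.End ℂ (dualSubspace (m := m) M) where
  toFun x :=
    { toFun := fun f => ⟨precomp (lieElt x.transpose) f, precomp_lieElt_mem _ _ f.2⟩
      map_add' := fun f g => by ext v; simp [precomp]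
      map_smul' := fun c f => by ext v; simp [precomp] }
  map_add' x y := by
    ext f v
    simp [precomp, lieElt_add]
  map_smul' c x := by
    ext f v
    simp [precomp, lieElt_smul]
  map_lie' := by
    intro x y
    ext f v
    simp only [LieRing.of_associative_ring_bracket, Matrix.transpose_sub, Matrix.transpose_mul,
      ← lieElt_comm]
    simp [precomp]

/-- The `R`-action on the restricted dual: `(f r)(v) = f(v r)`. -/
def dualCoeff : R m →ₐ[ℂ] Module.End ℂ (dualSubspace (m := m) M) where
  toFun r :=
    { toFun := fun f => ⟨precomp (coeffElt r : A m) f, precomp_coeffElt_mem _ _ f.2⟩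
      map_add' := fun f g => by ext v; simp [precomp]
      map_smul' := fun c f => by ext v; simp [precomp] }
  map_add' r s := by
    ext f v
    simp [precomp, coeffElt, TensorProduct.tmul_add]
  map_zero' := by
    ext f v
    simp [precomp, coeffElt]
  map_one' := by
    ext f v
    simp [precomp, coeffElt, ← Algebra.TensorProduct.one_def]
  map_mul' r s := by
    ext f v
    have : (coeffElt (r * s) : A m) = coeffElt s * coeffElt r := by
      simp [coeffElt, mul_comm]
    simp [precomp, this]
  commutes' c := by
    ext f v
    have : (coeffElt (algebraMap ℂ (R m) c) : A m) = algebraMap ℂ (A m) c := by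
      rw [coeffElt, Algebra.algebraMap_eq_smul_one, Algebra.algebraMap_eq_smul_one,
        TensorProduct.tmul_smul, Algebra.TensorProduct.one_def]
    change (f : Module.Dual ℂ M) ((coeffElt (algebraMap ℂ (R m) c) : A m) • v) = _
    rw [this, algebraMap_smul, map_smul]
    simp [Module.algebraMap_end_apply]

/-- The action of `U(𝔤) ⊗ R` on the restricted dual. -/
def dualAction : A m →ₐ[ℂ] Module.End ℂ (dualSubspace (m := m) M) :=
  Algebra.TensorProduct.lift (UniversalEnvelopingAlgebra.lift ℂ (dualLie M)) (dualCoeff M) (by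
    intro u r
    have hm : u ∈ Algebra.adjoin ℂ (Set.range (UniversalEnvelopingAlgebra.ι ℂ : Gl m → _)) := by
      rw [adjoin_range_ι]; trivial
    induction hm using Algebra.adjoin_induction with
    | mem y hy =>
      obtain ⟨x, rfl⟩ := hy
      rw [UniversalEnvelopingAlgebra.lift_ι_apply]
      refine LinearMap.ext fun f => Subtype.ext (LinearMap.ext fun v => ?_)
      change (f : Module.Dual ℂ M) ((coeffElt r : A m) • lieElt x.transpose • v) =
        (f : Module.Dual ℂ M) (lieElt x.transpose • (coeffElt r : A m) • v)
      rw [← mul_smul, ← mul_smul, coeffElt_commute]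
    | algebraMap c =>
      rw [AlgHom.commutes]; exact Algebra.commute_algebraMap_left _ _
    | add y z _ _ hy hz => rw [map_add]; exact hy.add_left hz
    | mul y z _ _ hy hz => rw [map_mul]; exact hy.mul_left hz)

/-- The type underlying the restricted dual, as a `U(𝔤) ⊗ R`-module. -/
def RestrictedDual (m : ℕ) (M : Type) [AddCommGroup M] [Module ℂ M] [Module (A m) M]
    [IsScalarTower ℂ (A m) M] : Type := dualSubspace (m := m) M

instance : AddCommGroup (RestrictedDual m M) :=
  inferInstanceAs (AddCommGroup (dualSubspace (m := m) M))

instance : Module (A m) (RestrictedDual m M) :=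
  letI : Module (Module.End ℂ (dualSubspace (m := m) M)) (RestrictedDual m M) :=
    inferInstanceAs (Module (Module.End ℂ (dualSubspace (m := m) M)) (dualSubspace (m := m) M))
  Module.compHom (RestrictedDual m M) (dualAction M).toRingHom

end Dual

/-- The restricted dual `M^∨` of a `(𝔤, R)`-bimodule `M`. -/
def dual {m : ℕ} (M : ModuleCat.{0} (A m)) : ModuleCat.{0} (A m) :=
  ModuleCat.of (A m) (RestrictedDual m M)

end DeformedBGG

end

/-! Call an object of `Otil m` lower projective if it is projective over the subalgebra U(𝔫₋) ⊗ R.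
These objects compute Ext into a dual Verma module. They cover the category, they are closed under
kernels of epimorphisms, and homomorphisms into M(μ)^∨ extend along every monomorphism whose
cokernel is lower projective. Given this, a class in Ext¹(X, M(μ)^∨) with X lower projective becomes
zero on some epimorphism onto X, so it is the connecting image of a homomorphism from the kernel.
That homomorphism extends, hence the class is zero. Higher degrees follow by dimension shifting
(`eq_zero_of_extension_property`), and the deformed Verma module is itself lower projective.

Covers: a finite set of generators of M lies in a finite-dimensional 𝔫₊-stable space W spanned by
weight vectors. Subtracting z_i from the action of e_{ii} makes W a 𝔟-module, and M is a quotient of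
the module induced from R ⊗ W (`exists_induced_surjective`). The induced module is built directly on
U(𝔫₋) ⊗ R ⊗ W, so it is visibly free over U(𝔫₋) ⊗ R and no PBW theorem is needed.

Extension: composing with evaluation at the highest weight vector turns homomorphisms X → M(μ)^∨
into linear forms on X that kill 𝔫₋X, on which R acts through its residue field and e_{ii} by (μ -
ρ)_i (`isVermaForm_of_hom`, `IsVermaForm.exists_hom`). An exact sequence with lower projective
cokernel splits over U(𝔫₋) ⊗ R. Composing a form with the retraction keeps the conditions on 𝔫₋ and
R, and projecting to the weight μ - ρ restores the condition on the e_{ii} (`exists_extension`).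

Degree zero: a form of this kind on M̃(λ) is determined by its value at the generator, which has
weight λ - ρ. So it vanishes if λ ≠ μ; if λ = μ, the augmentation of U(𝔫₋) ⊗ R gives one with value
1.

Membership is easy for M̃(λ), which is generated by a highest weight vector. For M(μ)^∨ the point is
finite generation: the Casimir element acts by one scalar, only finitely many weights are compatible
with that scalar, and their finite-dimensional weight spaces generate (`weightSpace_dual_le`). -/

/-! ### Effaceability of Ext and a vanishing criterion. -/

section ExtVanishing

open Limits CochainComplex

universe w v u

variable {C : Type u} [Category.{v} C] [Abelian C]

/-- A quasi-isomorphism from a complex in degrees `≤ i` to a single complex in degree `i` is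
an epimorphism in degree `i`. -/
theorem CochainComplex.epi_f_of_quasiIsoAt_single {X : C} {K : CochainComplex C ℤ} {i : ℤ}
    (π : K ⟶ (HomologicalComplex.single C (ComplexShape.up ℤ) i).obj X) [K.IsStrictlyLE i] [QuasiIsoAt π i] :
    Epi (π.f i) := by
  -- The complex is zero in degree i + 1, so everything in degree i is a cycle.
  let e := K.iCyclesIso i (i + 1) (by simp)
    ((K.isZero_of_isStrictlyLE i (i + 1) (by simp)).eq_of_tgt _ _)
  -- The composite K^i ≅ Z^i ↠ H^i(K) ≅ X: an epimorphism followed by isomorphisms.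
  let α := e.inv ≫ K.homologyπ i ≫ HomologicalComplex.homologyMap π i ≫
    (HomologicalComplex.singleObjHomologySelfIso _ _ _).hom
  have : π.f i = α ≫ (HomologicalComplex.singleObjXSelf (ComplexShape.up ℤ) i X).inv := by
    rw [← cancel_epi e.hom]
    dsimp [α, e]
    rw [Category.assoc, Category.assoc, Category.assoc, Iso.hom_inv_id_assoc,
      HomologicalComplex.homologyπ_naturality_assoc]
    change K.iCycles i ≫ π.f i = _
    rw [HomologicalComplex.homologyπ_singleObjHomologySelfIso_hom_assoc,
      ← HomologicalComplex.singleObjCyclesSelfIso_inv_iCycles, Iso.hom_inv_id_assoc,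
      ← HomologicalComplex.cyclesMap_i]
  rw [this]
  infer_instance

namespace CategoryTheory.Abelian.Ext

/-- Extension classes of positive degree are effaceable in the first variable. -/
theorem exists_epi_comp_eq_zero [HasExt.{w} C] {X Y : C} {n : ℕ} (e : Ext X Y (n + 1)) :
    ∃ (P : C) (p : P ⟶ X), Epi p ∧ (mk₀ p).comp e (zero_add _) = 0 := by
  let := HasDerivedCategory.standard C
  -- Identifies Y[n+1] with Y placed in degree -(n+1), so that the class becomes a morphism between
  -- single complexes.
  let s := ((DerivedCategory.singleFunctors C).shiftIso ((n : ℤ) + 1) (-(n + 1)) 0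
    (by lia)).hom.app Y
  let φ : DerivedCategory.Q.obj ((singleFunctor C 0).obj X) ⟶
    DerivedCategory.Q.obj ((singleFunctor C (-(n + 1))).obj Y) := e.hom ≫ s
  -- A roof X ← K → Y[n+1] with K concentrated in degrees ≤ 0. The required cover is K⁰ → X.
  obtain ⟨K, _, π, h, g, hφ⟩ := DerivedCategory.right_fac_of_isStrictlyLE φ 0
  rw [DerivedCategory.isIso_Q_map_iff_quasiIso] at h
  let ϖ : K ⟶ (HomologicalComplex.single C (ComplexShape.up ℤ) 0).obj X := π
  have : QuasiIsoAt ϖ 0 := h.quasiIsoAt 0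
  have := CochainComplex.epi_f_of_quasiIsoAt_single ϖ
  let j : (HomologicalComplex.single C (ComplexShape.up ℤ) 0).obj (K.X 0) ⟶ K :=
    HomologicalComplex.mkHomFromSingle (𝟙 _) (by
      rintro _ rfl
      apply (K.isZero_of_isStrictlyLE 0 _ (by simp)).eq_of_tgt)
  let p : K.X 0 ⟶ X := ϖ.f 0 ≫
    (HomologicalComplex.singleObjXSelf (ComplexShape.up ℤ) 0 X).hom
  have hp : (HomologicalComplex.single C (ComplexShape.up ℤ) 0).map p = j ≫ ϖ := by
    apply HomologicalComplex.from_single_hom_ext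
    simp [p, j, HomologicalComplex.single_map_f_self]
  refine ⟨K.X 0, p, inferInstance, ?_⟩
  apply homEquiv.injective
  change Ext.hom _ = Ext.hom _
  rw [comp_hom, mk₀_hom, zero_hom, ShiftedHom.mk₀_comp, ← cancel_mono s, Limits.zero_comp,
    Category.assoc]
  change DerivedCategory.Q.map ((singleFunctor C 0).map p) ≫ φ = 0
  have hπ : IsIso (DerivedCategory.Q.map π) := by
    rwa [DerivedCategory.isIso_Q_map_iff_quasiIso]
  -- K⁰ sits in degree 0, where the target, concentrated in degree -(n+1) < 0, vanishes.
  have hg : j ≫ g = 0 := by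
    apply HomologicalComplex.from_single_hom_ext
    apply ((singleFunctor C (-(n + 1))).obj Y |>.isZero_of_isStrictlyLE
      (-(n + 1)) 0 (by lia)).eq_of_tgt
  let ι : (singleFunctor C 0).obj (K.X 0) ⟶ K := j
  have hp' : (singleFunctor C 0).map p = ι ≫ π := hp
  have hg' : ι ≫ g = 0 := hg
  rw [hφ, hp', Functor.map_comp, Category.assoc, IsIso.hom_inv_id_assoc, ← Functor.map_comp,
    hg',
    Functor.map_zero]

/-- Vanishing of `Ext` against an object `N` to which morphisms from the subobjects with
quotient in `P` extend, for a class `P` of objects that covers all objects and is closed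
under kernels of epimorphisms. -/
theorem eq_zero_of_extension_property [HasExt.{w} C] (P : ObjectProperty C) (N : C)
    (hcover : ∀ X : C, ∃ (Q : C) (p : Q ⟶ X), Epi p ∧ P Q)
    (hker : ∀ S : ShortComplex C, S.ShortExact → P S.X₂ → P S.X₃ → P S.X₁)
    (hext : ∀ S : ShortComplex C, S.ShortExact → P S.X₃ →
      ∀ f : S.X₁ ⟶ N, ∃ g : S.X₂ ⟶ N, S.f ≫ g = f) :
    ∀ (n : ℕ) (X : C), P X → ∀ e : Ext X N (n + 1), e = 0 := by
  intro n
  induction n with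
  | zero =>
    intro X hX e
    obtain ⟨Z, q, _, hq⟩ := exists_epi_comp_eq_zero e
    let S := ShortComplex.mk _ _ (kernel.condition q)
    have hS : S.ShortExact := { exact := ShortComplex.exact_of_f_is_kernel _ (kernelIsKernel S.g) }
    -- Since `e` dies on `Z`, it is the connecting image of a morphism `ker q ⟶ N`. The extension
    -- property needs only that the quotient `X` is in `P`.
    obtain ⟨a, ha⟩ := contravariant_sequence_exact₃ hS N e hq (n₀ := 0) (by lia)
    obtain ⟨f, rfl⟩ := (mk₀_bijective _ _).2 a
    obtain ⟨g, hg⟩ := hext S hS hX f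
    rw [← ha, ← hg, ← mk₀_comp_mk₀, ← comp_assoc_of_second_deg_zero, hS.extClass_comp, zero_comp]
  | succ n ih =>
    intro X hX e
    obtain ⟨Z, q, _, hq⟩ := exists_epi_comp_eq_zero e
    -- Refining the effacing cover to an object of `P` puts the kernel in `P`, so the induction
    -- hypothesis applies to it.
    obtain ⟨Q, p, _, hQ⟩ := hcover Z
    let S := ShortComplex.mk _ _ (kernel.condition (p ≫ q))
    have hS : S.ShortExact := { exact := ShortComplex.exact_of_f_is_kernel _ (kernelIsKernel S.g) }
    obtain ⟨a, ha⟩ := contravariant_sequence_exact₃ hS N e (by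
      change (mk₀ (p ≫ q)).comp e _ = 0
      rw [← mk₀_comp_mk₀, comp_assoc_of_second_deg_zero, hq, comp_zero]) (n₀ := n + 1) (by lia)
    rw [← ha, ih _ (hker S hS hQ hX) a, comp_zero]

end CategoryTheory.Abelian.Ext

end ExtVanishing

/-! ### Induction of representations along a decomposition L = 𝔫 ⊕ 𝔟. -/

noncomputable section

section InducedRepresentation

variable {L : Type} [LieRing L] [LieAlgebra ℂ L] (n b : LieSubalgebra ℂ L)
  (pn : L →ₗ[ℂ] n) (pb : L →ₗ[ℂ] b)
  {E : Type} [AddCommGroup E] [Module ℂ E] (τ : b →ₗ⁅ℂ⁆ Module.End ℂ E)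

local notation "Un" => UniversalEnvelopingAlgebra ℂ n

/-- Left multiplication by `U(𝔫)` on `U(𝔫) ⊗ E`. -/
def tensorLeftMul (n E : Type) [LieRing n] [LieAlgebra ℂ n] [AddCommGroup E]
    [Module ℂ E] : UniversalEnvelopingAlgebra ℂ n →ₐ[ℂ]
      Module.End ℂ (UniversalEnvelopingAlgebra ℂ n ⊗[ℂ] E) :=
  AlgHom.ofLinearMap ((LinearMap.rTensorHom E).comp (Algebra.lmul ℂ _).toLinearMap)
    (by ext; simp) (fun u v => by ext; simp [mul_assoc])

theorem tensorLeftMul_tmul {n E : Type} [LieRing n] [LieAlgebra ℂ n] [AddCommGroup E]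
    [Module ℂ E] (u v : UniversalEnvelopingAlgebra ℂ n) (e : E) :
    tensorLeftMul n E u (v ⊗ₜ e) = (u * v) ⊗ₜ e := rfl

/-- Since U(𝔫) is generated by 𝔫, the space U(𝔫) ⊗ E is reached from 1 ⊗ E by sums and left
multiplications by elements of 𝔫. The identities for the induced action are checked along this
induction. -/
theorem tensorLeftMul_induction {n E : Type} [LieRing n] [LieAlgebra ℂ n] [AddCommGroup E]
    [Module ℂ E] {p : UniversalEnvelopingAlgebra ℂ n ⊗[ℂ] E → Prop}
    (hone : ∀ e, p (1 ⊗ₜ e)) (hadd : ∀ v w, p v → p w → p (v + w))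
    (hmul : ∀ (y : n) w, p w → p (tensorLeftMul n E (UniversalEnvelopingAlgebra.ι ℂ y) w))
    (w) : p w := by
  -- Quantifying over the right factor `v` makes the claim stable under products in `u`.
  have key : ∀ u v : UniversalEnvelopingAlgebra ℂ n, (∀ e, p (v ⊗ₜ e)) →
      ∀ e, p ((u * v) ⊗ₜ e) := by
    intro u
    have hu : u ∈ Algebra.adjoin ℂ (Set.range (UniversalEnvelopingAlgebra.ι ℂ : n → _)) := by
      rw [DeformedBGG.adjoin_range_ι]; trivial
    induction hu using Algebra.adjoin_induction with
    | mem x hx =>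
      obtain ⟨y, rfl⟩ := hx
      exact fun v hv e => hmul y _ (hv e)
    | algebraMap c =>
      intro v hv e
      rw [← Algebra.smul_def, TensorProduct.smul_tmul]
      exact hv _
    | add u u' _ _ h h' =>
      intro v hv e
      rw [add_mul, TensorProduct.add_tmul]
      exact hadd _ _ (h v hv e) (h' v hv e)
    | mul u u' _ _ h h' =>
      intro v hv e
      rw [mul_assoc]
      exact h _ (h' v hv) e
  induction w using TensorProduct.induction_on with
  | zero => simpa using hone 0
  | tmul u e => simpa using key u 1 hone e
  | add v w hv hw => exact hadd _ _ hv hw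

/-- The `𝔫`-action on `Hom(L, U(𝔫) ⊗ E)`. -/
def homLie : n →ₗ⁅ℂ⁆ Module.End ℂ (L →ₗ[ℂ] Un ⊗[ℂ] E) where
  toFun y :=
    { toFun := fun f => (tensorLeftMul n E (UniversalEnvelopingAlgebra.ι ℂ y)).comp f -
        f.comp (LieModule.toEnd ℂ L L y)
      map_add' := fun f g => by ext; simp; abel
      map_smul' := fun c f => by ext; simp [smul_sub] }
  map_add' y z := by ext; simp; abel
  map_smul' c y := by ext; simp [smul_sub]
  map_lie' := by
    intro y z
    ext f x
    simp [LieRing.of_associative_ring_bracket]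
    abel

theorem homLie_apply (y : n) (f : L →ₗ[ℂ] Un ⊗[ℂ] E) (x : L) : homLie (E := E) n y f x =
    tensorLeftMul n E (UniversalEnvelopingAlgebra.ι ℂ y) (f x) - f ⁅(y : L), x⁆ := rfl

/-- The elements of `1 ⊗ E`, as maps from `L`. -/
def inducedBase : E →ₗ[ℂ] L →ₗ[ℂ] Un ⊗[ℂ] E where
  toFun e := ((TensorProduct.mk ℂ Un E).flip e).comp
      (((UniversalEnvelopingAlgebra.ι ℂ : n →ₗ⁅ℂ⁆ Un) : n →ₗ[ℂ] Un).comp pn) +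
    (TensorProduct.mk ℂ Un E 1).comp (((τ : b →ₗ[ℂ] Module.End ℂ E).flip e).comp pb)
  map_add' e e' := by ext; simp [TensorProduct.tmul_add]; abel
  map_smul' c e := by ext; simp

/-- The action of `L` on `U(𝔫) ⊗ E`, with the arguments exchanged. -/
def inducedFlip : Un ⊗[ℂ] E →ₗ[ℂ] L →ₗ[ℂ] Un ⊗[ℂ] E :=
  -- The rule x(yw) = y(xw) + [x, y]w, for y in 𝔫, says that w ↦ (x ↦ xw) is 𝔫-linear into Hom(L,
  -- U(𝔫) ⊗ E). So the action is forced by its values on 1 ⊗ E, and the universal property of U(𝔫)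
  -- provides it.
  TensorProduct.lift
    (((LinearMap.llcomp ℂ E _ _).flip (inducedBase n b pn pb τ)).comp
      (UniversalEnvelopingAlgebra.lift ℂ (homLie (E := E) n)).toLinearMap)

theorem inducedFlip_one_tmul (e : E) (x : L) : inducedFlip n b pn pb τ (1 ⊗ₜ e) x =
    UniversalEnvelopingAlgebra.ι ℂ (pn x) ⊗ₜ e + 1 ⊗ₜ τ (pb x) e := by
  simp [inducedFlip, inducedBase]

theorem inducedFlip_mul (y : n) (w : Un ⊗[ℂ] E) (x : L) :
    inducedFlip n b pn pb τ (tensorLeftMul n E (UniversalEnvelopingAlgebra.ι ℂ y) w) x =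
      tensorLeftMul n E (UniversalEnvelopingAlgebra.ι ℂ y) (inducedFlip n b pn pb τ w x) +
        inducedFlip n b pn pb τ w ⁅x, (y : L)⁆ := by
  induction w using TensorProduct.induction_on with
  | zero => simp
  | tmul u e =>
    rw [tensorLeftMul_tmul]
    have h : ∀ u : Un, inducedFlip n b pn pb τ (u ⊗ₜ e) = UniversalEnvelopingAlgebra.lift ℂ
      (homLie (E := E) n) u (inducedBase n b pn pb τ e) := fun _ => rfl
    rw [h, h, map_mul, UniversalEnvelopingAlgebra.lift_ι_apply, Module.End.mul_apply, homLie_apply,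
      ← lie_skew, map_neg, sub_neg_eq_add]
  | add v w hv hw =>
    simp only [map_add, LinearMap.add_apply, hv, hw]; abel

variable {n b pn pb}

/-- By induction: y(zw) = z(yw) + [y, z]w, and the right side is yzw in U(𝔫) ⊗ E once y and [y, z]
act on w by left multiplication. -/
theorem inducedFlip_of_mem (hn : ∀ y : n, pn y = y) (hb : ∀ y : n, pb y = 0) (y : n)
    (w : Un ⊗[ℂ] E) : inducedFlip n b pn pb τ w y =
      tensorLeftMul n E (UniversalEnvelopingAlgebra.ι ℂ y) w := by
  induction w using tensorLeftMul_induction generalizing y with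
  | hone e => simp [inducedFlip_one_tmul, hn, hb, tensorLeftMul_tmul]
  | hadd v w hv hw => simp [hv, hw]
  | hmul z w hw =>
    rw [inducedFlip_mul, hw, ← LieSubalgebra.coe_bracket, hw, LieHom.map_lie,
      LieRing.of_associative_ring_bracket]
    simp

/-- The inductive step is the Jacobi identity. On 1 ⊗ E it suffices that 𝔫 and 𝔟 are subalgebras
acting by representations; brackets between 𝔫 and 𝔟 are never evaluated. -/
theorem inducedFlip_lie (hn : ∀ y : n, pn y = y) (hb : ∀ y : n, pb y = 0)
    (hadd : ∀ x, (pn x : L) + pb x = x) (hb' : ∀ y : b, pb y = y) (hn' : ∀ y : b, pn y = 0)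
    (x y : L) (w : Un ⊗[ℂ] E) :
    inducedFlip n b pn pb τ w ⁅x, y⁆ =
      inducedFlip n b pn pb τ (inducedFlip n b pn pb τ w y) x -
      inducedFlip n b pn pb τ (inducedFlip n b pn pb τ w x) y := by
  induction w using tensorLeftMul_induction generalizing x y with
  | hone e =>
    set F := inducedFlip n b pn pb τ (1 ⊗ₜ e) with hF
    have h1 : ∀ x : L, F x = tensorLeftMul n E (UniversalEnvelopingAlgebra.ι ℂ (pn x)) (1 ⊗ₜ e) +
        1 ⊗ₜ τ (pb x) e := fun x => by
      rw [hF, inducedFlip_one_tmul, tensorLeftMul_tmul, mul_one]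
    have h2 : F ⁅(pn x : L), (pn y : L)⁆ =
        (UniversalEnvelopingAlgebra.ι ℂ (pn x) * UniversalEnvelopingAlgebra.ι ℂ (pn y)) ⊗ₜ e -
        (UniversalEnvelopingAlgebra.ι ℂ (pn y) * UniversalEnvelopingAlgebra.ι ℂ (pn x)) ⊗ₜ e := by
      rw [← LieSubalgebra.coe_bracket, h1, hn, hb, map_zero, LinearMap.zero_apply,
        TensorProduct.tmul_zero, add_zero, LieHom.map_lie, LieRing.of_associative_ring_bracket,
        tensorLeftMul_tmul, mul_one, TensorProduct.sub_tmul]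
    have h3 : F ⁅(pb x : L), (pb y : L)⁆ = 1 ⊗ₜ τ (pb x) (τ (pb y) e) -
        1 ⊗ₜ τ (pb y) (τ (pb x) e) := by
      rw [← LieSubalgebra.coe_bracket, h1, hb', hn', map_zero, map_zero, LinearMap.zero_apply,
        zero_add, LieHom.map_lie, LieRing.of_associative_ring_bracket, LinearMap.sub_apply,
        TensorProduct.tmul_sub]
      rfl
    -- Chosen so that the mixed brackets occur only as ⁅x, pn y⁆ and ⁅y, pn x⁆, the terms that `h5`
    -- leaves standing; they cancel.
    have h4 : ⁅x, y⁆ = ⁅x, (pn y : L)⁆ - ⁅y, (pn x : L)⁆ - ⁅(pn x : L), (pn y : L)⁆ +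
        ⁅(pb x : L), (pb y : L)⁆ := by
      conv_lhs => rw [← hadd x, ← hadd y]
      conv_rhs => enter [1, 1, 1]; rw [← hadd x]
      conv_rhs => enter [1, 1, 2]; rw [← hadd y]
      simp only [add_lie, lie_add]
      rw [← lie_skew (pn y : L) (pn x), ← lie_skew (pb y : L) (pn x)]
      abel
    have h5 : ∀ x y : L, inducedFlip n b pn pb τ (F y) x =
        (UniversalEnvelopingAlgebra.ι ℂ (pn y) * UniversalEnvelopingAlgebra.ι ℂ (pn x)) ⊗ₜ e +
        UniversalEnvelopingAlgebra.ι ℂ (pn y) ⊗ₜ τ (pb x) e + F ⁅x, (pn y : L)⁆ +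
        UniversalEnvelopingAlgebra.ι ℂ (pn x) ⊗ₜ τ (pb y) e + 1 ⊗ₜ τ (pb x) (τ (pb y) e) := by
      intro x y
      rw [h1 y, map_add, LinearMap.add_apply, inducedFlip_mul, inducedFlip_one_tmul, map_add,
        tensorLeftMul_tmul, tensorLeftMul_tmul, mul_one,
        inducedFlip_one_tmul n b pn pb τ (τ (pb y) e)]
      abel
    rw [h5, h5, h4, map_add, map_sub, map_sub, h2, h3]
    abel
  | hadd v w hv hw => simp only [map_add, LinearMap.add_apply, hv, hw]; abel
  | hmul z w hw =>
    simp only [inducedFlip_mul, map_add, LinearMap.add_apply, hw, map_sub, lie_lie]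
    abel

/-- The representation of `L = 𝔫 ⊕ 𝔟` on `U(𝔫) ⊗ E` induced by a representation of `𝔟`. -/
def inducedRep (hn : ∀ y : n, pn y = y) (hb : ∀ y : n, pb y = 0)
    (hadd : ∀ x, (pn x : L) + pb x = x) (hb' : ∀ y : b, pb y = y) (hn' : ∀ y : b, pn y = 0) :
    L →ₗ⁅ℂ⁆ Module.End ℂ (Un ⊗[ℂ] E) :=
  { (inducedFlip n b pn pb τ).flip with
    map_lie' := by
      intro x y
      exact LinearMap.ext fun w => inducedFlip_lie τ hn hb hadd hb' hn' x y w }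

end InducedRepresentation
end

/-! ### The triangular decomposition of 𝔤 and induced (𝔤, R)-bimodules. -/

noncomputable section

namespace DeformedBGG

/-- The subalgebra `𝔫₋` of strictly lower triangular matrices. -/
def lower (m : ℕ) : LieSubalgebra ℂ (Gl m) where
  carrier := {x | ∀ i j, i ≤ j → x i j = 0}
  zero_mem' := by intro i j _; rfl
  add_mem' := by
    intro x y hx hy i j h
    rw [Matrix.add_apply, hx i j h, hy i j h, add_zero]
  smul_mem' := by
    intro c x hx i j h
    rw [Matrix.smul_apply, hx i j h, smul_zero]
  lie_mem' := by
    have hmul : ∀ x y : Gl m, (∀ i j, i ≤ j → x i j = 0) → (∀ i j, i ≤ j → y i j = 0) →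
        ∀ i j, i ≤ j → (x * y) i j = 0 := by
      intro x y hx hy i j h
      rw [Matrix.mul_apply]
      refine Finset.sum_eq_zero fun k _ => ?_
      rcases le_or_gt i k with hk | hk
      · rw [hx i k hk, zero_mul]
      · rw [hy k j (hk.le.trans h), mul_zero]
    intro x y hx hy i j h
    rw [LieRing.of_associative_ring_bracket, Matrix.sub_apply, hmul x y hx hy i j h,
      hmul y x hy hx i j h, sub_zero]

/-- The projection `𝔤 → 𝔫₋` along `𝔟`. -/
def lowerProj (m : ℕ) : Gl m →ₗ[ℂ] lower m where
  toFun x := ⟨Matrix.of fun i j => if j < i then x i j else 0, fun i j h => by simp [h.not_gt]⟩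
  map_add' x y := by ext i j; by_cases h : j < i <;> simp [h]
  map_smul' c x := by ext i j; by_cases h : j < i <;> simp [h]

/-- The projection `𝔤 → 𝔟` along `𝔫₋`. -/
def borelProj (m : ℕ) : Gl m →ₗ[ℂ] borel m where
  toFun x := ⟨Matrix.of fun i j => if j < i then 0 else x i j, fun i j h => by simp [h]⟩
  map_add' x y := by ext i j; by_cases h : j < i <;> simp [h]
  map_smul' c x := by ext i j; by_cases h : j < i <;> simp [h]

theorem lowerProj_coe_lower {m : ℕ} (y : lower m) : lowerProj m y = y := by
  ext i j
  by_cases h : j < i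
  · simp [lowerProj, h]
  · simp [lowerProj, h, y.2 i j (not_lt.mp h)]

theorem borelProj_coe_lower {m : ℕ} (y : lower m) : borelProj m y = 0 := by
  ext i j
  by_cases h : j < i
  · simp [borelProj, h]
  · simp [borelProj, h, y.2 i j (not_lt.mp h)]

theorem lowerProj_coe_borel {m : ℕ} (y : borel m) : lowerProj m y = 0 := by
  ext i j
  by_cases h : j < i
  · simp [lowerProj, h, y.2 i j h]
  · simp [lowerProj, h]

theorem borelProj_coe_borel {m : ℕ} (y : borel m) : borelProj m y = y := by
  ext i j
  by_cases h : j < i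
  · simp [borelProj, h, y.2 i j h]
  · simp [borelProj, h]

theorem lowerProj_add_borelProj {m : ℕ} (x : Gl m) :
    (lowerProj m x : Gl m) + borelProj m x = x := by
  ext i j
  by_cases h : j < i <;> simp [lowerProj, borelProj, h]

/-- The character `x ↦ ∑ x_{ii} c_i` of `𝔟`. -/
def diagChar {m : ℕ} {S : Type} [CommRing S] [Algebra ℂ S] (c : Fin m → S) : Gl m →ₗ[ℂ] S where
  toFun x := ∑ i, x i i • c i
  map_add' x y := by simp [add_smul, Finset.sum_add_distrib]
  map_smul' t x := by simp [Finset.smul_sum, mul_smul]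

theorem borelChar_ι {m : ℕ} {S : Type} [CommRing S] [Algebra ℂ S] (c : Fin m → S) (x : borel m) :
    borelChar c (UniversalEnvelopingAlgebra.ι ℂ x) = diagChar c (x : Gl m) := by
  simp [borelChar, diagChar]

/-- On 𝔟 this is the restriction of an algebra map to a commutative ring, which kills commutators.
-/
theorem diagChar_lie {m : ℕ} {S : Type} [CommRing S] [Algebra ℂ S] (c : Fin m → S)
    (x y : borel m) : diagChar c ((⁅x, y⁆ : borel m) : Gl m) = 0 := by
  rw [← borelChar_ι, LieHom.map_lie, LieRing.of_associative_ring_bracket, map_sub, map_mul,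
    map_mul, mul_comm, sub_self]

section Induced

variable {m : ℕ} {W : Type} [AddCommGroup W] [Module ℂ W] (τ : borel m →ₗ⁅ℂ⁆ Module.End ℂ W)

/-- The `𝔟`-action on `R ⊗ W`, twisted by the character `e_{ii} ↦ z_i`. -/
def deformedBorelRep : borel m →ₗ⁅ℂ⁆ Module.End ℂ (R m ⊗[ℂ] W) where
  toFun x := (τ x).lTensor (R m) +
    (LinearMap.mul ℂ (R m) (diagChar MvPowerSeries.X (x : Gl m))).rTensor W
  map_add' x y := by
    ext r w; simp; abel
  map_smul' c x := by
    ext r w; simp [TensorProduct.smul_tmul']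
  map_lie' := by
    intro x y
    rw [diagChar_lie]
    ext r w
    simp [LieRing.of_associative_ring_bracket]
    rw [mul_left_comm]
    abel

theorem deformedBorelRep_tmul (x : borel m) (r : R m) (w : W) :
    deformedBorelRep τ x (r ⊗ₜ w) =
      r ⊗ₜ τ x w + (diagChar MvPowerSeries.X (x : Gl m) * r) ⊗ₜ w := rfl

/-- The module `U(𝔤) ⊗_{U(𝔟)} (R ⊗ W)`, realized as `U(𝔫₋) ⊗ R ⊗ W`. -/
def Induced (_τ : borel m →ₗ⁅ℂ⁆ Module.End ℂ W) : Type :=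
  UniversalEnvelopingAlgebra ℂ (lower m) ⊗[ℂ] (R m ⊗[ℂ] W)

instance : AddCommGroup (Induced τ) := inferInstanceAs
  (AddCommGroup (UniversalEnvelopingAlgebra ℂ (lower m) ⊗[ℂ] (R m ⊗[ℂ] W)))

instance : Module ℂ (Induced τ) := inferInstanceAs
  (Module ℂ (UniversalEnvelopingAlgebra ℂ (lower m) ⊗[ℂ] (R m ⊗[ℂ] W)))

/-- The pure tensors of the induced module. -/
def Induced.tmul (u : UniversalEnvelopingAlgebra ℂ (lower m)) (e : R m ⊗[ℂ] W) : Induced τ :=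
  u ⊗ₜ[ℂ] e

/-- The `𝔤`-action on the induced module. -/
def inducedLie : Gl m →ₗ⁅ℂ⁆ Module.End ℂ (Induced τ) :=
  inducedRep (deformedBorelRep τ) lowerProj_coe_lower borelProj_coe_lower
    lowerProj_add_borelProj borelProj_coe_borel lowerProj_coe_borel

/-- The `U(𝔫₋)`-action on the induced module by left multiplication. -/
def inducedLeft : UniversalEnvelopingAlgebra ℂ (lower m) →ₐ[ℂ] Module.End ℂ (Induced τ) :=
  tensorLeftMul (lower m) (R m ⊗[ℂ] W)

theorem inducedLeft_tmul (u v) (e : R m ⊗[ℂ] W) :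
    inducedLeft τ u (.tmul τ v e) = .tmul τ (u * v) e := rfl

variable {τ} in
theorem Induced.induction {p : Induced τ → Prop} (hone : ∀ e, p (.tmul τ 1 e))
    (hadd : ∀ v w, p v → p w → p (v + w))
    (hmul : ∀ (y : lower m) w, p w → p (inducedLeft τ (UniversalEnvelopingAlgebra.ι ℂ y) w))
    (w : Induced τ) : p w :=
  tensorLeftMul_induction hone hadd hmul w

variable {τ} in
theorem Induced.induction_tmul {p : Induced τ → Prop} (htmul : ∀ u e, p (.tmul τ u e))
    (hadd : ∀ v w, p v → p w → p (v + w)) (w : Induced τ) : p w := by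
  refine TensorProduct.induction_on (motive := p) w ?_ htmul hadd
  have := htmul 0 0
  rwa [Induced.tmul, TensorProduct.zero_tmul] at this

theorem inducedLie_tmul_one (x : Gl m) (e : R m ⊗[ℂ] W) : inducedLie τ x (.tmul τ 1 e) =
    .tmul τ (UniversalEnvelopingAlgebra.ι ℂ (lowerProj m x)) e +
      .tmul τ 1 (deformedBorelRep τ (borelProj m x) e) :=
  inducedFlip_one_tmul _ _ _ _ _ _ _

theorem inducedLie_left (x : Gl m) (y : lower m) (w : Induced τ) :
    inducedLie τ x (inducedLeft τ (UniversalEnvelopingAlgebra.ι ℂ y) w) =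
      inducedLeft τ (UniversalEnvelopingAlgebra.ι ℂ y) (inducedLie τ x w) +
        inducedLie τ ⁅x, (y : Gl m)⁆ w :=
  inducedFlip_mul _ _ _ _ _ _ _ _

theorem inducedLie_lower (y : lower m) :
    inducedLie τ (y : Gl m) = inducedLeft τ (UniversalEnvelopingAlgebra.ι ℂ y) :=
  LinearMap.ext fun w =>
    inducedFlip_of_mem (deformedBorelRep τ) lowerProj_coe_lower borelProj_coe_lower y w

variable (W) in
/-- The multiplication by an element of `R` on `R ⊗ W`. -/
def coeffMul : R m →ₐ[ℂ] Module.End ℂ (R m ⊗[ℂ] W) :=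
  AlgHom.ofLinearMap ((LinearMap.rTensorHom W).comp (Algebra.lmul ℂ _).toLinearMap)
    (by ext; simp) (fun u v => by ext; simp [mul_assoc])

theorem coeffMul_tmul (r s : R m) (w : W) : coeffMul W r (s ⊗ₜ w) = (r * s) ⊗ₜ w := rfl

theorem deformedBorelRep_coeffMul (x : borel m) (r : R m) (e : R m ⊗[ℂ] W) :
    deformedBorelRep τ x (coeffMul W r e) = coeffMul W r (deformedBorelRep τ x e) := by
  induction e using TensorProduct.induction_on with
  | zero => simp
  | tmul s w => simp only [coeffMul_tmul, deformedBorelRep_tmul, map_add, mul_left_comm]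
  | add e f he hf => rw [map_add, map_add, map_add, map_add, he, hf]

/-- The `R`-action on the induced module. -/
def inducedCoeff : R m →ₐ[ℂ] Module.End ℂ (Induced τ) :=
  AlgHom.ofLinearMap ((LinearMap.lTensorHom (UniversalEnvelopingAlgebra ℂ (lower m))).comp
    (coeffMul W).toLinearMap)
    (by
      change (coeffMul W 1).lTensor _ = _
      rw [map_one]
      exact LinearMap.lTensor_id _ _)
    (fun u v => by
      change (coeffMul W (u * v)).lTensor _ = _
      rw [map_mul]
      exact LinearMap.lTensor_comp _ _ _)

theorem inducedCoeff_tmul (r : R m) (u) (e : R m ⊗[ℂ] W) :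
    inducedCoeff τ r (.tmul τ u e) = .tmul τ u (coeffMul W r e) := rfl

theorem inducedCoeff_left (r : R m) (u) (w : Induced τ) :
    inducedCoeff τ r (inducedLeft τ u w) = inducedLeft τ u (inducedCoeff τ r w) := by
  induction w using Induced.induction_tmul with
  | htmul v e => rfl
  | hadd v w hv hw => rw [map_add, map_add, map_add, map_add, hv, hw]

theorem inducedLie_coeff (x : Gl m) (r : R m) (w : Induced τ) :
    inducedLie τ x (inducedCoeff τ r w) = inducedCoeff τ r (inducedLie τ x w) := by
  induction w using Induced.induction generalizing x with
  | hone e =>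
    rw [inducedCoeff_tmul, inducedLie_tmul_one, inducedLie_tmul_one, map_add, inducedCoeff_tmul,
      inducedCoeff_tmul, deformedBorelRep_coeffMul]
  | hadd v w hv hw => rw [map_add, map_add, map_add, map_add, hv, hw]
  | hmul y w hw =>
    rw [inducedCoeff_left, inducedLie_left, inducedLie_left, map_add, hw, hw, inducedCoeff_left]

/-- The action of `U(𝔤) ⊗ R` on the induced module. -/
def inducedAction : A m →ₐ[ℂ] Module.End ℂ (Induced τ) :=
  Algebra.TensorProduct.lift (UniversalEnvelopingAlgebra.lift ℂ (inducedLie τ)) (inducedCoeff τ) (by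
    intro u r
    have hm : u ∈ Algebra.adjoin ℂ (Set.range (UniversalEnvelopingAlgebra.ι ℂ : Gl m → _)) := by
      rw [adjoin_range_ι]; trivial
    induction hm using Algebra.adjoin_induction with
    | mem y hy =>
      obtain ⟨x, rfl⟩ := hy
      rw [UniversalEnvelopingAlgebra.lift_ι_apply]
      exact LinearMap.ext fun w => inducedLie_coeff τ x r w
    | algebraMap c =>
      rw [AlgHom.commutes]; exact Algebra.commute_algebraMap_left _ _
    | add y z _ _ hy hz => rw [map_add]; exact hy.add_left hz
    | mul y z _ _ hy hz => rw [map_mul]; exact hy.mul_left hz)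

instance : Module (A m) (Induced τ) := Module.compHom (Induced τ) (inducedAction τ).toRingHom

theorem Induced.smul_def (a : A m) (w : Induced τ) : a • w = inducedAction τ a w := rfl

instance : IsScalarTower ℂ (A m) (Induced τ) where
  smul_assoc c a w := by rw [Induced.smul_def, map_smul]; rfl

theorem Induced.lieElt_smul (x : Gl m) (w : Induced τ) : lieElt x • w = inducedLie τ x w := by
  simp [Induced.smul_def, inducedAction, lieElt]

theorem Induced.coeffElt_smul (r : R m) (w : Induced τ) :
    (coeffElt r : A m) • w = inducedCoeff τ r w := by
  simp [Induced.smul_def, inducedAction, coeffElt]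

variable (m) in
/-- The map `U(𝔫₋) → U(𝔤) ⊗ R`. -/
def lowerIncl : UniversalEnvelopingAlgebra ℂ (lower m) →ₐ[ℂ] A m :=
  Algebra.TensorProduct.includeLeft.comp
    (UniversalEnvelopingAlgebra.lift ℂ ((UniversalEnvelopingAlgebra.ι ℂ).comp (lower m).incl))

theorem lowerIncl_ι (y : lower m) :
    lowerIncl m (UniversalEnvelopingAlgebra.ι ℂ y) = lieElt (y : Gl m) := by
  simp [lowerIncl, lieElt]

/-- Both sides are algebra maps out of U(𝔫₋) that agree on 𝔫₋. This is what makes induced modules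
free over U(𝔫₋) ⊗ R. -/
theorem Induced.lowerIncl_smul (u) (w : Induced τ) : lowerIncl m u • w = inducedLeft τ u w := by
  have : (inducedAction τ).comp (lowerIncl m) = inducedLeft τ := by
    apply UniversalEnvelopingAlgebra.hom_ext
    refine LieHom.ext fun y => ?_
    change inducedAction τ (lowerIncl m (UniversalEnvelopingAlgebra.ι ℂ y)) =
      inducedLeft τ (UniversalEnvelopingAlgebra.ι ℂ y)
    rw [lowerIncl_ι, ← inducedLie_lower]
    exact LinearMap.ext fun w => Induced.lieElt_smul τ y w
  rw [← this]; rfl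

variable {X : Type} [AddCommGroup X] [Module ℂ X] [Module (A m) X] [IsScalarTower ℂ (A m) X]

/-- The `R`-linear extension of a map `W → X` to `R ⊗ W`. -/
def coeffExtend (g : W →ₗ[ℂ] X) : R m ⊗[ℂ] W →ₗ[ℂ] X :=
  TensorProduct.lift ((LinearMap.llcomp ℂ W X X).flip g ∘ₗ (Algebra.lsmul ℂ ℂ X).toLinearMap ∘ₗ
    (Algebra.TensorProduct.includeRight : R m →ₐ[ℂ] A m).toLinearMap)

theorem coeffExtend_tmul (g : W →ₗ[ℂ] X) (r : R m) (w : W) :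
    coeffExtend g (r ⊗ₜ w) = (coeffElt r : A m) • g w := rfl

theorem coeffExtend_coeffMul (g : W →ₗ[ℂ] X) (r : R m) (e : R m ⊗[ℂ] W) :
    coeffExtend g (coeffMul W r e) = (coeffElt r : A m) • coeffExtend g e := by
  induction e using TensorProduct.induction_on with
  | zero => simp
  | tmul s w => simp [coeffMul_tmul, coeffExtend_tmul, ← mul_smul, coeffElt]
  | add e f he hf => rw [map_add, map_add, map_add, smul_add, he, hf]

variable {τ} in
-- The hypothesis asks for equivariance after the z-part of the diagonal has been subtracted,
-- because the 𝔟-action on R ⊗ W adds that part back.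
theorem coeffExtend_deformedBorelRep (g : W →ₗ[ℂ] X)
    (hg : ∀ (x : borel m) w, g (τ x w) =
      lieElt (x : Gl m) • g w - (coeffElt (diagChar MvPowerSeries.X (x : Gl m)) : A m) • g w)
    (x : borel m) (e : R m ⊗[ℂ] W) :
    coeffExtend g (deformedBorelRep τ x e) = lieElt (x : Gl m) • coeffExtend g e := by
  induction e using TensorProduct.induction_on with
  | zero => simp
  | tmul r w =>
    rw [deformedBorelRep_tmul, map_add, coeffExtend_tmul, coeffExtend_tmul, coeffExtend_tmul, hg,
      smul_sub, ← mul_smul, ← mul_smul, ← mul_smul, coeffElt_commute]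
    have : (coeffElt (diagChar MvPowerSeries.X (x : Gl m) * r) : A m) =
        coeffElt r * coeffElt (diagChar MvPowerSeries.X (x : Gl m)) := by
      simp [coeffElt, mul_comm]
    rw [this]; abel
  | add e f he hf => rw [map_add, map_add, map_add, smul_add, he, hf]

/-- The linear map underlying `Induced.lift`. -/
def Induced.liftAux (g : W →ₗ[ℂ] X) : Induced τ →ₗ[ℂ] X :=
  TensorProduct.lift ((LinearMap.llcomp ℂ (R m ⊗[ℂ] W) X X).flip (coeffExtend g) ∘ₗ
    (Algebra.lsmul ℂ ℂ X).toLinearMap ∘ₗ (lowerIncl m).toLinearMap)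

theorem Induced.liftAux_tmul (g : W →ₗ[ℂ] X) (u) (e : R m ⊗[ℂ] W) :
    Induced.liftAux τ g (.tmul τ u e) = lowerIncl m u • coeffExtend g e := rfl

theorem Induced.liftAux_left (g : W →ₗ[ℂ] X) (u) (w : Induced τ) :
    Induced.liftAux τ g (inducedLeft τ u w) = lowerIncl m u • Induced.liftAux τ g w := by
  induction w using Induced.induction_tmul with
  | htmul v e => rw [inducedLeft_tmul, liftAux_tmul, liftAux_tmul, map_mul, mul_smul]
  | hadd v w hv hw => rw [map_add, map_add, map_add, smul_add, hv, hw]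

variable {τ} in
-- The rule that moves x past an element of 𝔫₋ holds in `X` as well, so agreement on R ⊗ W, where it
-- comes from x = x₋ + x_𝔟, propagates.
theorem Induced.liftAux_lie (g : W →ₗ[ℂ] X)
    (hg : ∀ (x : borel m) w, g (τ x w) =
      lieElt (x : Gl m) • g w - (coeffElt (diagChar MvPowerSeries.X (x : Gl m)) : A m) • g w)
    (x : Gl m) (w : Induced τ) :
    Induced.liftAux τ g (inducedLie τ x w) = lieElt x • Induced.liftAux τ g w := by
  induction w using Induced.induction generalizing x with
  | hone e =>
    rw [inducedLie_tmul_one, map_add, liftAux_tmul, liftAux_tmul, liftAux_tmul, map_one, one_smul,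
      one_smul, coeffExtend_deformedBorelRep g hg, lowerIncl_ι, ← add_smul, ← lieElt_add,
      lowerProj_add_borelProj]
  | hadd v w hv hw => rw [map_add, map_add, map_add, smul_add, hv, hw]
  | hmul y w hw =>
    rw [inducedLie_left, map_add, liftAux_left, liftAux_left, hw, hw, lowerIncl_ι,
      LieRing.of_associative_ring_bracket, ← lieElt_comm, sub_smul, mul_smul, mul_smul]
    abel

theorem Induced.liftAux_coeff (g : W →ₗ[ℂ] X) (r : R m) (w : Induced τ) :
    Induced.liftAux τ g (inducedCoeff τ r w) = (coeffElt r : A m) • Induced.liftAux τ g w := by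
  induction w using Induced.induction_tmul with
  | htmul v e =>
    rw [inducedCoeff_tmul, liftAux_tmul, liftAux_tmul, coeffExtend_coeffMul, ← mul_smul,
      ← mul_smul, coeffElt_commute]
  | hadd v w hv hw => rw [map_add, map_add, map_add, smul_add, hv, hw]

variable {τ} in
/-- The universal property of the induced module. -/
def Induced.lift (g : W →ₗ[ℂ] X)
    (hg : ∀ (x : borel m) w, g (τ x w) =
      lieElt (x : Gl m) • g w - (coeffElt (diagChar MvPowerSeries.X (x : Gl m)) : A m) • g w) :
    Induced τ →ₗ[A m] X where
  toFun := Induced.liftAux τ g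
  map_add' := map_add _
  map_smul' a w := by
    rw [RingHom.id_apply]
    induction a using A_induction generalizing w with
    | hl x => rw [Induced.lieElt_smul, Induced.liftAux_lie g hg]
    | hr r => rw [Induced.coeffElt_smul, Induced.liftAux_coeff]
    | hadd a b ha hb => rw [add_smul, add_smul, map_add, ha, hb]
    | hmul a b ha hb => rw [mul_smul, mul_smul, ha, hb]

/-- The embedding of `W` into the induced module. -/
def Induced.incl : W →ₗ[ℂ] Induced τ where
  toFun w := .tmul τ 1 (1 ⊗ₜ w)
  map_add' v w := by
    rw [TensorProduct.tmul_add]; exact TensorProduct.tmul_add _ _ _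
  map_smul' c w := by
    rw [TensorProduct.tmul_smul]; exact TensorProduct.tmul_smul _ _ _

variable {τ} in
theorem Induced.lift_incl (g : W →ₗ[ℂ] X) (hg) (w : W) :
    Induced.lift (τ := τ) g hg (Induced.incl τ w) = g w := by
  change lowerIncl m 1 • (coeffElt 1 : A m) • g w = g w
  rw [map_one, one_smul, coeffElt, ← Algebra.TensorProduct.one_def, one_smul]

theorem Induced.tmul_eq_smul (u) (r : R m) (w : W) :
    Induced.tmul τ u (r ⊗ₜ w) = (lowerIncl m u * coeffElt r) • Induced.incl τ w := by
  rw [mul_smul, Induced.coeffElt_smul, Induced.lowerIncl_smul]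
  change _ = inducedLeft τ u (inducedCoeff τ r (.tmul τ 1 (1 ⊗ₜ w)))
  rw [inducedCoeff_tmul, inducedLeft_tmul, coeffMul_tmul, mul_one, mul_one]

theorem Induced.span_range_incl : Submodule.span (A m) (Set.range (Induced.incl τ)) = ⊤ := by
  rw [eq_top_iff]
  intro w _
  induction w using Induced.induction_tmul with
  | htmul u e =>
    induction e using TensorProduct.induction_on with
    | zero =>
      have : Induced.tmul τ u 0 = 0 := TensorProduct.tmul_zero _ _
      rw [this]; exact zero_mem _
    | tmul r w =>
      rw [Induced.tmul_eq_smul]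
      exact Submodule.smul_mem _ _ (Submodule.subset_span ⟨w, rfl⟩)
    | add e f he hf =>
      have : Induced.tmul τ u (e + f) = .tmul τ u e + .tmul τ u f := TensorProduct.tmul_add _ _ _
      rw [this]; exact add_mem (he trivial) (hf trivial)
  | hadd v w hv hw => exact add_mem (hv trivial) (hw trivial)

/-- The extra z-term is the one in the definition of `weightSpace`: a weight vector of τ becomes a
generalized weight vector of the same weight. -/
theorem Induced.lieElt_smul_incl (x : borel m) (w : W) :
    lieElt (x : Gl m) • Induced.incl τ w = Induced.incl τ (τ x w) +
      (coeffElt (diagChar MvPowerSeries.X (x : Gl m)) : A m) • Induced.incl τ w := by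
  rw [Induced.lieElt_smul, Induced.coeffElt_smul]
  change inducedLie τ _ (.tmul τ 1 (1 ⊗ₜ w)) =
    .tmul τ 1 (1 ⊗ₜ _) + inducedCoeff τ _ (.tmul τ 1 (1 ⊗ₜ w))
  have h0 : Induced.tmul τ 0 ((1 : R m) ⊗ₜ[ℂ] w) = 0 := TensorProduct.zero_tmul _ _
  rw [inducedLie_tmul_one, lowerProj_coe_borel, borelProj_coe_borel, map_zero, h0, zero_add,
    deformedBorelRep_tmul, inducedCoeff_tmul, coeffMul_tmul]
  exact TensorProduct.tmul_add _ _ _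

end Induced

end DeformedBGG

end

/-! ### Membership in Õ and covers by induced modules. -/

noncomputable section

namespace DeformedBGG

section Membership

variable {m : ℕ} {M : Type} [AddCommGroup M] [Module ℂ M] [Module (A m) M]
  [IsScalarTower ℂ (A m) M]

theorem algebraMap_mem_smul (N : Submodule (A m) M) (c : ℂ) {v : M} (hv : v ∈ N) : c • v ∈ N := by
  rw [← algebraMap_smul (A m) c v]; exact N.smul_mem _ hv

theorem coeffElt_zero : (coeffElt (0 : R m) : A m) = 0 := TensorProduct.tmul_zero _ _

theorem coeffElt_smul_mem_weightSpace (r : R m) {l : Fin m → ℤ} {v : M}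
    (hv : v ∈ weightSpace M l) : (coeffElt r : A m) • v ∈ weightSpace M l := by
  intro i
  rw [← mul_smul, ← mul_smul, ← coeffElt_commute, coeffElt_commute (MvPowerSeries.X i), mul_smul,
    mul_smul, ← hv i, smul_sub, smul_comm (l i : ℂ)]

variable (m) in
/-- The map `x ↦ lieElt x`, as a linear map. -/
def lieEltLinear : Gl m →ₗ[ℂ] A m where
  toFun := lieElt
  map_add' := lieElt_add
  map_smul' := lieElt_smul

theorem lieElt_eq_sum (x : Gl m) :
    lieElt x = ∑ i, ∑ j, (lieElt (Matrix.single i j (x i j)) : A m) := by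
  change lieEltLinear m x = ∑ i, ∑ j, lieEltLinear m _
  conv_lhs => rw [Matrix.matrix_eq_sum_single x]
  simp [map_sum]

variable (m M) in
/-- The submodule of the vectors that lie in a finite-dimensional `𝔫₊`-stable subspace. -/
def locallyFinitePart : Submodule (A m) M where
  carrier := {v | ∃ W : Submodule ℂ M, FiniteDimensional ℂ W ∧ v ∈ W ∧
    ∀ x ∈ nPlus m, ∀ w ∈ W, lieElt x • w ∈ W}
  zero_mem' := ⟨⊥, inferInstance, zero_mem _, by
    rintro x _ w hw
    rw [Submodule.mem_bot] at hw
    rw [hw, smul_zero]; exact zero_mem _⟩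
  add_mem' := by
    rintro v v' ⟨W, hW, hv, hst⟩ ⟨W', hW', hv', hst'⟩
    refine ⟨W ⊔ W', inferInstance, Submodule.add_mem_sup hv hv', ?_⟩
    intro x hx w hw
    obtain ⟨a, ha, b, hb, rfl⟩ := Submodule.mem_sup.mp hw
    rw [smul_add]
    exact Submodule.add_mem_sup (hst x hx a ha) (hst' x hx b hb)
  smul_mem' := by
    intro a v hv
    induction a using A_induction generalizing v with
    | hl x =>
      obtain ⟨W, hW, hv, hst⟩ := hv
      -- W + 𝔤W is finite-dimensional, and it is 𝔫₊-stable because y(zw) = [y, z]w + z(yw) with yw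
      -- in W.
      let act : Gl m →ₗ[ℂ] M →ₗ[ℂ] M := (Algebra.lsmul ℂ ℂ M).toLinearMap ∘ₗ lieEltLinear m
      refine ⟨W ⊔ Submodule.map₂ act ⊤ W, ?_, ?_, ?_⟩
      · have : FiniteDimensional ℂ (Submodule.map₂ act ⊤ W) :=
          Module.Finite.iff_fg.mpr (Submodule.FG.map₂ _ Module.Finite.fg_top
            (Module.Finite.iff_fg.mp hW))
        infer_instance
      · exact Submodule.mem_sup_right (Submodule.apply_mem_map₂ act (m := x) trivial hv)
      · intro y hy w hw
        obtain ⟨a, ha, b, hb, rfl⟩ := Submodule.mem_sup.mp hw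
        rw [smul_add]
        refine add_mem (Submodule.mem_sup_left (hst y hy a ha)) ?_
        have : Submodule.map₂ act ⊤ W ≤
            (W ⊔ Submodule.map₂ act ⊤ W).comap (Algebra.lsmul ℂ ℂ M (lieElt y)) := by
          rw [Submodule.map₂_le]
          intro z _ c hc
          change lieElt y • lieElt z • c ∈ W ⊔ Submodule.map₂ act ⊤ W
          rw [← mul_smul, ← sub_add_cancel (lieElt y * lieElt z) (lieElt z * lieElt y), add_smul,
            lieElt_comm, mul_smul]
          exact Submodule.mem_sup_right (add_mem
            (Submodule.apply_mem_map₂ act (m := y * z - z * y) trivial hc)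
            (Submodule.apply_mem_map₂ act (m := z) trivial (hst y hy c hc)))
        exact this hb
    | hr r =>
      obtain ⟨W, hW, hv, hst⟩ := hv
      refine ⟨W.map (Algebra.lsmul ℂ ℂ M (coeffElt r)), inferInstance, ⟨v, hv, rfl⟩, ?_⟩
      rintro x hx _ ⟨w, hw, rfl⟩
      refine ⟨lieElt x • w, hst x hx w hw, ?_⟩
      change (coeffElt r : A m) • lieElt x • w = lieElt x • (coeffElt r : A m) • w
      rw [← mul_smul, coeffElt_commute, mul_smul]
    | hadd a b ha hb =>
      obtain ⟨W, hW, hva, hst⟩ := ha hv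
      obtain ⟨W', hW', hvb, hst'⟩ := hb hv
      refine ⟨W ⊔ W', inferInstance, ?_, ?_⟩
      · rw [add_smul]; exact Submodule.add_mem_sup hva hvb
      intro x hx w hw
      obtain ⟨a, ha, b, hb, rfl⟩ := Submodule.mem_sup.mp hw
      rw [smul_add]
      exact Submodule.add_mem_sup (hst x hx a ha) (hst' x hx b hb)
    | hmul a b ha hb => rw [mul_smul]; exact ha (hb hv)

variable (m M) in
/-- The sum of the weight spaces. -/
def weightPart : Submodule (A m) M where
  __ := (⨆ l, weightSpace M (l : Fin m → ℤ)).toAddSubmonoid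
  smul_mem' := by
    intro a v hv
    change a • v ∈ ⨆ l, weightSpace M (l : Fin m → ℤ)
    change v ∈ ⨆ l, weightSpace M (l : Fin m → ℤ) at hv
    induction a using A_induction generalizing v with
    | hl x =>
      rw [lieElt_eq_sum, Finset.sum_smul]
      refine sum_mem fun i _ => ?_
      rw [Finset.sum_smul]
      refine sum_mem fun j _ => ?_
      induction hv using Submodule.iSup_induction' with
      | mem l v hv => exact Submodule.mem_iSup_of_mem _ (single_smul_mem hv _ _ _)
      | zero => rw [smul_zero]; exact zero_mem _
      | add v w _ _ hv hw => rw [smul_add]; exact add_mem hv hw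
    | hr r =>
      induction hv using Submodule.iSup_induction' with
      | mem l v hv => exact Submodule.mem_iSup_of_mem l (coeffElt_smul_mem_weightSpace r hv)
      | zero => rw [smul_zero]; exact zero_mem _
      | add v w _ _ hv hw => rw [smul_add]; exact add_mem hv hw
    | hadd a b ha hb => rw [add_smul]; exact add_mem (ha hv) (hb hv)
    | hmul a b ha hb => rw [mul_smul]; exact ha (hb hv)

/-- Locally finite vectors form a submodule, and so does the sum of the weight spaces; hence both
conditions need checking only on generators. -/
theorem isOtil_of_span (S : Set M) (hfin : S.Finite) (hspan : Submodule.span (A m) S = ⊤)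
    (hlf : ∀ v ∈ S, v ∈ locallyFinitePart m M)
    (hw : ∀ v ∈ S, v ∈ ⨆ l, weightSpace M (l : Fin m → ℤ)) : IsOtil m M where
  finite := ⟨⟨hfin.toFinset, by simpa using hspan⟩⟩
  locallyFinite := by
    have : Submodule.span (A m) S ≤ locallyFinitePart m M := Submodule.span_le.mpr hlf
    intro v
    exact this (by rw [hspan]; trivial)
  weight := by
    have : Submodule.span (A m) S ≤ weightPart m M := Submodule.span_le.mpr hw
    rw [weight_isInternal_iff, eq_top_iff]
    intro v _
    exact this (by rw [hspan]; trivial)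

/-- The unit matrices `e_{ii}`, as elements of `𝔟`. -/
def diagUnit (i : Fin m) : borel m :=
  ⟨unitMat i i, fun j k h => by
    rw [unitMat, Matrix.single_apply, if_neg]; rintro ⟨rfl, rfl⟩; exact lt_irrefl _ h⟩

theorem diagChar_diagUnit {S : Type} [CommRing S] [Algebra ℂ S] (c : Fin m → S) (i : Fin m) :
    diagChar c (diagUnit i : Gl m) = c i := by
  change ∑ j, (Matrix.single i i (1 : ℂ)) j j • c j = c i
  rw [Finset.sum_eq_single i]
  · simp
  · intro j _ hj; simp [hj.symm]
  · simp

theorem nPlus_le_borel {x : Gl m} (hx : x ∈ nPlus m) : x ∈ borel m := fun i j h => hx i j h.le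

theorem diagChar_nPlus {S : Type} [CommRing S] [Algebra ℂ S] (c : Fin m → S) {x : Gl m}
    (hx : x ∈ nPlus m) : diagChar c x = 0 := by
  change ∑ i, x i i • c i = 0
  exact Finset.sum_eq_zero fun i _ => by rw [hx i i le_rfl, zero_smul]

section

variable {W : Type} [AddCommGroup W] [Module ℂ W] (τ : borel m →ₗ⁅ℂ⁆ Module.End ℂ W)

/-- The copy of W is itself 𝔫₊-stable, since the twist by z involves only diagonal entries. The
hypothesis says that τ is diagonalizable on the torus with integral weights. -/
theorem Induced.isOtil [FiniteDimensional ℂ W]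
    (hτ : Submodule.span ℂ {w | ∃ κ : Fin m → ℤ, ∀ i, τ (diagUnit i) w = (κ i : ℂ) • w} = ⊤) :
    IsOtil m (Induced τ) := by
  have hlf : ∀ w, Induced.incl τ w ∈ locallyFinitePart m (Induced τ) := by
    intro w
    refine ⟨LinearMap.range (Induced.incl τ), inferInstance, ⟨w, rfl⟩, ?_⟩
    rintro x hx _ ⟨w, rfl⟩
    have := Induced.lieElt_smul_incl τ ⟨x, nPlus_le_borel hx⟩ w
    rw [this, diagChar_nPlus _ hx, coeffElt_zero, zero_smul (A m) (Induced.incl τ w), add_zero]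
    exact ⟨τ ⟨x, nPlus_le_borel hx⟩ w, rfl⟩
  have hw : ∀ w, Induced.incl τ w ∈ ⨆ l, weightSpace (Induced τ) (l : Fin m → ℤ) := by
    have : Submodule.span ℂ {w | ∃ κ : Fin m → ℤ, ∀ i, τ (diagUnit i) w = (κ i : ℂ) • w} ≤
        (⨆ l, weightSpace (Induced τ) (l : Fin m → ℤ)).comap (Induced.incl τ) := by
      rw [Submodule.span_le]
      rintro w ⟨κ, hκ⟩
      refine Submodule.mem_iSup_of_mem κ ?_
      intro i
      have := Induced.lieElt_smul_incl τ (diagUnit i) w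
      rw [diagChar_diagUnit, hκ i, map_smul] at this
      change lieElt (diagUnit i : Gl m) • _ - _ = _
      rw [this, add_sub_cancel_left]
    intro w
    exact this (by rw [hτ]; trivial)
  obtain ⟨s, hs⟩ := (Module.Finite.fg_top : (⊤ : Submodule ℂ W).FG)
  refine isOtil_of_span (Induced.incl τ '' s) (s.finite_toSet.image _) ?_ ?_ ?_
  · rw [eq_top_iff, ← Induced.span_range_incl, Submodule.span_le]
    rintro _ ⟨w, rfl⟩
    have hw : w ∈ Submodule.span ℂ (s : Set W) := by rw [hs]; trivial
    have := Submodule.mem_map_of_mem (f := Induced.incl τ) hw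
    rw [Submodule.map_span] at this
    exact Submodule.span_le_restrictScalars ℂ (A m) _ this
  · rintro _ ⟨w, _, rfl⟩; exact hlf w
  · rintro _ ⟨w, _, rfl⟩; exact hw w

end

/-- A finite-dimensional subspace that is stable under `𝔫₊` and spanned by weight vectors. -/
structure IsWeightStable (W : Submodule ℂ M) : Prop where
  finite : FiniteDimensional ℂ W
  stable : ∀ x ∈ nPlus m, ∀ w ∈ W, lieElt x • w ∈ W
  weight : W ≤ ⨆ l : Fin m → ℤ, W ⊓ weightSpace M l

theorem IsWeightStable.sup {V W : Submodule ℂ M} (hV : IsWeightStable (m := m) V)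
    (hW : IsWeightStable (m := m) W) : IsWeightStable (m := m) (V ⊔ W) where
  finite := have := hV.finite; have := hW.finite; inferInstance
  stable := by
    intro x hx w hw
    obtain ⟨a, ha, b, hb, rfl⟩ := Submodule.mem_sup.mp hw
    rw [smul_add]
    exact Submodule.add_mem_sup (hV.stable x hx a ha) (hW.stable x hx b hb)
  weight := sup_le (hV.weight.trans (iSup_mono fun _ => inf_le_inf_right _ le_sup_left))
    (hW.weight.trans (iSup_mono fun _ => inf_le_inf_right _ le_sup_right))

theorem single_mem_nPlus {x : Gl m} (hx : x ∈ nPlus m) (i j : Fin m) :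
    Matrix.single i j (x i j) ∈ nPlus m := by
  intro a b hab
  rw [Matrix.single_apply]
  split_ifs with h
  · obtain ⟨rfl, rfl⟩ := h; exact hx _ _ hab
  · rfl

/-- An 𝔫₊-stable W need not be spanned by weight vectors, but the sum of its intersections with the
weight spaces is still 𝔫₊-stable: an element of 𝔫₊ is a sum of multiples of matrix units in 𝔫₊, and
these carry weight vectors to weight vectors. -/
theorem exists_isWeightStable_of_mem_weightSpace (hM : IsOtil m M) {l : Fin m → ℤ} {v : M}
    (hv : v ∈ weightSpace M l) :
    ∃ W : Submodule ℂ M, IsWeightStable (m := m) W ∧ v ∈ W := by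
  obtain ⟨W, hW, hvW, hst⟩ := hM.locallyFinite v
  set V := ⨆ l : Fin m → ℤ, W ⊓ weightSpace M l with hV
  have hVW : V ≤ W := iSup_le fun _ => inf_le_left
  have hmem : ∀ l : Fin m → ℤ, W ⊓ weightSpace M l ≤ V := fun l => le_iSup_of_le l le_rfl
  refine ⟨V, ⟨Submodule.finiteDimensional_of_le hVW, ?_, ?_⟩, hmem l ⟨hvW, hv⟩⟩
  · intro x hx w hw
    rw [lieElt_eq_sum, Finset.sum_smul]
    refine sum_mem fun i _ => ?_
    rw [Finset.sum_smul]
    refine sum_mem fun j _ => ?_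
    induction hw using Submodule.iSup_induction' with
    | mem l w hw =>
      exact hmem _ ⟨hst _ (single_mem_nPlus hx i j) w hw.1, single_smul_mem hw.2 _ _ _⟩
    | zero => rw [smul_zero]; exact zero_mem _
    | add v w _ _ hv hw => rw [smul_add]; exact add_mem hv hw
  · exact iSup_le fun l => le_iSup_of_le l (le_inf (hmem l) inf_le_right)

theorem exists_isWeightStable (hM : IsOtil m M) (v : M) :
    ∃ W : Submodule ℂ M, IsWeightStable (m := m) W ∧ v ∈ W := by
  have hv : v ∈ ⨆ l, weightSpace M (l : Fin m → ℤ) := by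
    rw [weight_isInternal_iff.mp hM.weight]; trivial
  induction hv using Submodule.iSup_induction' with
  | mem l v hv => exact exists_isWeightStable_of_mem_weightSpace hM hv
  | zero => exact exists_isWeightStable_of_mem_weightSpace hM (l := 0) (zero_mem _)
  | add v w _ _ hv hw =>
    obtain ⟨V, hV, hv⟩ := hv
    obtain ⟨W, hW, hw⟩ := hw
    exact ⟨V ⊔ W, hV.sup hW, Submodule.add_mem_sup hv hw⟩

theorem exists_isWeightStable_finset (hM : IsOtil m M) (s : Finset M) :
    ∃ W : Submodule ℂ M, IsWeightStable (m := m) W ∧ (s : Set M) ⊆ W := by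
  classical
  induction s using Finset.induction_on with
  | empty =>
    obtain ⟨W, hW, _⟩ := exists_isWeightStable hM 0
    exact ⟨W, hW, by simp⟩
  | insert v s _ ih =>
    obtain ⟨V, hV, hv⟩ := exists_isWeightStable hM v
    obtain ⟨W, hW, hs⟩ := ih
    refine ⟨V ⊔ W, hV.sup hW, ?_⟩
    rw [Finset.coe_insert, Set.insert_subset_iff]
    exact ⟨Submodule.mem_sup_left hv, fun w hw => Submodule.mem_sup_right (hs hw)⟩

variable (m) in
/-- The twist `x ↦ x - ∑ x_{ii} z_i` of the inclusion of `𝔤`. -/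
def twistElt : Gl m →ₗ[ℂ] A m :=
  lieEltLinear m - (Algebra.TensorProduct.includeRight : R m →ₐ[ℂ] A m).toLinearMap ∘ₗ
    diagChar MvPowerSeries.X

theorem twistElt_apply (x : Gl m) :
    twistElt m x = lieElt x - coeffElt (diagChar MvPowerSeries.X x) := rfl

/-- The z_i are central and the subtracted character vanishes on brackets of 𝔟. -/
theorem twistElt_lie (x y : borel m) : twistElt m ((⁅x, y⁆ : borel m) : Gl m) =
    twistElt m (x : Gl m) * twistElt m (y : Gl m) -
      twistElt m (y : Gl m) * twistElt m (x : Gl m) := by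
  simp only [twistElt_apply]
  rw [diagChar_lie, LieSubalgebra.coe_bracket, LieRing.of_associative_ring_bracket, ← lieElt_comm,
    coeffElt_zero, sub_mul, sub_mul, coeffElt_commute, coeffElt_commute _ (lieElt (x : Gl m) - _)]
  simp only [mul_sub, sub_mul]
  rw [coeffElt_commute (diagChar MvPowerSeries.X (x : Gl m)) (coeffElt _)]
  abel

/-- On a weight vector the twisted e_{ii} acts by the scalar λ_i. Untwisted it would produce z_i w,
which need not lie in W. Strictly upper triangular elements are not affected by the twist. -/
theorem IsWeightStable.twistElt_smul_mem {W : Submodule ℂ M} (hW : IsWeightStable (m := m) W)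
    (x : borel m) {w : M} (hw : w ∈ W) : twistElt m (x : Gl m) • w ∈ W := by
  have hdec : (x : Gl m) = Matrix.of (fun i j => if i < j then (x : Gl m) i j else 0) +
      ∑ i, (x : Gl m) i i • (diagUnit i : Gl m) := by
    ext a b
    rw [Matrix.add_apply, Matrix.sum_apply]
    simp only [Matrix.smul_apply, diagUnit, unitMat, Matrix.single_apply, Matrix.of_apply]
    rcases lt_trichotomy a b with h | rfl | h
    · rw [if_pos h, Finset.sum_eq_zero, add_zero]
      intro i _
      rw [if_neg, smul_zero]
      rintro ⟨rfl, rfl⟩; exact lt_irrefl _ h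
    · simp
    · rw [if_neg h.not_gt, x.2 a b h, Finset.sum_eq_zero, add_zero]
      intro i _
      rw [if_neg, smul_zero]
      rintro ⟨rfl, rfl⟩; exact lt_irrefl _ h
  have hn : Matrix.of (fun i j => if i < j then (x : Gl m) i j else 0) ∈ nPlus m := by
    intro i j h
    simp [h.not_gt]
  rw [hdec, map_add, map_sum, add_smul, Finset.sum_smul]
  refine add_mem ?_ (sum_mem fun i _ => ?_)
  · rw [twistElt_apply, diagChar_nPlus _ hn]
    rw [coeffElt_zero, sub_zero]
    exact hW.stable _ hn _ hw
  · rw [map_smul, smul_assoc]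
    refine W.smul_mem _ ?_
    have := hW.weight hw
    clear hw
    induction this using Submodule.iSup_induction' with
    | mem l w hw =>
      have := hw.2 i
      rw [twistElt_apply, diagChar_diagUnit, sub_smul, ← this]
      change lieElt (unitMat i i) • w - (lieElt (unitMat i i) • w - (l i : ℂ) • w) ∈ W
      rw [sub_sub_cancel]
      exact W.smul_mem _ hw.1
    | zero => rw [smul_zero]; exact zero_mem _
    | add v w _ _ hv hw => rw [smul_add]; exact add_mem hv hw

/-- The twisted action of `𝔟` on a stable subspace. -/
def IsWeightStable.rep {W : Submodule ℂ M} (hW : IsWeightStable (m := m) W) :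
    borel m →ₗ⁅ℂ⁆ Module.End ℂ W where
  toFun x := (Algebra.lsmul ℂ ℂ M (twistElt m (x : Gl m))).restrict
    fun _ hw => hW.twistElt_smul_mem x hw
  map_add' x y := by
    ext w
    change twistElt m ((x : Gl m) + y) • (w : M) = twistElt m (x : Gl m) • (w : M) +
      twistElt m (y : Gl m) • (w : M)
    rw [map_add, add_smul]
  map_smul' c x := by
    ext w
    change twistElt m (c • (x : Gl m)) • (w : M) = c • twistElt m (x : Gl m) • (w : M)
    rw [map_smul, smul_assoc]
  map_lie' := by
    intro x y
    ext w
    change twistElt m ((⁅x, y⁆ : borel m) : Gl m) • (w : M) =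
      twistElt m (x : Gl m) • twistElt m (y : Gl m) • (w : M) -
        twistElt m (y : Gl m) • twistElt m (x : Gl m) • (w : M)
    rw [twistElt_lie, sub_smul, mul_smul, mul_smul]

theorem IsWeightStable.span_weight {W : Submodule ℂ M} (hW : IsWeightStable (m := m) W) :
    Submodule.span ℂ {w | ∃ κ : Fin m → ℤ, ∀ i, hW.rep (diagUnit i) w = (κ i : ℂ) • w} = ⊤ := by
  rw [eq_top_iff]
  rintro ⟨w, hw⟩ _
  have h : W ≤ (Submodule.span ℂ {w | ∃ κ : Fin m → ℤ,
      ∀ i, hW.rep (diagUnit i) w = (κ i : ℂ) • w}).map W.subtype := by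
    refine hW.weight.trans (iSup_le fun l => ?_)
    rintro v hv
    refine ⟨⟨v, hv.1⟩, Submodule.subset_span ⟨l, fun i => ?_⟩, rfl⟩
    apply Subtype.ext
    change twistElt m (diagUnit i : Gl m) • v = (l i : ℂ) • v
    rw [twistElt_apply, diagChar_diagUnit, sub_smul, ← hv.2 i]
    exact sub_sub_cancel _ _
  obtain ⟨v, hv, rfl⟩ := h hw
  exact hv

/-- Every object of the deformed category is a quotient of an induced module. -/
theorem exists_induced_surjective (hM : IsOtil m M) :
    ∃ (W : Submodule ℂ M) (τ : borel m →ₗ⁅ℂ⁆ Module.End ℂ W) (f : Induced τ →ₗ[A m] M),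
      IsOtil m (Induced τ) ∧ Function.Surjective f := by
  obtain ⟨s, hs⟩ := hM.finite.fg_top
  obtain ⟨W, hW, hsW⟩ := exists_isWeightStable_finset hM s
  have := hW.finite
  -- W contains a finite set of generators, so extending its inclusion to the induced module gives a
  -- surjection.
  refine ⟨W, hW.rep, Induced.lift W.subtype (fun x w => ?_),
    Induced.isOtil _ hW.span_weight, ?_⟩
  · change twistElt m (x : Gl m) • (w : M) = _
    rw [twistElt_apply, sub_smul]; rfl
  · rw [← LinearMap.range_eq_top, eq_top_iff, ← hs, Submodule.span_le]
    intro v hv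
    exact ⟨Induced.incl _ ⟨v, hsW hv⟩, Induced.lift_incl _ _ _⟩

end Membership

end DeformedBGG

end

/-! ### Projectivity over U(𝔫₋) ⊗ R, and deformed Verma modules as induced modules. -/

noncomputable section

namespace DeformedBGG

section LowerProjective

variable {m : ℕ}

theorem algebraMap_eq_coeffElt (c : ℂ) :
    algebraMap ℂ (A m) c = coeffElt (algebraMap ℂ (R m) c) := by
  rw [coeffElt, Algebra.algebraMap_eq_smul_one, Algebra.algebraMap_eq_smul_one,
    TensorProduct.tmul_smul, Algebra.TensorProduct.one_def]

variable (m) in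
/-- The algebra `U(𝔫₋) ⊗ R`. -/
abbrev LowerAlg : Type := UniversalEnvelopingAlgebra ℂ (lower m) ⊗[ℂ] R m

variable (m) in
/-- The embedding of `U(𝔫₋) ⊗ R` into `U(𝔤) ⊗ R`. -/
def lowerAlgIncl : LowerAlg m →ₐ[ℂ] A m :=
  Algebra.TensorProduct.lift (lowerIncl m) Algebra.TensorProduct.includeRight
    fun u r => (coeffElt_commute r (lowerIncl m u)).symm

theorem lowerAlgIncl_tmul (u) (r : R m) : lowerAlgIncl m (u ⊗ₜ r) = lowerIncl m u * coeffElt r :=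
  rfl

variable (m) in
/-- Restriction of the action to `U(𝔫₋) ⊗ R`. -/
abbrev lowerModule (M : Type) [AddCommGroup M] [Module (A m) M] : Module (LowerAlg m) M :=
  Module.compHom M (lowerAlgIncl m).toRingHom

variable (m) in
/-- Projectivity over the subalgebra `U(𝔫₋) ⊗ R`. -/
def IsLowerProjective (M : Type) [AddCommGroup M] [Module (A m) M] : Prop :=
  letI := lowerModule m M
  Module.Projective (LowerAlg m) M

section

variable {K Q X : Type} [AddCommGroup K] [Module (A m) K] [AddCommGroup Q] [Module (A m) Q]
  [AddCommGroup X] [Module (A m) X]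

/-- The restriction of a linear map to `U(𝔫₋) ⊗ R`. -/
def lowerRestrict (f : K →ₗ[A m] Q) :
    letI := lowerModule m K
    letI := lowerModule m Q
    K →ₗ[LowerAlg m] Q :=
  letI := lowerModule m K
  letI := lowerModule m Q
  { toFun := f
    map_add' := map_add f
    map_smul' := fun b v => f.map_smul (lowerAlgIncl m b) v }

theorem IsLowerProjective.of_equiv (e : K ≃ₗ[A m] Q) (h : IsLowerProjective m K) :
    IsLowerProjective m Q := by
  let := lowerModule m K
  let := lowerModule m Q
  have : Module.Projective (LowerAlg m) K := h
  let e' : K ≃ₗ[LowerAlg m] Q :=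
    { lowerRestrict e.toLinearMap with
      invFun := e.symm
      left_inv := e.left_inv
      right_inv := e.right_inv }
  exact Module.Projective.of_equiv e'

/-- A projective cokernel splits the sequence. The retraction commutes with 𝔫₋ and R only, not with
the Borel subalgebra. -/
theorem IsLowerProjective.exists_retraction (h : IsLowerProjective m X) (f : K →ₗ[A m] Q)
    (g : Q →ₗ[A m] X) (hf : Function.Injective f) (hfg : Function.Exact f g)
    (hg : Function.Surjective g) :
    letI := lowerModule m K
    letI := lowerModule m Q
    ∃ s : Q →ₗ[LowerAlg m] K, s.comp (lowerRestrict f) = LinearMap.id := by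
  let := lowerModule m K
  let := lowerModule m Q
  let := lowerModule m X
  have : Module.Projective (LowerAlg m) X := h
  obtain ⟨t, ht⟩ := Module.projective_lifting_property (lowerRestrict g) LinearMap.id hg
  have hfg' : Function.Exact (lowerRestrict f) (lowerRestrict g) := hfg
  have hsplit : Function.Injective (lowerRestrict f) ∧
      ∃ t, (lowerRestrict g).comp t = LinearMap.id := ⟨hf, t, ht⟩
  have hret : Function.Surjective (lowerRestrict g) ∧
      ∃ s : Q →ₗ[LowerAlg m] K, s.comp (lowerRestrict f) = LinearMap.id := (hfg'.split_tfae'.out 0 1).mp hsplit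
  exact hret.2

/-- The splitting exhibits the kernel as a direct summand of the middle term. -/
theorem IsLowerProjective.of_exact (hQ : IsLowerProjective m Q) (hX : IsLowerProjective m X)
    (f : K →ₗ[A m] Q) (g : Q →ₗ[A m] X) (hf : Function.Injective f) (hfg : Function.Exact f g)
    (hg : Function.Surjective g) : IsLowerProjective m K := by
  let := lowerModule m K
  let := lowerModule m Q
  have : Module.Projective (LowerAlg m) Q := hQ
  obtain ⟨s, hs⟩ := hX.exists_retraction f g hf hfg hg
  exact Module.Projective.of_split (lowerRestrict f) s hs

end

section

variable {W : Type} [AddCommGroup W] [Module ℂ W] (τ : borel m →ₗ⁅ℂ⁆ Module.End ℂ W)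

theorem Induced.isLowerProjective : IsLowerProjective m (Induced τ) := by
  let := lowerModule m (Induced τ)
  -- Reassociation identifies the induced module with the base change of the vector space W to U(𝔫₋)
  -- ⊗ R.
  let e : LowerAlg m ⊗[ℂ] W ≃ₗ[ℂ] Induced τ := TensorProduct.assoc ℂ _ (R m) W
  have he : ∀ u (r : R m) (w : W), e ((u ⊗ₜ r) ⊗ₜ w) = .tmul τ u (r ⊗ₜ w) := fun _ _ _ => rfl
  have hsmul : ∀ (b : LowerAlg m) v, e (b • v) = b • e v := by
    intro b v
    induction b using TensorProduct.induction_on with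
    | zero => rw [zero_smul (LowerAlg m) v, map_zero, zero_smul (LowerAlg m) (e v)]
    | add b c hb hc => rw [add_smul, map_add, hb, hc, add_smul]
    | tmul u r =>
      induction v using TensorProduct.induction_on with
      | zero => rw [smul_zero, map_zero, smul_zero]
      | add v w hv hw => rw [smul_add, map_add, hv, hw, map_add, smul_add]
      | tmul c w =>
        induction c using TensorProduct.induction_on with
        | zero => rw [TensorProduct.zero_tmul, smul_zero, map_zero, smul_zero]
        | add c d hc hd => rw [TensorProduct.add_tmul, smul_add, map_add, hc, hd, map_add, smul_add]
        | tmul v s =>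
          rw [TensorProduct.smul_tmul', smul_eq_mul, Algebra.TensorProduct.tmul_mul_tmul, he, he]
          change _ = (lowerIncl m u * coeffElt r) • Induced.tmul τ v (s ⊗ₜ w)
          rw [mul_smul, Induced.coeffElt_smul, Induced.lowerIncl_smul, inducedCoeff_tmul,
            inducedLeft_tmul, coeffMul_tmul]
  let e' : LowerAlg m ⊗[ℂ] W ≃ₗ[LowerAlg m] Induced τ := { e with map_smul' := hsmul }
  exact Module.Projective.of_equiv e'

/-- The projection of the induced module to `W` that kills the images of `𝔫₋` and of the maximal
ideal of `R`. -/
def Induced.counit : Induced τ →ₗ[ℂ] W :=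
  (TensorProduct.lid ℂ W).toLinearMap ∘ₗ TensorProduct.map
    (UniversalEnvelopingAlgebra.lift ℂ (0 : lower m →ₗ⁅ℂ⁆ ℂ)).toLinearMap
    ((TensorProduct.lid ℂ W).toLinearMap ∘ₗ
      TensorProduct.map (MvPowerSeries.coeff (R := ℂ) (0 : Fin m →₀ ℕ)) LinearMap.id)

theorem Induced.counit_tmul (u) (r : R m) (w : W) : Induced.counit τ (.tmul τ u (r ⊗ₜ w)) =
    UniversalEnvelopingAlgebra.lift ℂ (0 : lower m →ₗ⁅ℂ⁆ ℂ) u •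
      MvPowerSeries.constantCoeff r • w := rfl

variable {τ} in
theorem Induced.induction_pure {p : Induced τ → Prop} (hadd : ∀ v w, p v → p w → p (v + w))
    (htmul : ∀ u r w, p (.tmul τ u (r ⊗ₜ w))) (w : Induced τ) : p w := by
  induction w using Induced.induction_tmul with
  | htmul u e =>
    induction e using TensorProduct.induction_on with
    | zero => simpa using htmul u 0 0
    | tmul r w => exact htmul u r w
    | add e f he hf =>
      have : Induced.tmul τ u (e + f) = .tmul τ u e + .tmul τ u f := TensorProduct.tmul_add _ _ _
      rw [this]; exact hadd _ _ he hf
  | hadd v w hv hw => exact hadd v w hv hw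

theorem Induced.counit_lower (y : lower m) (w : Induced τ) :
    Induced.counit τ (lieElt (y : Gl m) • w) = 0 := by
  rw [Induced.lieElt_smul, inducedLie_lower]
  induction w using Induced.induction_pure with
  | htmul u r w =>
    rw [inducedLeft_tmul, counit_tmul, map_mul, UniversalEnvelopingAlgebra.lift_ι_apply,
      LieHom.zero_apply, zero_mul, zero_smul]
  | hadd v w hv hw => rw [map_add, map_add, hv, hw, add_zero]

theorem Induced.counit_coeff (r : R m) (w : Induced τ) :
    Induced.counit τ ((coeffElt r : A m) • w) =
      MvPowerSeries.constantCoeff r • Induced.counit τ w := by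
  rw [Induced.coeffElt_smul]
  induction w using Induced.induction_pure with
  | htmul u s w =>
    rw [inducedCoeff_tmul, coeffMul_tmul, counit_tmul, counit_tmul, map_mul, smul_smul,
      smul_smul, smul_smul]
    congr 1; ring
  | hadd v w hv hw => rw [map_add, map_add, hv, hw, map_add, smul_add]

theorem Induced.counit_incl (w : W) : Induced.counit τ (Induced.incl τ w) = w := by
  change Induced.counit τ (.tmul τ 1 (1 ⊗ₜ w)) = w
  rw [counit_tmul, map_one, map_one, one_smul, one_smul]

end

/-- The one-dimensional representation of `𝔟` of weight `μ`. -/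
def charRep (mu : Fin m → ℤ) : borel m →ₗ⁅ℂ⁆ Module.End ℂ ℂ where
  toFun x := LinearMap.mul ℂ ℂ (diagChar (fun i => (mu i : ℂ)) (x : Gl m))
  map_add' x y := by
    rw [← map_add, ← map_add]; rfl
  map_smul' c x := by
    rw [RingHom.id_apply, ← map_smul, ← map_smul]; rfl
  map_lie' := by
    intro x y
    rw [diagChar_lie, map_zero]
    ext
    simp [LieRing.of_associative_ring_bracket, mul_comm]

theorem charRep_apply (mu : Fin m → ℤ) (x : borel m) (c : ℂ) :
    charRep mu x c = diagChar (fun i => (mu i : ℂ)) (x : Gl m) * c := rfl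

theorem diagChar_add_X (mu : Fin m → ℤ) (x : Gl m) :
    diagChar (fun i => (mu i : R m) + MvPowerSeries.X i) x =
      algebraMap ℂ (R m) (diagChar (fun i => (mu i : ℂ)) x) + diagChar MvPowerSeries.X x := by
  change ∑ i, x i i • _ = algebraMap ℂ (R m) (∑ i, x i i • _) + ∑ i, x i i • _
  rw [map_sum, ← Finset.sum_add_distrib]
  refine Finset.sum_congr rfl fun i _ => ?_
  rw [smul_add, smul_eq_mul, map_mul, Algebra.smul_def, map_intCast]

/-- The hypothesis on 𝔟 passes to U(𝔟) because 𝔟 generates it and the values of the character are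
central. This is what checks the defining relations of the deformed Verma module in `defVermaLift`.
-/
theorem borelIncl_smul {X : Type} [AddCommGroup X] [Module (A m) X] (mu : Fin m → ℤ) (v : X)
    (hv : ∀ x : borel m, lieElt (x : Gl m) • v =
      (coeffElt (diagChar (fun i => (mu i : R m) + MvPowerSeries.X i) (x : Gl m)) : A m) • v)
    (b : Ub m) : (borelIncl m b ⊗ₜ 1 : A m) • v = (coeffElt (defChar mu b) : A m) • v := by
  have hb : b ∈ Algebra.adjoin ℂ (Set.range (UniversalEnvelopingAlgebra.ι ℂ : borel m → _)) := by
    rw [adjoin_range_ι]; trivial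
  induction hb using Algebra.adjoin_induction with
  | mem y hy =>
    obtain ⟨x, rfl⟩ := hy
    rw [defChar, borelChar_ι, ← hv]
    simp [borelIncl, lieElt]
  | algebraMap c =>
    rw [AlgHom.commutes, AlgHom.commutes, ← algebraMap_eq_coeffElt]; rfl
  | add y z _ _ hy hz =>
    rw [map_add, map_add, TensorProduct.add_tmul, add_smul, hy, hz, coeffElt, coeffElt, coeffElt,
      TensorProduct.tmul_add, add_smul]
  | mul y z _ _ hy hz =>
    have h1 : ((borelIncl m (y * z)) ⊗ₜ 1 : A m) =
        (borelIncl m y ⊗ₜ 1) * (borelIncl m z ⊗ₜ 1) := by simp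
    have h2 : (coeffElt (defChar mu (y * z)) : A m) =
        coeffElt (defChar mu z) * coeffElt (defChar mu y) := by simp [coeffElt, mul_comm]
    rw [h1, h2, mul_smul, hz, ← mul_smul, ← coeffElt_commute, mul_smul, hy, mul_smul]

theorem lieElt_smul_incl_charRep (mu : Fin m → ℤ) (x : borel m) :
    lieElt (x : Gl m) • Induced.incl (charRep mu) (1 : ℂ) =
      (coeffElt (diagChar (fun i => (mu i : R m) + MvPowerSeries.X i) (x : Gl m)) : A m) •
        Induced.incl (charRep mu) (1 : ℂ) := by
  have h : ∀ c : ℂ, Induced.incl (charRep mu) c =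
      (coeffElt (algebraMap ℂ (R m) c) : A m) • Induced.incl (charRep mu) (1 : ℂ) := by
    intro c
    rw [← algebraMap_eq_coeffElt, algebraMap_smul, ← map_smul, smul_eq_mul, mul_one]
  rw [Induced.lieElt_smul_incl, charRep_apply, mul_one, h, diagChar_add_X, ← add_smul]
  simp only [coeffElt, TensorProduct.tmul_add]

/-- The highest weight vector of the deformed Verma module. -/
def defVermaGen (l : Fin m → ℤ) : defVerma l := (defVermaRel (l - rho m)).mkQ 1

theorem lieElt_smul_defVermaGen (l : Fin m → ℤ) (x : borel m) :
    lieElt (x : Gl m) • defVermaGen l =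
      (coeffElt (diagChar (fun i => (((l - rho m) i : ℤ) : R m) + MvPowerSeries.X i)
        (x : Gl m)) : A m) • defVermaGen l := by
  rw [← sub_eq_zero, ← sub_smul]
  change (defVermaRel (l - rho m)).mkQ ((_ : A m) • (1 : A m)) = 0
  rw [Submodule.mkQ_apply, Submodule.Quotient.mk_eq_zero, smul_eq_mul, mul_one]
  refine Submodule.subset_span ⟨1, UniversalEnvelopingAlgebra.ι ℂ x, 1, ?_⟩
  rw [defChar, borelChar_ι, one_mul, mul_one, coeffElt]
  simp [borelIncl, lieElt]

theorem span_defVermaGen (l : Fin m → ℤ) :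
    Submodule.span (A m) {defVermaGen l} = ⊤ := by
  rw [eq_top_iff]
  rintro v _
  obtain ⟨a, ha⟩ := (defVermaRel (l - rho m)).mkQ_surjective v
  refine Submodule.mem_span_singleton.mpr ⟨a, ?_⟩
  rw [← ha]
  change (defVermaRel (l - rho m)).mkQ (a • (1 : A m)) = (defVermaRel (l - rho m)).mkQ a
  rw [smul_eq_mul, mul_one]

/-- The universal property of the deformed Verma module. -/
def defVermaLift {X : Type} [AddCommGroup X] [Module (A m) X] (l : Fin m → ℤ) (v : X)
    (hv : ∀ x : borel m, lieElt (x : Gl m) • v =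
      (coeffElt (diagChar (fun i => (((l - rho m) i : ℤ) : R m) + MvPowerSeries.X i)
        (x : Gl m)) : A m) • v) : defVerma l →ₗ[A m] X :=
  (defVermaRel (l - rho m)).liftQ (LinearMap.toSpanSingleton (A m) X v) (by
    rw [defVermaRel, Submodule.span_le]
    rintro _ ⟨u, b, r, rfl⟩
    change ((u * borelIncl m b) ⊗ₜ[ℂ] r - u ⊗ₜ[ℂ] (defChar _ b * r) : A m) • v = 0
    have h1 : ((u * borelIncl m b) ⊗ₜ[ℂ] r : A m) =
      (u ⊗ₜ 1) * (coeffElt r * (borelIncl m b ⊗ₜ 1)) := by simp [coeffElt]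
    have h2 : (u ⊗ₜ[ℂ] (defChar (l - rho m) b * r) : A m) =
      (u ⊗ₜ 1) * (coeffElt r * coeffElt (defChar (l - rho m) b)) := by simp [coeffElt, mul_comm]
    rw [h1, h2, sub_smul, mul_smul, mul_smul, borelIncl_smul _ v hv, mul_smul, mul_smul, sub_self])

theorem defVermaLift_gen {X : Type} [AddCommGroup X] [Module (A m) X] (l : Fin m → ℤ) (v : X) (hv) :
    defVermaLift l v hv (defVermaGen l) = v := one_smul (A m) v

/-- The deformed Verma module as an induced module. -/
def defVermaEquiv (l : Fin m → ℤ) : defVerma l ≃ₗ[A m] Induced (charRep (l - rho m)) :=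
  -- The two universal properties give maps in both directions, inverse to each other on generators.
  LinearEquiv.ofLinearMap
    (defVermaLift l (Induced.incl _ (1 : ℂ)) (lieElt_smul_incl_charRep _))
    (Induced.lift (LinearMap.toSpanSingleton ℂ (defVerma l) (defVermaGen l)) (by
      intro x c
      have : (coeffElt (diagChar (fun i => (((l - rho m) i : ℤ) : R m) + MvPowerSeries.X i)
        (x : Gl m)) : A m) = algebraMap ℂ (A m) (diagChar (fun i => (((l - rho m) i : ℤ) : ℂ)) x) +
          coeffElt (diagChar MvPowerSeries.X (x : Gl m)) := by
        rw [diagChar_add_X, algebraMap_eq_coeffElt]; simp only [coeffElt, TensorProduct.tmul_add]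
      rw [LinearMap.toSpanSingleton_apply, LinearMap.toSpanSingleton_apply, charRep_apply,
        smul_comm (lieElt _), lieElt_smul_defVermaGen, this, add_smul, smul_add, algebraMap_smul,
        smul_comm c (coeffElt _), add_sub_cancel_right, smul_smul, mul_comm]))
    (by
      refine LinearMap.ext_on (Induced.span_range_incl _) ?_
      rintro _ ⟨c, rfl⟩
      rw [LinearMap.comp_apply, Induced.lift_incl, LinearMap.toSpanSingleton_apply,
        ← algebraMap_smul (A m) c, map_smul, defVermaLift_gen, algebraMap_smul, ← map_smul,
        smul_eq_mul, mul_one, LinearMap.id_apply])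
    (by
      refine LinearMap.ext_on (span_defVermaGen l) ?_
      rintro _ rfl
      rw [LinearMap.comp_apply, defVermaLift_gen, Induced.lift_incl,
        LinearMap.toSpanSingleton_apply, one_smul, LinearMap.id_apply])

theorem defVermaEquiv_gen (l : Fin m → ℤ) :
    defVermaEquiv l (defVermaGen l) = Induced.incl _ (1 : ℂ) :=
  defVermaLift_gen _ _ (lieElt_smul_incl_charRep _)

theorem isLowerProjective_defVerma (l : Fin m → ℤ) : IsLowerProjective m (defVerma l) :=
  (Induced.isLowerProjective _).of_equiv (defVermaEquiv l).symm

theorem otilProp_defVerma (l : Fin m → ℤ) : otilProp m (defVerma l) := by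
  have : IsOtil m (Induced (charRep (l - rho m))) := by
    refine Induced.isOtil _ ?_
    rw [eq_top_iff]
    intro w _
    refine Submodule.subset_span ⟨l - rho m, fun i => ?_⟩
    rw [charRep_apply, diagChar_diagUnit, smul_eq_mul]
  exact this.of_injective (defVermaEquiv l).toLinearMap (defVermaEquiv l).injective

theorem defVermaGen_mem_weightSpace (l : Fin m → ℤ) :
    defVermaGen l ∈ weightSpace (defVerma l) (l - rho m) := by
  intro i
  have := lieElt_smul_defVermaGen l (diagUnit i)
  change lieElt (diagUnit i : Gl m) • _ - _ = _
  rw [this, diagChar_diagUnit, sub_eq_iff_eq_add', ← algebraMap_smul (A m) (((l - rho m) i : ℤ) : ℂ),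
    ← add_smul, algebraMap_eq_coeffElt, map_intCast]
  simp only [coeffElt, TensorProduct.tmul_add]

end LowerProjective

end DeformedBGG

end

/-! ### Projections to weight spaces. -/

noncomputable section

namespace DeformedBGG

section WeightProjection

variable {m : ℕ} {M : Type} [AddCommGroup M] [Module ℂ M] [Module (A m) M]
  [IsScalarTower ℂ (A m) M]

/-- The projection to a weight space. -/
def weightProj (h : DirectSum.IsInternal (weightSpace M : (Fin m → ℤ) → Submodule ℂ M))
    (l : Fin m → ℤ) : M →ₗ[ℂ] M :=
  (weightSpace M l).subtype ∘ₗ DirectSum.component ℂ _ _ l ∘ₗ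
    (LinearEquiv.ofBijective (DirectSum.coeLinearMap _) h).symm.toLinearMap

variable (h : DirectSum.IsInternal (weightSpace M : (Fin m → ℤ) → Submodule ℂ M))

theorem weightProj_of_mem {l k : Fin m → ℤ} {v : M} (hv : v ∈ weightSpace M l) :
    weightProj h k v = if l = k then v else 0 := by
  have : (LinearEquiv.ofBijective (DirectSum.coeLinearMap _) h).symm v =
      DirectSum.lof ℂ _ (fun l => weightSpace M l) l ⟨v, hv⟩ := by
    rw [LinearEquiv.symm_apply_eq]
    exact (DirectSum.coeLinearMap_lof (weightSpace M) l ⟨v, hv⟩).symm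
  change ((DirectSum.component ℂ _ _ k
    ((LinearEquiv.ofBijective (DirectSum.coeLinearMap _) h).symm v) : weightSpace M k) : M) = _
  rw [this]
  split_ifs with hlk
  · subst hlk; rw [DirectSum.component.lof_self]
  · rw [DirectSum.component.of, dif_neg hlk]; rfl

include h in
theorem weight_induction {p : M → Prop} (hmem : ∀ (l : Fin m → ℤ) v, v ∈ weightSpace M l → p v)
    (hadd : ∀ v w, p v → p w → p (v + w)) (v : M) : p v := by
  have hv : v ∈ ⨆ l, weightSpace M (l : Fin m → ℤ) := by
    rw [weight_isInternal_iff.mp h]; trivial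
  induction hv using Submodule.iSup_induction' with
  | mem l v hv => exact hmem l v hv
  | zero => exact hmem 0 0 (zero_mem _)
  | add v w _ _ hv hw => exact hadd v w hv hw

end WeightProjection

/-! ### The Casimir element. -/

section Casimir

variable {m : ℕ}

variable (m) in
/-- The Casimir element `∑ e_{ij} e_{ji}`. -/
def casimir : A m := ∑ i, ∑ j, lieElt (unitMat i j) * lieElt (unitMat j i)

theorem lieElt_single (i j : Fin m) (c : ℂ) :
    (lieElt (Matrix.single i j c) : A m) = c • lieElt (unitMat i j) := by
  rw [← lieElt_smul, unitMat, Matrix.smul_single, smul_eq_mul, mul_one]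

theorem lieElt_zero : (lieElt (0 : Gl m) : A m) = 0 := (lieEltLinear m).map_zero

theorem unit_commutator (k l i j : Fin m) :
    (lieElt (unitMat k l) * lieElt (unitMat i j) - lieElt (unitMat i j) * lieElt (unitMat k l) :
      A m) = (if l = i then lieElt (unitMat k j) else 0) -
        (if j = k then lieElt (unitMat i l) else 0) := by
  rw [lieElt_comm]
  change lieEltLinear m _ = (if l = i then lieEltLinear m (unitMat k j) else 0) -
        (if j = k then lieEltLinear m (unitMat i l) else 0)
  rw [map_sub]
  congr 1
  · split_ifs with h
    · subst h; rw [unitMat, unitMat, Matrix.single_mul_single_same, mul_one]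
    · rw [unitMat, unitMat, Matrix.single_mul_single_of_ne _ _ _ _ h, map_zero]
  · split_ifs with h
    · subst h; rw [unitMat, unitMat, Matrix.single_mul_single_same, mul_one]
    · rw [unitMat, unitMat, Matrix.single_mul_single_of_ne _ _ _ _ h, map_zero]

theorem casimir_unit_commute (k l : Fin m) :
    lieElt (unitMat k l) * casimir m = casimir m * lieElt (unitMat k l) := by
  -- Leibniz rule for the commutator with e_{kl}. After summation the first term cancels the fourth
  -- and the second cancels the third.
  have h1 : ∀ i j : Fin m, lieElt (unitMat k l) * (lieElt (unitMat i j) * lieElt (unitMat j i)) -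
      (lieElt (unitMat i j) * lieElt (unitMat j i)) * lieElt (unitMat k l) =
      ((if l = i then lieElt (unitMat k j) * lieElt (unitMat j i) else 0) -
        (if j = k then lieElt (unitMat i l) * lieElt (unitMat j i) else 0)) +
      ((if l = j then lieElt (unitMat i j) * lieElt (unitMat k i) else 0) -
        (if i = k then lieElt (unitMat i j) * lieElt (unitMat j l) else 0) : A m) := by
    intro i j
    have e1 := congrArg (· * lieElt (unitMat j i)) (unit_commutator k l i j)
    have e2 := congrArg (lieElt (unitMat i j) * ·) (unit_commutator k l j i)
    simp only [sub_mul, mul_sub, ite_mul, mul_ite, zero_mul, mul_zero] at e1 e2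
    rw [← e1, ← e2]
    noncomm_ring
  rw [← sub_eq_zero, casimir]
  simp only [Finset.mul_sum, Finset.sum_mul, ← Finset.sum_sub_distrib]
  simp only [h1, Finset.sum_add_distrib, Finset.sum_sub_distrib, Finset.sum_ite_eq, Finset.sum_ite_eq',
    Finset.mem_univ, if_true]
  have h2 : ∀ (p : Fin m) (f : Fin m → Fin m → A m), ∑ i, ∑ j, (if p = i then f i j else 0) =
      ∑ j, f p j := by
    intro p f
    rw [Finset.sum_comm]
    simp
  have h3 : ∀ (p : Fin m) (f : Fin m → Fin m → A m), ∑ i, ∑ j, (if i = p then f i j else 0) =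
      ∑ j, f p j := by
    intro p f
    rw [Finset.sum_comm]
    simp
  rw [h2, h3]
  abel

theorem casimir_commute (x : Gl m) : lieElt x * casimir m = casimir m * lieElt x := by
  rw [lieElt_eq_sum, Finset.sum_mul, Finset.mul_sum]
  refine Finset.sum_congr rfl fun i _ => ?_
  rw [Finset.sum_mul, Finset.mul_sum]
  refine Finset.sum_congr rfl fun j _ => ?_
  rw [lieElt_single, smul_mul_assoc, casimir_unit_commute, mul_smul_comm]

/-- The value of the Casimir element on a singular vector of weight `κ`. -/
def casimirValue (κ : Fin m → ℤ) : ℤ :=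
  ∑ i, ∑ j, if i = j then κ i * κ i else if i < j then κ i - κ j else 0

/-- For i < j write e_{ij}e_{ji} = e_{ji}e_{ij} + e_{ii} - e_{jj}. Working modulo `N` covers both a
genuine singular vector (`N = ⊥`) and a vector that is singular only modulo a submodule, as in the
dual Verma module. -/
theorem casimir_smul_sub_mem {X : Type} [AddCommGroup X] [Module ℂ X] [Module (A m) X]
    [IsScalarTower ℂ (A m) X] (N : Submodule (A m) X) (κ : Fin m → ℤ) (v : X)
    (hup : ∀ i j : Fin m, i < j → lieElt (unitMat i j) • v ∈ N)
    (hdiag : ∀ i, lieElt (unitMat i i) • v = (κ i : ℂ) • v) :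
    casimir m • v - (casimirValue κ : ℂ) • v ∈ N := by
  rw [casimir, casimirValue, Finset.sum_smul, Int.cast_sum, Finset.sum_smul,
    ← Finset.sum_sub_distrib]
  refine sum_mem fun i _ => ?_
  rw [Finset.sum_smul, Int.cast_sum, Finset.sum_smul, ← Finset.sum_sub_distrib]
  refine sum_mem fun j _ => ?_
  rcases lt_trichotomy i j with h | rfl | h
  · rw [if_neg h.ne, if_pos h]
    have := unit_commutator i j j i
    rw [if_pos rfl, if_pos rfl, sub_eq_iff_eq_add] at this
    rw [this, add_smul, sub_smul, hdiag, hdiag, Int.cast_sub, sub_smul, add_sub_cancel_left,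
      mul_smul]
    exact N.smul_mem _ (hup i j h)
  · rw [if_pos rfl, mul_smul, hdiag, smul_comm, hdiag, Int.cast_mul, mul_smul, sub_self]
    exact zero_mem _
  · rw [if_neg h.ne', if_neg h.not_gt, Int.cast_zero, zero_smul, sub_zero, mul_smul]
    exact N.smul_mem _ (hup j i h)

/-- The quadratic part dominates: the linear part is at least -2m ∑ |κ_i|, and completing the square
bounds every |κ_i|. -/
theorem finite_casimirValue_eq (c : ℤ) : {κ : Fin m → ℤ | casimirValue κ = c}.Finite := by
  -- From (|κ_i| - m)² ≤ c + m³ + m² and t ≤ t² for integers. The m³ collects the m completed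
  -- squares; the m² is slack.
  set K : ℤ := m + (c + m ^ 3 + m ^ 2) with hK
  refine (Set.finite_Icc (fun _ : Fin m => -K) (fun _ => K)).subset ?_
  intro κ hκ
  have hle : ∑ i, ((|κ i| - m) ^ 2 - m ^ 2 : ℤ) ≤ c := by
    rw [← (hκ : casimirValue κ = c), casimirValue]
    have h1 : ∀ i j : Fin m, (if i = j then κ i * κ i else 0) - |κ i| - |κ j| ≤
        (if i = j then κ i * κ i else if i < j then κ i - κ j else 0) := by
      intro i j
      have := abs_nonneg (κ i)
      have := abs_nonneg (κ j)
      have := neg_abs_le (κ i)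
      have := le_abs_self (κ j)
      split_ifs <;> linarith
    refine le_trans (le_of_eq ?_) (Finset.sum_le_sum fun i _ => Finset.sum_le_sum fun j _ => h1 i j)
    simp only [Finset.sum_sub_distrib, Finset.sum_ite_eq, Finset.mem_univ, if_true,
      Finset.sum_const, Finset.card_univ, Fintype.card_fin, nsmul_eq_mul, sub_sq, sq_abs,
      Finset.sum_add_distrib, ← Finset.mul_sum, ← Finset.sum_mul]
    simp only [pow_two]
    ring
  have hterm : ∀ i, (|κ i| - m) ^ 2 ≤ c + m ^ 3 + m ^ 2 := by
    intro i
    have h2 : ((|κ i| - m) ^ 2 : ℤ) ≤ ∑ i, (|κ i| - m) ^ 2 :=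
      Finset.single_le_sum (f := fun i => (|κ i| - m : ℤ) ^ 2) (fun _ _ => sq_nonneg _)
        (Finset.mem_univ i)
    rw [Finset.sum_sub_distrib] at hle
    simp only [Finset.sum_const, Finset.card_univ, Fintype.card_fin, nsmul_eq_mul] at hle
    have : (m : ℤ) * m ^ 2 = m ^ 3 := by ring
    have := sq_nonneg (m : ℤ)
    linarith
  have habs : ∀ i, |κ i| ≤ K := by
    intro i
    have := hterm i
    have h3 : (|κ i| - m : ℤ) ≤ (|κ i| - m) ^ 2 := by
      exact Int.le_self_sq _
    linarith
  exact ⟨fun i => (abs_le.mp (habs i)).1, fun i => (abs_le.mp (habs i)).2⟩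

end Casimir

/-! ### Verma modules. -/

section Verma

variable {m : ℕ}

theorem residue_lieElt (x : Gl m) : residue m (lieElt x) = UniversalEnvelopingAlgebra.ι ℂ x := by
  simp [residue, lieElt]

theorem residue_coeffElt (r : R m) :
    residue m (coeffElt r) = algebraMap ℂ _ (MvPowerSeries.constantCoeff r) := by
  simp [residue, coeffElt, Algebra.algebraMap_eq_smul_one]

/-- The highest weight vector of the Verma module. -/
def vermaGen (l : Fin m → ℤ) : verma l := (vermaRel (l - rho m)).mkQ 1

theorem verma_smul_gen (l : Fin m → ℤ) (a : A m) :
    a • vermaGen l = (vermaRel (l - rho m)).mkQ (residue m a) := by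
  change (vermaRel (l - rho m)).mkQ (residue m a • (1 : Ug m)) = _
  rw [smul_eq_mul, mul_one]

theorem verma_coeffElt_smul {l : Fin m → ℤ} (r : R m) (v : verma l) :
    (coeffElt r : A m) • v = MvPowerSeries.constantCoeff r • v := by
  rw [← algebraMap_smul (A m) (MvPowerSeries.constantCoeff r)]
  obtain ⟨u, rfl⟩ := (vermaRel (l - rho m)).mkQ_surjective v
  change (vermaRel (l - rho m)).mkQ (residue m (coeffElt r) • u) =
    (vermaRel (l - rho m)).mkQ (residue m (algebraMap ℂ _ _) • u)
  rw [residue_coeffElt, AlgHom.commutes]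

theorem lieElt_smul_vermaGen (l : Fin m → ℤ) (x : borel m) :
    lieElt (x : Gl m) • vermaGen l =
      diagChar (fun i => (((l - rho m) i : ℤ) : ℂ)) (x : Gl m) • vermaGen l := by
  rw [← algebraMap_smul (A m) (diagChar _ _) (vermaGen l), ← sub_eq_zero, ← sub_smul,
    verma_smul_gen, map_sub]
  refine (Submodule.Quotient.mk_eq_zero _).mpr ?_
  refine Submodule.subset_span ⟨1, UniversalEnvelopingAlgebra.ι ℂ x, ?_⟩
  rw [borelChar_ι, AlgHom.commutes, residue_lieElt, one_mul, Algebra.algebraMap_eq_smul_one]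
  simp [borelIncl]

theorem exists_smul_vermaGen {l : Fin m → ℤ} (v : verma l) : ∃ a : A m, a • vermaGen l = v := by
  obtain ⟨u, rfl⟩ := (vermaRel (l - rho m)).mkQ_surjective v
  refine ⟨u ⊗ₜ 1, ?_⟩
  rw [verma_smul_gen]
  congr 1
  simp [residue]

/-- The projection of the induced module to the Verma module. -/
def vermaLift (l : Fin m → ℤ) : Induced (charRep (l - rho m)) →ₗ[A m] verma l :=
  Induced.lift (LinearMap.toSpanSingleton ℂ (verma l) (vermaGen l)) (by
    intro x c
    -- R acts on the Verma module through constant terms, so the z-twist in the universal property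
    -- of the induced module disappears.
    have h0 : MvPowerSeries.constantCoeff (diagChar MvPowerSeries.X (x : Gl m) : R m) = 0 := by
      change MvPowerSeries.constantCoeff (∑ i, (x : Gl m) i i • (MvPowerSeries.X i : R m)) = 0
      simp
    rw [verma_coeffElt_smul, h0, zero_smul, sub_zero, LinearMap.toSpanSingleton_apply,
      LinearMap.toSpanSingleton_apply, charRep_apply, smul_comm (lieElt _), lieElt_smul_vermaGen,
      smul_smul, mul_comm])

theorem vermaLift_surjective (l : Fin m → ℤ) : Function.Surjective (vermaLift l) := by
  intro v
  obtain ⟨a, rfl⟩ := exists_smul_vermaGen v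
  refine ⟨a • Induced.incl _ (1 : ℂ), ?_⟩
  rw [map_smul, vermaLift, Induced.lift_incl, LinearMap.toSpanSingleton_apply, one_smul]

theorem isOtil_verma (l : Fin m → ℤ) : IsOtil m (verma l) :=
  ((otilProp_defVerma l).of_injective (defVermaEquiv l).symm.toLinearMap
    (defVermaEquiv l).symm.injective).of_surjective (vermaLift l) (vermaLift_surjective l)

theorem vermaGen_mem_weightSpace (l : Fin m → ℤ) :
    vermaGen l ∈ weightSpace (verma l) (l - rho m) := by
  intro i
  have := lieElt_smul_vermaGen l (diagUnit i)
  change lieElt (diagUnit i : Gl m) • _ - _ = _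
  rw [this, diagChar_diagUnit, sub_self, verma_coeffElt_smul, MvPowerSeries.constantCoeff_X,
    zero_smul]

theorem lieElt_smul_of_mem_weightSpace_verma {l κ : Fin m → ℤ} {v : verma l}
    (hv : v ∈ weightSpace (verma l) κ) (i : Fin m) :
    lieElt (unitMat i i) • v = (κ i : ℂ) • v := by
  have := hv i
  rwa [verma_coeffElt_smul, MvPowerSeries.constantCoeff_X, zero_smul, sub_eq_zero] at this

/-- The Verma module is generated by its highest weight vector over `𝔫₋`. -/
theorem verma_eq_top {l : Fin m → ℤ} (P : Submodule ℂ (verma l)) (hgen : vermaGen l ∈ P)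
    (hst : ∀ (y : lower m), ∀ v ∈ P, lieElt (y : Gl m) • v ∈ P) : P = ⊤ := by
  rw [eq_top_iff]
  intro v _
  obtain ⟨w, rfl⟩ := vermaLift_surjective l v
  induction w using Induced.induction with
  | hone e =>
    induction e using TensorProduct.induction_on with
    | zero =>
      have : Induced.tmul (charRep (l - rho m)) 1 0 = 0 := TensorProduct.tmul_zero _ _
      rw [this, map_zero]; exact zero_mem _
    | tmul r c =>
      rw [Induced.tmul_eq_smul, map_one, one_mul, map_smul, verma_coeffElt_smul, vermaLift,
        Induced.lift_incl]
      exact P.smul_mem _ (P.smul_mem _ hgen)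
    | add e f he hf =>
      have : Induced.tmul (charRep (l - rho m)) 1 (e + f) = .tmul _ 1 e + .tmul _ 1 f :=
        TensorProduct.tmul_add _ _ _
      rw [this, map_add]; exact add_mem (he trivial) (hf trivial)
  | hadd v w hv hw => rw [map_add]; exact add_mem (hv trivial) (hw trivial)
  | hmul y w hw =>
    rw [← inducedLie_lower, ← Induced.lieElt_smul, map_smul]
    exact hst y _ (hw trivial)

/-- The highest weight vector is singular, the Casimir element commutes with 𝔤, and 𝔫₋ generates the
module from that vector. -/
theorem casimir_smul_verma {l : Fin m → ℤ} (v : verma l) :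
    casimir m • v = (casimirValue (l - rho m) : ℂ) • v := by
  let P : Submodule ℂ (verma l) :=
    LinearMap.ker (Algebra.lsmul ℂ ℂ (verma l) (casimir m) -
      (casimirValue (l - rho m) : ℂ) • LinearMap.id)
  have hP : ∀ v, v ∈ P ↔ casimir m • v - (casimirValue (l - rho m) : ℂ) • v = 0 := fun v => Iff.rfl
  have : P = ⊤ := by
    refine verma_eq_top P ?_ ?_
    · rw [hP, ← Submodule.mem_bot (A m)]
      refine casimir_smul_sub_mem ⊥ _ _ (fun i j h => ?_) (fun i => ?_)
      · have hn : unitMat i j ∈ nPlus m := by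
          intro a b hab
          rw [unitMat, Matrix.single_apply, if_neg]
          rintro ⟨rfl, rfl⟩; exact hab.not_gt h
        have := lieElt_smul_vermaGen l ⟨_, nPlus_le_borel hn⟩
        rw [Submodule.mem_bot, this, diagChar_nPlus _ hn, zero_smul]
      · exact lieElt_smul_of_mem_weightSpace_verma (vermaGen_mem_weightSpace l) i
    · intro y v hv
      rw [hP, sub_eq_zero] at hv ⊢
      rw [← mul_smul, ← casimir_commute, mul_smul, hv, smul_comm]
  have hv : v ∈ P := by rw [this]; trivial
  rwa [hP, sub_eq_zero] at hv

end Verma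

end DeformedBGG

end

/-! ### The height filtration. -/

noncomputable section

namespace DeformedBGG

section Height

variable {m : ℕ}

/-- The height of a weight; subtracting a positive root increases it. -/
def height (κ : Fin m → ℤ) : ℤ := ∑ i : Fin m, (i : ℤ) * κ i

theorem height_add_root (κ : Fin m → ℤ) (a b : Fin m) :
    height (κ + (Pi.single a 1 - Pi.single b 1)) = height κ + (a - b) := by
  simp only [height, Pi.add_apply, Pi.sub_apply, mul_add, mul_sub, Finset.sum_add_distrib,
    Finset.sum_sub_distrib, Pi.single_apply, mul_ite, mul_one, mul_zero, Finset.sum_ite_eq',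
    Finset.mem_univ, if_true]

variable (M : Type) [AddCommGroup M] [Module ℂ M] [Module (A m) M] [IsScalarTower ℂ (A m) M]

/-- The sum of the weight spaces of height at least `N`. -/
def heightGE (N : ℤ) : Submodule ℂ M :=
  ⨆ (κ : Fin m → ℤ) (_ : N ≤ height κ), weightSpace M κ

variable {M}

theorem weightSpace_le_heightGE {N : ℤ} {κ : Fin m → ℤ} (h : N ≤ height κ) :
    weightSpace M κ ≤ heightGE (m := m) M N := le_iSup₂_of_le κ h le_rfl

theorem heightGE_le {N : ℤ} {P : Submodule ℂ M}
    (h : ∀ κ : Fin m → ℤ, N ≤ height κ → weightSpace M κ ≤ P) : heightGE (m := m) M N ≤ P :=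
  iSup₂_le h

theorem heightGE_anti {N N' : ℤ} (h : N ≤ N') : heightGE (m := m) M N' ≤ heightGE (m := m) M N :=
  heightGE_le fun _ hκ => weightSpace_le_heightGE (h.trans hκ)

/-- The matrix unit e_{ij} with i > j raises the height by i - j ≥ 1. -/
theorem lower_smul_heightGE (y : lower m) {N : ℤ} {v : M} (hv : v ∈ heightGE (m := m) M N) :
    lieElt (y : Gl m) • v ∈ heightGE (m := m) M (N + 1) := by
  have : heightGE (m := m) M N ≤
      (heightGE (m := m) M (N + 1)).comap (Algebra.lsmul ℂ ℂ M (lieElt (y : Gl m))) := by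
    refine heightGE_le fun κ hκ v hv => ?_
    change lieElt (y : Gl m) • v ∈ heightGE M (N + 1)
    rw [lieElt_eq_sum, Finset.sum_smul]
    refine sum_mem fun i _ => ?_
    rw [Finset.sum_smul]
    refine sum_mem fun j _ => ?_
    rcases lt_or_ge j i with h | h
    · refine weightSpace_le_heightGE ?_ (single_smul_mem hv i j _)
      rw [height_add_root]
      have : (j : ℤ) < i := by exact_mod_cast h
      lia
    · rw [y.2 i j h, Matrix.single_zero, lieElt_zero, zero_smul (A m) v]
      exact zero_mem _
  exact this hv

end Height

section VermaWeights

variable {m : ℕ} (l : Fin m → ℤ)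

theorem heightGE_verma : heightGE (m := m) (verma l) (height (l - rho m)) = ⊤ :=
  verma_eq_top _ (weightSpace_le_heightGE le_rfl (vermaGen_mem_weightSpace l))
    fun y _ hv => heightGE_anti (by lia) (lower_smul_heightGE y hv)

/-- Every step of the height filtration has finite codimension. This gives the finiteness statements
for the dual. -/
theorem exists_sup_heightGE_verma (n : ℕ) : ∃ H : Submodule ℂ (verma l),
    FiniteDimensional ℂ H ∧ H ⊔ heightGE (m := m) (verma l) (height (l - rho m) + n) = ⊤ := by
  induction n with
  | zero => exact ⟨⊥, inferInstance, by rw [Nat.cast_zero, add_zero, heightGE_verma, bot_sup_eq]⟩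
  | succ n ih =>
    obtain ⟨H, hH, htop⟩ := ih
    let act : Gl m →ₗ[ℂ] verma l →ₗ[ℂ] verma l :=
      (Algebra.lsmul ℂ ℂ (verma l)).toLinearMap ∘ₗ lieEltLinear m
    -- The module is spanned by the highest weight vector and the image of 𝔫₋, and 𝔫₋ moves the part
    -- of large height one step further.
    refine ⟨Submodule.span ℂ {vermaGen l} ⊔ Submodule.map₂ act ⊤ H, ?_, ?_⟩
    · have : FiniteDimensional ℂ (Submodule.map₂ act ⊤ H) :=
        Module.Finite.iff_fg.mpr (Submodule.FG.map₂ _ Module.Finite.fg_top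
          (Module.Finite.iff_fg.mp hH))
      infer_instance
    · refine verma_eq_top _ (Submodule.mem_sup_left (Submodule.mem_sup_left
        (Submodule.mem_span_singleton_self _))) fun y v _ => ?_
      have hv : v ∈ H ⊔ heightGE (m := m) (verma l) (height (l - rho m) + n) := by
        rw [htop]; trivial
      obtain ⟨h, hh, p, hp, rfl⟩ := Submodule.mem_sup.mp hv
      rw [smul_add]
      refine add_mem (Submodule.mem_sup_left (Submodule.mem_sup_right
        (Submodule.apply_mem_map₂ act (m := (y : Gl m)) trivial hh))) (Submodule.mem_sup_right ?_)
      rw [Nat.cast_succ, ← add_assoc]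
      exact lower_smul_heightGE y hp

end VermaWeights

/-! ### Weights of the restricted dual. -/

section DualModule

variable {m : ℕ} {M : ModuleCat.{0} (A m)}

/-- The linear form underlying an element of the restricted dual. -/
def dualVal (f : dual M) : Module.Dual ℂ M := Subtype.val (p := (· ∈ dualSubspace (m := m) M)) f

theorem dualVal_injective : Function.Injective (dualVal (M := M)) := Subtype.val_injective

theorem dualVal_mem (f : dual M) : dualVal f ∈ dualSubspace (m := m) M :=
  Subtype.property (p := (· ∈ dualSubspace (m := m) M)) f

/-- An element of the restricted dual. -/
def dualMk (f : Module.Dual ℂ M) (hf : f ∈ dualSubspace (m := m) M) : dual M :=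
  (⟨f, hf⟩ : dualSubspace (m := m) M)

theorem dualVal_mk (f : Module.Dual ℂ M) (hf : f ∈ dualSubspace (m := m) M) :
    dualVal (dualMk f hf) = f := rfl

theorem dualVal_add (f g : dual M) : dualVal (f + g) = dualVal f + dualVal g := rfl

theorem dualVal_lieElt (x : Gl m) (f : dual M) (v : M) :
    dualVal (lieElt x • f) v = dualVal f (lieElt x.transpose • v) := by
  have : dualAction M (lieElt x) = dualLie M x := by
    simp [dualAction, lieElt]
  change ((dualAction M (lieElt x) f : dualSubspace (m := m) M) : Module.Dual ℂ M) v = _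
  rw [this]; rfl

theorem dualVal_coeffElt (r : R m) (f : dual M) (v : M) :
    dualVal ((coeffElt r : A m) • f) v = dualVal f ((coeffElt r : A m) • v) := by
  have : dualAction M (coeffElt r) = dualCoeff M r := by
    simp [dualAction, coeffElt]
  change ((dualAction M (coeffElt r) f : dualSubspace (m := m) M) : Module.Dual ℂ M) v = _
  rw [this]; rfl

theorem dualVal_smul (c : ℂ) (f : dual M) : dualVal (c • f) = c • dualVal f := by
  ext v
  rw [← algebraMap_smul (A m) c f, algebraMap_eq_coeffElt, dualVal_coeffElt,
    ← algebraMap_eq_coeffElt, algebraMap_smul, map_smul]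
  rfl

variable (M) in
/-- The map from the restricted dual to the full dual. -/
def dualValLinear : dual M →ₗ[ℂ] Module.Dual ℂ M where
  toFun := dualVal
  map_add' := dualVal_add
  map_smul' := dualVal_smul

theorem dualVal_unit_smul (i j : Fin m) (f : dual M) (v : M) :
    dualVal (lieElt (unitMat i j) • f) v = dualVal f (lieElt (unitMat j i) • v) := by
  rw [dualVal_lieElt, unitMat, Matrix.transpose_single]

theorem dualVal_sub (f g : dual M) : dualVal (f - g) = dualVal f - dualVal g := rfl

/-- The e_{ii} are fixed by transposition, so moving e_{ii} - z_i across the pairing equates its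
eigenvalues κ_i and κ'_i on a nonzero pairing. -/
theorem dualVal_apply_eq_zero {κ κ' : Fin m → ℤ} (hne : κ ≠ κ') {f : dual M}
    (hf : f ∈ weightSpace (dual M) κ) {v : M} (hv : v ∈ weightSpace M κ') : dualVal f v = 0 := by
  obtain ⟨i, hi⟩ := Function.ne_iff.mp hne
  have h1 := congrArg (fun g => dualVal g v) (hf i)
  simp only [dualVal_sub, LinearMap.sub_apply, dualVal_unit_smul, dualVal_coeffElt, dualVal_smul,
    LinearMap.smul_apply, ← hv i, map_sub, map_smul, smul_eq_mul] at h1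
  have h2 : ((κ' i : ℂ) - κ i) * dualVal f v = 0 := by linear_combination h1
  refine (mul_eq_zero.mp h2).resolve_left (sub_ne_zero.mpr ?_)
  exact_mod_cast hi.symm

variable (hM : IsOtil m M)

include hM in
theorem mem_weightSpace_dual {κ : Fin m → ℤ} {f : dual M}
    (hf : ∀ κ', κ' ≠ κ → ∀ v ∈ weightSpace M κ', dualVal f v = 0) :
    f ∈ weightSpace (dual M) κ := by
  intro i
  refine dualVal_injective (LinearMap.ext fun v => ?_)
  simp only [dualVal_sub, LinearMap.sub_apply, dualVal_unit_smul, dualVal_coeffElt, dualVal_smul,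
    LinearMap.smul_apply]
  induction v using weight_induction hM.weight with
  | hmem κ' v hv =>
    rw [← hv i, map_sub, LinearMap.map_smul (dualVal f) (κ' i : ℂ) v]
    by_cases h : κ' = κ
    · rw [h]
    · rw [hf κ' h v hv, smul_zero, smul_zero]
  | hadd v w hv hw =>
    rw [smul_add, smul_add, map_add, map_add, map_add, smul_add, ← hv, ← hw]; abel

theorem comp_weightProj_mem (f : Module.Dual ℂ M) (κ : Fin m → ℤ) :
    f ∘ₗ weightProj hM.weight κ ∈ dualSubspace (m := m) M := by
  refine (Set.finite_singleton κ).subset ?_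
  rintro κ' ⟨v, hv, hne⟩
  by_contra h
  refine hne ?_
  rw [LinearMap.comp_apply, weightProj_of_mem _ hv, if_neg (show ¬κ' = κ from h), map_zero]

include hM in
-- A form in the restricted dual is the sum of its compositions with the weight projections; the sum
-- is finite because only finitely many weight spaces are not killed.
theorem iSup_weightSpace_dual : ⨆ κ, weightSpace (dual M) (κ : Fin m → ℤ) = ⊤ := by
  rw [eq_top_iff]
  intro f _
  have hfin : {κ : Fin m → ℤ | ∃ v ∈ weightSpace M κ, dualVal f v ≠ 0}.Finite := dualVal_mem f
  have : f = ∑ κ ∈ hfin.toFinset, dualMk _ (comp_weightProj_mem hM (dualVal f) κ) := by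
    refine dualVal_injective (LinearMap.ext fun v => ?_)
    change dualVal f v = dualValLinear M _ v
    rw [map_sum, LinearMap.sum_apply]
    change _ = ∑ κ ∈ _, dualVal f (weightProj hM.weight κ v)
    induction v using weight_induction hM.weight with
    | hmem κ v hv =>
      simp only [weightProj_of_mem _ hv]
      by_cases h : κ ∈ hfin.toFinset
      · rw [Finset.sum_eq_single_of_mem κ h, if_pos rfl]
        intro κ' _ hne
        rw [if_neg hne.symm, map_zero]
      · rw [Finset.sum_eq_zero]
        · by_contra hne
          exact h (hfin.mem_toFinset.mpr ⟨v, hv, hne⟩)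
        · intro κ' hκ'
          rw [if_neg (by rintro rfl; exact h hκ'), map_zero]
    | hadd v w hv hw =>
      simp only [map_add, Finset.sum_add_distrib]
      rw [hv, hw]
  rw [this]
  refine sum_mem fun κ _ => Submodule.mem_iSup_of_mem κ (mem_weightSpace_dual hM ?_)
  intro κ' h v hv
  rw [dualVal_mk, LinearMap.comp_apply, weightProj_of_mem _ hv, if_neg h, map_zero]

end DualModule

/-! ### Dual Verma modules belong to Õ. -/

section DualVerma

variable {m : ℕ} (l : Fin m → ℤ)

/-- The elements of the dual Verma module that vanish on the weight spaces of height at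
least `N`. -/
def dualVermaTrunc (N : ℤ) : Submodule ℂ (dual (verma l)) :=
  ((heightGE (m := m) (verma l) N).dualAnnihilator).comap (dualValLinear (verma l))

variable {l}

theorem mem_dualVermaTrunc {N : ℤ} {f : dual (verma l)} : f ∈ dualVermaTrunc l N ↔
    ∀ v ∈ heightGE (m := m) (verma l) N, dualVal f v = 0 :=
  Submodule.mem_dualAnnihilator _

/-- A form that kills a subspace is determined by its restriction to a finite-dimensional complement
`H`. -/
theorem finiteDimensional_dualVermaTrunc (N : ℤ) : FiniteDimensional ℂ (dualVermaTrunc l N) := by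
  obtain ⟨H, hH, htop⟩ := exists_sup_heightGE_verma l (N - height (l - rho m)).toNat
  have hle : heightGE (m := m) (verma l) (height (l - rho m) + (N - height (l - rho m)).toNat) ≤
      heightGE (m := m) (verma l) N := heightGE_anti (by lia)
  let res : dualVermaTrunc l N →ₗ[ℂ] Module.Dual ℂ H :=
    H.dualRestrict ∘ₗ dualValLinear (verma l) ∘ₗ (dualVermaTrunc l N).subtype
  refine Module.Finite.of_injective res ?_
  rw [← LinearMap.ker_eq_bot, LinearMap.ker_eq_bot']
  intro f hf
  refine Subtype.ext (dualVal_injective (LinearMap.ext fun v => ?_))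
  have hv : v ∈ H ⊔ heightGE (m := m) (verma l)
      (height (l - rho m) + (N - height (l - rho m)).toNat) := by rw [htop]; trivial
  obtain ⟨h, hh, p, hp, rfl⟩ := Submodule.mem_sup.mp hv
  have h1 : dualVal (f : dual (verma l)) h = 0 := LinearMap.congr_fun hf ⟨h, hh⟩
  rw [map_add, h1, mem_dualVermaTrunc.mp f.2 p (hle hp), add_zero]
  rfl

theorem exists_mem_dualVermaTrunc (f : dual (verma l)) : ∃ N, f ∈ dualVermaTrunc l N := by
  have hfin : {κ : Fin m → ℤ | ∃ v ∈ weightSpace (verma l) κ, dualVal f v ≠ 0}.Finite :=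
    dualVal_mem f
  obtain ⟨N, hN⟩ := (hfin.image height).bddAbove
  -- `N` may be attained by a weight on which `f` is nonzero, so vanishing starts at `N + 1`.
  refine ⟨N + 1, mem_dualVermaTrunc.mpr ?_⟩
  have : heightGE (m := m) (verma l) (N + 1) ≤ LinearMap.ker (dualVal f) := by
    refine heightGE_le fun κ hκ v hv => ?_
    by_contra hne
    have := hN ⟨κ, ⟨v, hv, hne⟩, rfl⟩
    lia
  exact this

theorem weightSpace_le_dualVermaTrunc (κ : Fin m → ℤ) :
    weightSpace (dual (verma l)) κ ≤ dualVermaTrunc l (height κ + 1) := by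
  intro f hf
  refine mem_dualVermaTrunc.mpr ?_
  have : heightGE (m := m) (verma l) (height κ + 1) ≤ LinearMap.ker (dualVal f) := by
    refine heightGE_le fun κ' hκ' v hv => ?_
    refine dualVal_apply_eq_zero ?_ hf hv
    rintro rfl
    lia
  exact this

theorem transpose_mem_lower {x : Gl m} (hx : x ∈ nPlus m) : x.transpose ∈ lower m :=
  fun i j h => hx j i h

/-- Transposition composed with reversal of the order fixes every summand e_{ij}e_{ji}. -/
theorem casimir_smul_dual (f : dual (verma l)) :
    casimir m • f = (casimirValue (l - rho m) : ℂ) • f := by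
  refine dualVal_injective (LinearMap.ext fun v => ?_)
  rw [dualVal_smul, LinearMap.smul_apply, ← map_smul, ← casimir_smul_verma, casimir,
    Finset.sum_smul, Finset.sum_smul, map_sum]
  change dualValLinear (verma l) _ v = _
  rw [map_sum, LinearMap.sum_apply]
  refine Finset.sum_congr rfl fun i _ => ?_
  rw [Finset.sum_smul, Finset.sum_smul, map_sum, map_sum, LinearMap.sum_apply]
  refine Finset.sum_congr rfl fun j _ => ?_
  change dualVal _ v = _
  rw [mul_smul, dualVal_unit_smul, dualVal_unit_smul, mul_smul]

theorem weightSpace_dual_eq_bot {κ : Fin m → ℤ} (h : height κ < height (l - rho m)) :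
    weightSpace (dual (verma l)) κ = ⊥ := by
  rw [eq_bot_iff]
  intro f hf
  have h1 := heightGE_anti (M := verma l) (m := m) (N := height κ + 1) h
  rw [heightGE_verma] at h1
  have h2 := mem_dualVermaTrunc.mp (weightSpace_le_dualVermaTrunc κ hf)
  rw [Submodule.mem_bot]
  exact dualVal_injective (LinearMap.ext fun v => h2 v (h1 trivial))

theorem lieElt_smul_of_mem_weightSpace_dual {κ : Fin m → ℤ} {f : dual (verma l)}
    (hf : f ∈ weightSpace (dual (verma l)) κ) (i : Fin m) :
    lieElt (unitMat i i) • f = (κ i : ℂ) • f := by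
  have h0 : (coeffElt (MvPowerSeries.X i) : A m) • f = 0 := by
    refine dualVal_injective (LinearMap.ext fun v => ?_)
    rw [dualVal_coeffElt, verma_coeffElt_smul, MvPowerSeries.constantCoeff_X, zero_smul, map_zero]
    rfl
  have := hf i
  rwa [h0, sub_eq_zero] at this

/-- A submodule that contains the weight spaces on whose weights the Casimir element takes
the right value is everything. -/
theorem weightSpace_dual_le (N : Submodule (A m) (dual (verma l)))
    (hN : ∀ κ : Fin m → ℤ, casimirValue κ = casimirValue (l - rho m) →
      ∀ f ∈ weightSpace (dual (verma l)) κ, f ∈ N) (n : ℕ) :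
    ∀ κ : Fin m → ℤ, height κ < height (l - rho m) + n → ∀ f ∈ weightSpace (dual (verma l)) κ, f ∈ N := by
  induction n with
  | zero =>
    intro κ hκ f hf
    rw [weightSpace_dual_eq_bot (by simpa using hκ)] at hf
    rw [(Submodule.mem_bot ℂ).mp hf]
    exact zero_mem _
  | succ n ih =>
    intro κ hκ f hf
    by_cases hc : casimirValue κ = casimirValue (l - rho m)
    · exact hN κ hc f hf
    -- For i < j the vector e_{ij}f has smaller height, so it lies in `N` by induction and f is
    -- singular modulo `N`. Two different Casimir scalars on f then force f into `N`.
    have h1 := casimir_smul_sub_mem N κ f (fun i j hij => by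
      refine ih _ ?_ _ (single_smul_mem hf i j 1)
      rw [height_add_root]
      have : (i : ℤ) < j := by exact_mod_cast hij
      push_cast at hκ
      lia) (lieElt_smul_of_mem_weightSpace_dual hf)
    rw [casimir_smul_dual, ← sub_smul] at h1
    have hne : (casimirValue (l - rho m) : ℂ) - casimirValue κ ≠ 0 :=
      sub_ne_zero.mpr fun h => hc (by exact_mod_cast h.symm)
    have h2 := algebraMap_mem_smul N ((casimirValue (l - rho m) : ℂ) - casimirValue κ)⁻¹ h1
    rwa [smul_smul, inv_mul_cancel₀ hne, one_smul] at h2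

variable (l)

/-- The highest weight vector need not generate. The weight spaces with the right Casimir value do,
and there are finitely many of them, each finite-dimensional. -/
theorem finite_dual_verma : Module.Finite (A m) (dual (verma l)) := by
  have hS := finite_casimirValue_eq (m := m) (casimirValue (l - rho m))
  set S := {κ : Fin m → ℤ | casimirValue κ = casimirValue (l - rho m)} with hSdef
  have : Finite S := hS
  have hfd : ∀ κ : S, FiniteDimensional ℂ (weightSpace (dual (verma l)) (κ : Fin m → ℤ)) := by
    intro κ
    have := finiteDimensional_dualVermaTrunc (l := l) (height (κ : Fin m → ℤ) + 1)
    exact Submodule.finiteDimensional_of_le (weightSpace_le_dualVermaTrunc _)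
  have hV : FiniteDimensional ℂ (⨆ κ : S, weightSpace (dual (verma l)) (κ : Fin m → ℤ) :
    Submodule ℂ (dual (verma l))) := Submodule.finiteDimensional_iSup _
  obtain ⟨t, ht⟩ := Module.Finite.iff_fg.mp hV
  refine ⟨⟨t, ?_⟩⟩
  have hspan : ∀ κ : Fin m → ℤ, ∀ f ∈ weightSpace (dual (verma l)) κ,
      f ∈ Submodule.span (A m) (t : Set (dual (verma l))) := by
    intro κ
    refine weightSpace_dual_le _ ?_ (height κ - height (l - rho m) + 1).toNat κ (by lia)
    intro κ hκ f hf
    have : f ∈ Submodule.span ℂ (t : Set (dual (verma l))) := by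
      rw [ht]; exact Submodule.mem_iSup_of_mem (⟨κ, hκ⟩ : S) hf
    exact Submodule.span_le_restrictScalars ℂ (A m) _ this
  rw [eq_top_iff]
  intro f _
  have hf : f ∈ ⨆ κ, weightSpace (dual (verma l)) (κ : Fin m → ℤ) := by
    rw [iSup_weightSpace_dual (isOtil_verma l)]; trivial
  induction hf using Submodule.iSup_induction' with
  | mem κ f hf => exact hspan κ f hf
  | zero => exact zero_mem _
  | add f g _ _ hf hg => exact add_mem (hf trivial) (hg trivial)

/-- An element of 𝔫₊ acts through its transpose in 𝔫₋, which raises heights in the Verma module.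
Hence the finite-dimensional truncations are 𝔫₊-stable. -/
theorem otilProp_dual_verma : otilProp m (dual (verma l)) where
  finite := finite_dual_verma l
  locallyFinite := by
    intro f
    obtain ⟨N, hN⟩ := exists_mem_dualVermaTrunc f
    refine ⟨dualVermaTrunc l N, finiteDimensional_dualVermaTrunc N, hN, ?_⟩
    intro x hx g hg
    refine mem_dualVermaTrunc.mpr fun v hv => ?_
    rw [dualVal_lieElt]
    exact mem_dualVermaTrunc.mp hg _ (heightGE_anti (by lia)
      (lower_smul_heightGE ⟨_, transpose_mem_lower hx⟩ hv))
  weight := weight_isInternal_iff.mpr (iSup_weightSpace_dual (isOtil_verma l))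

end DualVerma

end DeformedBGG

end

/-! ### Homomorphisms into a dual Verma module as linear forms. -/

noncomputable section

namespace DeformedBGG

section Forms

variable {m : ℕ} (l : Fin m → ℤ)

section

variable (X : Type) [AddCommGroup X] [Module ℂ X] [Module (A m) X] [IsScalarTower ℂ (A m) X]

/-- The linear forms that correspond to the homomorphisms to a dual Verma module: they kill the
image of `𝔫₋`, and the diagonal matrices and `R` act by scalars. -/
structure IsVermaForm (φ : X →ₗ[ℂ] ℂ) : Prop where
  lower : ∀ (y : lower m) x, φ (lieElt (y : Gl m) • x) = 0
  coeff : ∀ (r : R m) x, φ ((coeffElt r : A m) • x) = MvPowerSeries.constantCoeff r * φ x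
  diag : ∀ i x, φ (lieElt (unitMat i i) • x) = ((l - rho m) i : ℂ) * φ x

variable {X l}

theorem IsVermaForm.apply_eq_zero {φ : X →ₗ[ℂ] ℂ} (hφ : IsVermaForm l X φ) {κ : Fin m → ℤ}
    (hκ : κ ≠ l - rho m) {v : X} (hv : v ∈ weightSpace X κ) : φ v = 0 := by
  obtain ⟨i, hi⟩ := Function.ne_iff.mp hκ
  have h1 := congrArg φ (hv i)
  rw [map_sub, hφ.diag, hφ.coeff, map_smul, MvPowerSeries.constantCoeff_X, zero_mul, smul_eq_mul,
    ← sub_mul] at h1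
  refine (mul_eq_zero.mp h1).resolve_left (sub_ne_zero.mpr ?_)
  exact_mod_cast hi.symm

variable (l) in
/-- The weight component of a linear form that kills the image of `𝔫₋` and on which `R` acts
by scalars. -/
theorem isVermaForm_comp_weightProj
    (h : DirectSum.IsInternal (weightSpace X : (Fin m → ℤ) → Submodule ℂ X)) (φ : X →ₗ[ℂ] ℂ)
    (hlow : ∀ (y : lower m) x, φ (lieElt (y : Gl m) • x) = 0)
    (hcoeff : ∀ (r : R m) x, φ ((coeffElt r : A m) • x) = MvPowerSeries.constantCoeff r * φ x) :
    IsVermaForm l X (φ ∘ₗ weightProj h (l - rho m)) where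
  lower := by
    intro y x
    induction x using weight_induction h with
    | hmem κ v hv =>
      rw [LinearMap.comp_apply, lieElt_eq_sum, Finset.sum_smul, map_sum, map_sum]
      refine Finset.sum_eq_zero fun i _ => ?_
      rw [Finset.sum_smul, map_sum, map_sum]
      refine Finset.sum_eq_zero fun j _ => ?_
      -- Every entry of `y` gives an element of 𝔫₋ that maps weight vectors to weight vectors. The
      -- projection keeps the image, which φ kills, or sends it to zero.
      rw [weightProj_of_mem h (single_smul_mem hv i j _)]
      split_ifs
      · refine hlow ⟨Matrix.single i j ((y : Gl m) i j), ?_⟩ v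
        intro a b hab
        rw [Matrix.single_apply]
        split_ifs with hij
        · obtain ⟨rfl, rfl⟩ := hij; exact y.2 _ _ hab
        · rfl
      · exact map_zero _
    | hadd v w hv hw => rw [smul_add, map_add, hv, hw, add_zero]
  coeff := by
    intro r x
    induction x using weight_induction h with
    | hmem κ v hv =>
      rw [LinearMap.comp_apply, LinearMap.comp_apply, weightProj_of_mem h hv,
        weightProj_of_mem h (coeffElt_smul_mem_weightSpace r hv)]
      split_ifs
      · exact hcoeff r v
      · rw [map_zero, mul_zero]
    | hadd v w hv hw => rw [smul_add, map_add, map_add, hv, hw, mul_add]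
  diag := by
    intro i x
    induction x using weight_induction h with
    | hmem κ v hv =>
      have he : lieElt (unitMat i i) • v =
          (κ i : ℂ) • v + (coeffElt (MvPowerSeries.X i) : A m) • v := by
        rw [← hv i]; abel
      have hmem : lieElt (unitMat i i) • v ∈ weightSpace X κ := by
        rw [he]
        exact add_mem (Submodule.smul_mem _ _ hv) (coeffElt_smul_mem_weightSpace _ hv)
      rw [LinearMap.comp_apply, LinearMap.comp_apply, weightProj_of_mem h hv,
        weightProj_of_mem h hmem]
      split_ifs with hκ
      · rw [he, map_add, hcoeff, MvPowerSeries.constantCoeff_X, zero_mul, add_zero, map_smul, hκ,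
          smul_eq_mul]
      · rw [map_zero, mul_zero]
    | hadd v w hv hw => rw [smul_add, map_add, map_add, hv, hw, mul_add]

/-- The universal property of the Verma module. -/
theorem exists_vermaHom (l : Fin m → ℤ) (v : X)
    (hv : ∀ x : borel m, lieElt (x : Gl m) • v =
      diagChar (fun i => (((l - rho m) i : ℤ) : ℂ)) (x : Gl m) • v)
    (hr : ∀ r : R m, (coeffElt r : A m) • v = MvPowerSeries.constantCoeff r • v) :
    ∃ G : verma l →ₗ[A m] X, G (vermaGen l) = v := by
  let _ : Module (Ug m) X := Module.compHom X
    (Algebra.TensorProduct.includeLeft : Ug m →ₐ[ℂ] A m).toRingHom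
  have hsmul : ∀ (u : Ug m) (x : X), u • x = (u ⊗ₜ 1 : A m) • x := fun _ _ => rfl
  have hb : ∀ b : Ub m, (borelIncl m b ⊗ₜ 1 : A m) • v =
      borelChar (fun i => (((l - rho m) i : ℤ) : ℂ)) b • v := by
    intro b
    have hb : b ∈ Algebra.adjoin ℂ (Set.range (UniversalEnvelopingAlgebra.ι ℂ : borel m → _)) := by
      rw [adjoin_range_ι]; trivial
    induction hb using Algebra.adjoin_induction with
    | mem y hy =>
      obtain ⟨x, rfl⟩ := hy
      rw [borelChar_ι, ← hv]
      simp [borelIncl, lieElt]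
    | algebraMap c =>
      rw [AlgHom.commutes, AlgHom.commutes]
      exact algebraMap_smul (A m) c v
    | add y z _ _ hy hz => rw [map_add, map_add, TensorProduct.add_tmul, add_smul, hy, hz, add_smul]
    | mul y z _ _ hy hz =>
      have h1 : ((borelIncl m (y * z)) ⊗ₜ 1 : A m) =
        (borelIncl m y ⊗ₜ 1) * (borelIncl m z ⊗ₜ 1) := by simp
      rw [h1, mul_smul, hz, smul_comm, hy, map_mul, smul_smul, mul_comm]
  let f : (Ug m ⧸ vermaRel (l - rho m)) →ₗ[Ug m] X :=
    (vermaRel (l - rho m)).liftQ (LinearMap.toSpanSingleton (Ug m) X v) (by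
      rw [vermaRel, Submodule.span_le]
      rintro _ ⟨u, b, rfl⟩
      change (u * borelIncl m b - _ • u) • v = 0
      have h1 : ∀ c : ℂ, c • u = u * algebraMap ℂ _ c := fun c => by
        rw [Algebra.smul_def, Algebra.commutes]
      rw [h1, ← mul_sub, mul_smul, sub_smul, hsmul (borelIncl m b), hb, hsmul (algebraMap ℂ _ _)]
      have h2 : ∀ c : ℂ, ((algebraMap ℂ (Ug m) c) ⊗ₜ 1 : A m) • v = c • v := fun c =>
        algebraMap_smul (A m) c v
      rw [h2, sub_self, smul_zero])
  have hf : ∀ u : Ug m, f ((vermaRel (l - rho m)).mkQ u) = (u ⊗ₜ 1 : A m) • v := fun _ => rfl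
  refine ⟨{ toFun := f, map_add' := map_add f, map_smul' := ?_ }, ?_⟩
  · intro a w
    rw [RingHom.id_apply]
    induction a using A_induction generalizing w with
    | hl x =>
      obtain ⟨u, rfl⟩ := (vermaRel (l - rho m)).mkQ_surjective w
      change f ((vermaRel (l - rho m)).mkQ (residue m (lieElt x) • u)) = _
      rw [residue_lieElt, hf, hf, ← mul_smul, smul_eq_mul]
      simp [lieElt]
    | hr r =>
      rw [verma_coeffElt_smul, ← algebraMap_smul (A m) (MvPowerSeries.constantCoeff r) w]
      obtain ⟨u, rfl⟩ := (vermaRel (l - rho m)).mkQ_surjective w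
      change f ((vermaRel (l - rho m)).mkQ (residue m (algebraMap ℂ _ _) • u)) = _
      rw [AlgHom.commutes, hf, hf, ← mul_smul, coeffElt_commute, mul_smul, hr, smul_eq_mul,
        ← Algebra.smul_def, ← TensorProduct.smul_tmul', smul_assoc, smul_comm]
    | hadd a b ha hb => rw [add_smul, add_smul, ← ha, ← hb]; exact map_add f _ _
    | hmul a b ha hb => rw [mul_smul, mul_smul, ← hb, ← ha]
  · change f ((vermaRel (l - rho m)).mkQ 1) = v
    rw [hf, ← Algebra.TensorProduct.one_def, one_smul]

end

variable {l} {X : ModuleCat.{0} (A m)}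

theorem IsVermaForm.mem_dualSubspace {φ : X →ₗ[ℂ] ℂ} (hφ : IsVermaForm l X φ) :
    (φ : Module.Dual ℂ X) ∈ dualSubspace (m := m) X := by
  refine (Set.finite_singleton (l - rho m)).subset ?_
  rintro κ ⟨v, hv, hne⟩
  by_contra h
  exact hne (hφ.apply_eq_zero h hv)

/-- Evaluation at the highest weight vector: the transpose of 𝔫₋ kills that vector, and the diagonal
and R act on it by scalars. -/
theorem isVermaForm_of_hom (F : X →ₗ[A m] dual (verma l)) (φ : X →ₗ[ℂ] ℂ)
    (h : ∀ x, φ x = dualVal (F x) (vermaGen l)) : IsVermaForm l X φ where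
  lower := by
    intro y x
    have hy : (y : Gl m).transpose ∈ nPlus m := fun i j hij => y.2 j i hij
    have := lieElt_smul_vermaGen l ⟨_, nPlus_le_borel hy⟩
    rw [h, map_smul, dualVal_lieElt, this, diagChar_nPlus _ hy, zero_smul, map_zero]
  coeff := by
    intro r x
    rw [h, h, map_smul, dualVal_coeffElt, verma_coeffElt_smul, map_smul, smul_eq_mul]
  diag := by
    intro i x
    rw [h, h, map_smul, dualVal_unit_smul,
      lieElt_smul_of_mem_weightSpace_verma (vermaGen_mem_weightSpace l), map_smul, smul_eq_mul]

/-- The Verma module is generated over 𝔫₋ by its highest weight vector, and F(x)(yv) = F(yᵀx)(v). -/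
theorem hom_dual_ext {F G : X →ₗ[A m] dual (verma l)}
    (h : ∀ x, dualVal (F x) (vermaGen l) = dualVal (G x) (vermaGen l)) : F = G := by
  let P : Submodule ℂ (verma l) := ⨅ x : X, LinearMap.ker (dualVal (F x) - dualVal (G x))
  have hP : ∀ v, v ∈ P ↔ ∀ x, dualVal (F x) v = dualVal (G x) v := by
    intro v
    simp only [P, Submodule.mem_iInf, LinearMap.mem_ker, LinearMap.sub_apply, sub_eq_zero]
  have hPtop : P = ⊤ := by
    refine verma_eq_top P ((hP _).mpr h) fun y v hv => (hP _).mpr fun x => ?_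
    have := (hP _).mp hv (lieElt (y : Gl m).transpose • x)
    rwa [map_smul, map_smul, dualVal_lieElt, dualVal_lieElt, Matrix.transpose_transpose] at this
  refine LinearMap.ext fun x => dualVal_injective (LinearMap.ext fun v => ?_)
  exact (hP v).mp (by rw [hPtop]; trivial) x

/-- A Verma form comes from a homomorphism to the dual Verma module. -/
theorem IsVermaForm.exists_hom (hX : IsOtil m X) {φ : X →ₗ[ℂ] ℂ} (hφ : IsVermaForm l X φ) :
    ∃ F : X →ₗ[A m] dual (verma l), ∀ x, dualVal (F x) (vermaGen l) = φ x := by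
  have hdiagT : ∀ x : borel m, (x : Gl m).transpose =
      (lowerProj m (x : Gl m).transpose : Gl m) +
        ∑ i, Matrix.single i i ((x : Gl m) i i) := by
    intro x
    ext a b
    rw [Matrix.add_apply, Matrix.sum_apply]
    simp only [Matrix.single_apply, lowerProj, LinearMap.coe_mk, AddHom.coe_mk, Matrix.of_apply,
      Matrix.transpose_apply]
    rcases lt_trichotomy a b with h | rfl | h
    · rw [if_neg h.not_gt, x.2 b a h, Finset.sum_eq_zero, add_zero]
      intro i _
      rw [if_neg]
      rintro ⟨rfl, rfl⟩; exact lt_irrefl _ h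
    · simp
    · rw [if_pos h, Finset.sum_eq_zero, add_zero]
      intro i _
      rw [if_neg]
      rintro ⟨rfl, rfl⟩; exact lt_irrefl _ h
  -- As an element of the restricted dual of `X`, φ is a highest weight vector of weight l - ρ
  -- killed by the z_i. So it receives a map from the Verma module, and transposing this map gives
  -- the required homomorphism.
  obtain ⟨G, hG⟩ := exists_vermaHom (X := dual X) l (dualMk φ hφ.mem_dualSubspace)
    (by
      intro x
      refine dualVal_injective (LinearMap.ext fun v => ?_)
      rw [dualVal_lieElt, dualVal_smul, LinearMap.smul_apply, dualVal_mk, hdiagT, lieElt_add,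
        add_smul, map_add, hφ.lower, zero_add]
      change φ (lieEltLinear m (∑ i, Matrix.single i i ((x : Gl m) i i)) • v) =
        (∑ i, (x : Gl m) i i • (((l - rho m) i : ℤ) : ℂ)) • φ v
      rw [map_sum, Finset.sum_smul, map_sum, Finset.sum_smul]
      refine Finset.sum_congr rfl fun i _ => ?_
      change φ (lieElt (Matrix.single i i ((x : Gl m) i i)) • v) = _
      rw [lieElt_single, smul_assoc, map_smul, hφ.diag, smul_eq_mul, smul_eq_mul, smul_eq_mul,
        mul_assoc])
    (by
      intro r
      refine dualVal_injective (LinearMap.ext fun v => ?_)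
      rw [dualVal_coeffElt, dualVal_smul, LinearMap.smul_apply, dualVal_mk, hφ.coeff, smul_eq_mul])
  let B : X →ₗ[ℂ] Module.Dual ℂ (verma l) :=
    (dualValLinear X ∘ₗ G.restrictScalars ℂ).flip
  have hB : ∀ x w, B x w = dualVal (G w) x := fun _ _ => rfl
  -- `G` preserves weights and different weights are orthogonal, so on a weight vector `x` the form
  -- `B x` is supported on a single weight.
  have hmem : ∀ x, B x ∈ dualSubspace (m := m) (verma l) := by
    intro x
    induction x using weight_induction hX.weight with
    | hmem κ x hx =>
      refine (Set.finite_singleton κ).subset ?_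
      rintro κ' ⟨w, hw, hne⟩
      by_contra h
      exact hne (dualVal_apply_eq_zero h (map_mem_weightSpace G hw) hx)
    | hadd v w hv hw => rw [map_add]; exact add_mem hv hw
  refine ⟨{ toFun := fun x => dualMk (B x) (hmem x), map_add' := ?_, map_smul' := ?_ }, ?_⟩
  · intro x y
    refine dualVal_injective ?_
    rw [dualVal_add, dualVal_mk, dualVal_mk, dualVal_mk, map_add]
  · intro a x
    rw [RingHom.id_apply]
    induction a using A_induction generalizing x with
    | hl z =>
      refine dualVal_injective (LinearMap.ext fun w => ?_)
      rw [dualVal_lieElt, dualVal_mk, dualVal_mk, hB, hB, G.map_smul, dualVal_lieElt,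
        Matrix.transpose_transpose]
    | hr r =>
      refine dualVal_injective (LinearMap.ext fun w => ?_)
      rw [dualVal_coeffElt, dualVal_mk, dualVal_mk, hB, hB, G.map_smul, dualVal_coeffElt]
    | hadd a b ha hb =>
      rw [add_smul a b (dualMk _ _)]
      refine dualVal_injective ?_
      refine Eq.trans ?_ (congrArg₂ (fun f g => dualVal f + dualVal g) (ha x) (hb x))
      change B _ = B _ + B _
      rw [add_smul, map_add]
    | hmul a b ha hb =>
      rw [mul_smul a b (dualMk _ _)]
      refine Eq.trans (dualVal_injective ?_) ((ha (b • x)).trans (congrArg (a • ·) (hb x)))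
      change B _ = B _
      rw [mul_smul]
  · intro x
    change B x (vermaGen l) = φ x
    rw [hB, hG, dualVal_mk]

/-- Homomorphisms to a dual Verma module extend along a monomorphism whose cokernel is
projective over `U(𝔫₋) ⊗ R`. -/
theorem exists_extension {K Q X : ModuleCat.{0} (A m)} (hK : IsOtil m K) (hQ : IsOtil m Q)
    (hX : IsLowerProjective m X) (f : K →ₗ[A m] Q) (g : Q →ₗ[A m] X) (hf : Function.Injective f)
    (hfg : Function.Exact f g) (hg : Function.Surjective g) (F : K →ₗ[A m] dual (verma l)) :
    ∃ G : Q →ₗ[A m] dual (verma l), G ∘ₗ f = F := by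
  let φ : K →ₗ[ℂ] ℂ :=
    (LinearMap.applyₗ (vermaGen l)) ∘ₗ dualValLinear (verma l) ∘ₗ F.restrictScalars ℂ
  have hφF : ∀ x, φ x = dualVal (F x) (vermaGen l) := fun _ => rfl
  have hφ : IsVermaForm l K φ := isVermaForm_of_hom F φ hφF
  let := lowerModule m K
  let := lowerModule m Q
  obtain ⟨s, hs⟩ := hX.exists_retraction f g hf hfg hg
  have hsA : ∀ (b : LowerAlg m) q, s (lowerAlgIncl m b • q) = lowerAlgIncl m b • s q := s.map_smul
  have hlow : ∀ (y : lower m) q, s (lieElt (y : Gl m) • q) = lieElt (y : Gl m) • s q := by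
    intro y q
    have := hsA (UniversalEnvelopingAlgebra.ι ℂ y ⊗ₜ 1) q
    rwa [lowerAlgIncl_tmul, lowerIncl_ι, coeffElt, ← Algebra.TensorProduct.one_def, mul_one] at this
  have hcoeff : ∀ (r : R m) q, s ((coeffElt r : A m) • q) = (coeffElt r : A m) • s q := by
    intro r q
    have := hsA (1 ⊗ₜ r) q
    rwa [lowerAlgIncl_tmul, map_one, one_mul] at this
  let sC : Q →ₗ[ℂ] K :=
    { toFun := s
      map_add' := map_add s
      map_smul' := fun c q => by
        rw [RingHom.id_apply, ← algebraMap_smul (A m) c q, algebraMap_eq_coeffElt, hcoeff,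
          ← algebraMap_eq_coeffElt, algebraMap_smul] }
  -- `s` need not preserve weights, so φ ∘ s satisfies only the conditions on 𝔫₋ and R; the weight
  -- projection supplies the third.
  have hform := isVermaForm_comp_weightProj l hQ.weight (φ ∘ₗ sC)
    (fun y q => by
      change φ (s (lieElt (y : Gl m) • q)) = 0
      rw [hlow, hφ.lower])
    (fun r q => by
      change φ (s ((coeffElt r : A m) • q)) = _ * φ (s q)
      rw [hcoeff, hφ.coeff])
  obtain ⟨G, hG⟩ := hform.exists_hom hQ
  refine ⟨G, hom_dual_ext fun k => ?_⟩
  rw [LinearMap.comp_apply, hG, ← hφF]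
  -- On the image of `K` the projection changes nothing: φ already vanishes off the weight l - ρ,
  -- and `f` preserves weights.
  induction k using weight_induction hK.weight with
  | hmem κ k hk =>
    rw [LinearMap.comp_apply, weightProj_of_mem _ (map_mem_weightSpace f hk)]
    split_ifs with h
    · change φ (s (f k)) = φ k
      exact congrArg φ (LinearMap.congr_fun hs k)
    · rw [map_zero, hφ.apply_eq_zero h hk]
  | hadd v w hv hw => rw [map_add, map_add, map_add, hv, hw]

end Forms

/-! ### Homomorphisms from deformed Verma modules to dual Verma modules. -/

section HomDefVerma

variable {m : ℕ} {l mu : Fin m → ℤ}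

/-- The linear form on a deformed Verma module that takes the value `1` at the generator and kills
the images of `𝔫₋` and of the maximal ideal of `R`. -/
def defVermaForm (l : Fin m → ℤ) : defVerma l →ₗ[ℂ] ℂ :=
  Induced.counit (charRep (l - rho m)) ∘ₗ (defVermaEquiv l).toLinearMap.restrictScalars ℂ

theorem exists_hom_defVerma_dual (l : Fin m → ℤ) : ∃ F : defVerma l →ₗ[A m] dual (verma l),
    dualVal (F (defVermaGen l)) (vermaGen l) = 1 := by
  have h := (otilProp_defVerma l).weight
  obtain ⟨F, hF⟩ := (isVermaForm_comp_weightProj l h (defVermaForm l)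
    (fun y x => by
      change Induced.counit _ (defVermaEquiv l (lieElt (y : Gl m) • x)) = 0
      rw [map_smul, Induced.counit_lower])
    (fun r x => by
      change Induced.counit _ (defVermaEquiv l ((coeffElt r : A m) • x)) =
        _ * Induced.counit _ (defVermaEquiv l x)
      rw [map_smul, Induced.counit_coeff, smul_eq_mul])).exists_hom (otilProp_defVerma l)
  refine ⟨F, ?_⟩
  rw [hF, LinearMap.comp_apply, weightProj_of_mem h (defVermaGen_mem_weightSpace l), if_pos rfl]
  change Induced.counit _ (defVermaEquiv l (defVermaGen l)) = 1
  rw [defVermaEquiv_gen, Induced.counit_incl]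

/-- The deformed Verma module is generated over U(𝔫₋) ⊗ R by one vector; a Verma form kills the
image of 𝔫₋ and is R-linear through constant terms, so its value there determines it. -/
theorem hom_defVerma_dual_ext {F G : defVerma l →ₗ[A m] dual (verma mu)}
    (h : dualVal (F (defVermaGen l)) (vermaGen mu) =
      dualVal (G (defVermaGen l)) (vermaGen mu)) : F = G := by
  refine hom_dual_ext fun x => ?_
  obtain ⟨w, rfl⟩ := (defVermaEquiv l).symm.surjective x
  let φ (F : defVerma l →ₗ[A m] dual (verma mu)) : defVerma l →ₗ[ℂ] ℂ :=
    (LinearMap.applyₗ (vermaGen mu)) ∘ₗ dualValLinear (verma mu) ∘ₗ F.restrictScalars ℂ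
  have hφ : ∀ F, IsVermaForm mu (defVerma l) (φ F) := fun F =>
    isVermaForm_of_hom F _ fun _ => rfl
  have hgen : (defVermaEquiv l).symm (Induced.incl _ (1 : ℂ)) = defVermaGen l := by
    rw [LinearEquiv.symm_apply_eq, defVermaEquiv_gen]
  change φ F _ = φ G _
  change φ F _ = φ G _ at h
  induction w using Induced.induction with
  | hone e =>
    induction e using TensorProduct.induction_on with
    | zero =>
      have : Induced.tmul (charRep (l - rho m)) 1 0 = 0 := TensorProduct.tmul_zero _ _
      rw [this, map_zero, map_zero, map_zero]
    | tmul r c =>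
      have hc : Induced.incl (charRep (l - rho m)) c =
          algebraMap ℂ (A m) c • Induced.incl (charRep (l - rho m)) (1 : ℂ) := by
        rw [algebraMap_smul, ← map_smul, smul_eq_mul, mul_one]
      rw [Induced.tmul_eq_smul, map_one, one_mul, hc, LinearEquiv.map_smul, LinearEquiv.map_smul, hgen, (hφ F).coeff,
        (hφ G).coeff, algebraMap_smul, map_smul, map_smul, h]
    | add e f he hf =>
      have : Induced.tmul (charRep (l - rho m)) 1 (e + f) = .tmul _ 1 e + .tmul _ 1 f :=
        TensorProduct.tmul_add _ _ _
      rw [this, map_add, map_add, map_add, he, hf]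
  | hadd v w hv hw => rw [map_add, map_add, map_add, hv, hw]
  | hmul y w hw =>
    rw [← inducedLie_lower, ← Induced.lieElt_smul, map_smul, (hφ F).lower, (hφ G).lower]

theorem hom_defVerma_dual_eq_zero (h : l ≠ mu) (F : defVerma l →ₗ[A m] dual (verma mu)) :
    F = 0 := by
  refine hom_defVerma_dual_ext ?_
  have hne : l - rho m ≠ mu - rho m := fun he => h (sub_left_injective he)
  have := isVermaForm_of_hom F
    ((LinearMap.applyₗ (vermaGen mu)) ∘ₗ dualValLinear (verma mu) ∘ₗ F.restrictScalars ℂ)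
    fun _ => rfl
  exact this.apply_eq_zero hne (defVermaGen_mem_weightSpace l)

end HomDefVerma

/-! ### Passage to the abelian category Õ. -/

section Category

variable {m : ℕ}

variable (m) in
/-- The objects that are projective over `U(𝔫₋) ⊗ R`. -/
def lowerProjective : ObjectProperty (Otil m) := fun X => IsLowerProjective m X.obj

/-- The inclusion of Õ into all bimodules preserves kernels and cokernels, hence is exact. -/
theorem shortExact_underlying (S : ShortComplex (Otil m)) (hS : S.ShortExact) :
    Function.Injective S.f.hom.hom ∧ Function.Exact S.f.hom.hom S.g.hom.hom ∧
      Function.Surjective S.g.hom.hom := by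
  have h1 := (otilProp m).preservesKernels_ι
  have h2 := (otilProp m).preservesCokernels_ι
  have := (otilProp m).ι.preservesFiniteLimits_of_preservesKernels
  have := (otilProp m).ι.preservesFiniteColimits_of_preservesCokernels
  have h := hS.map_of_exact (otilProp m).ι
  exact ⟨h.moduleCat_injective_f, (ShortComplex.ShortExact.moduleCat_exact_iff_function_exact _).mp h.exact,
    h.moduleCat_surjective_g⟩

theorem exists_epi_lowerProjective (X : Otil m) :
    ∃ (Q : Otil m) (p : Q ⟶ X), Epi p ∧ lowerProjective m Q := by
  obtain ⟨W, τ, f, hI, hf⟩ := exists_induced_surjective (M := X.obj) X.property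
  -- Applied to the identity map, this carries membership from the ℂ-structure built on `Induced τ`
  -- to the one attached to an object of `ModuleCat`.
  have hY : ∀ (Y : ModuleCat.{0} (A m)) (e : Y →ₗ[A m] Induced τ), Function.Injective e →
      otilProp m Y := fun _ e he => hI.of_injective e he
  let p : (⟨ModuleCat.of (A m) (Induced τ), hY _ LinearMap.id Function.injective_id⟩ : Otil m) ⟶ X :=
    ObjectProperty.homMk (ModuleCat.ofHom f)
  refine ⟨_, p, ?_, Induced.isLowerProjective τ⟩
  refine (otilProp m).ι.epi_of_epi_map ?_
  exact (ModuleCat.epi_iff_surjective _).mpr hf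

variable {l mu : Fin m → ℤ}

theorem subsingleton_ext_defVerma_dual_succ (hV : otilProp m (defVerma l))
    (hD : otilProp m (dual (verma mu))) (n : ℕ) :
    Subsingleton (Abelian.Ext.{1} (⟨defVerma l, hV⟩ : Otil m) (⟨dual (verma mu), hD⟩ : Otil m)
      (n + 1)) := by
  refine subsingleton_of_forall_eq 0 fun e => ?_
  refine Abelian.Ext.eq_zero_of_extension_property (lowerProjective m) _
    exists_epi_lowerProjective ?_ ?_ n ⟨defVerma l, hV⟩
    (isLowerProjective_defVerma l) e
  · intro S hS h2 h3
    obtain ⟨hf, hfg, hg⟩ := shortExact_underlying S hS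
    exact IsLowerProjective.of_exact h2 h3 _ _ hf hfg hg
  · intro S hS h3 f
    obtain ⟨hf, hfg, hg⟩ := shortExact_underlying S hS
    obtain ⟨G, hG⟩ := exists_extension S.X₁.property S.X₂.property h3 _ _ hf hfg hg f.hom.hom
    refine ⟨ObjectProperty.homMk (ModuleCat.ofHom G), ?_⟩
    ext x
    exact LinearMap.congr_fun hG x

theorem subsingleton_hom_defVerma_dual (h : l ≠ mu) (hV : otilProp m (defVerma l))
    (hD : otilProp m (dual (verma mu))) :
    Subsingleton ((⟨defVerma l, hV⟩ : Otil m) ⟶ (⟨dual (verma mu), hD⟩ : Otil m)) := by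
  refine ⟨fun F G => ?_⟩
  ext x
  rw [hom_defVerma_dual_eq_zero h F.hom.hom, hom_defVerma_dual_eq_zero h G.hom.hom]

theorem nonempty_hom_defVerma_dual_equiv (hV : otilProp m (defVerma l))
    (hD : otilProp m (dual (verma l))) :
    Nonempty (((⟨defVerma l, hV⟩ : Otil m) ⟶ (⟨dual (verma l), hD⟩ : Otil m)) ≃ₗ[ℂ] ℂ) := by
  -- Evaluation at both highest weight vectors: injective because the generator determines the
  -- homomorphism, surjective because the value 1 is attained.
  let ev : ((⟨defVerma l, hV⟩ : Otil m) ⟶ (⟨dual (verma l), hD⟩ : Otil m)) →ₗ[ℂ] ℂ :=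
    { toFun := fun F => dualVal (F.hom.hom (defVermaGen l)) (vermaGen l)
      map_add' := fun _ _ => rfl
      map_smul' := fun c F => by
        change dualVal (c • F.hom.hom (defVermaGen l)) (vermaGen l) = _
        rw [dualVal_smul]; rfl }
  refine ⟨LinearEquiv.ofBijective ev ⟨fun F G h => ?_, fun c => ?_⟩⟩
  · have := hom_defVerma_dual_ext h
    ext x
    rw [this]
  · obtain ⟨F, hF⟩ := exists_hom_defVerma_dual l
    refine ⟨c • ObjectProperty.homMk (ModuleCat.ofHom F), ?_⟩
    rw [map_smul]
    change c • dualVal (F (defVermaGen l)) (vermaGen l) = c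
    rw [hF, smul_eq_mul, mul_one]

end Category

end DeformedBGG

end

theorem proposition5 (m : ℕ) (hm : 2 ≤ m) (l mu : Fin m → ℤ) :
    ∃ (hV : DeformedBGG.otilProp m (DeformedBGG.defVerma l))
      (hD : DeformedBGG.otilProp m (DeformedBGG.dual (DeformedBGG.verma mu))),
      ∀ i : ℕ,
        ((i = 0 ∧ l = mu) →
          Nonempty (CategoryTheory.Abelian.Ext.{1}
            (⟨DeformedBGG.defVerma l, hV⟩ : DeformedBGG.Otil m)
            (⟨DeformedBGG.dual (DeformedBGG.verma mu), hD⟩ : DeformedBGG.Otil m) i ≃ₗ[ℂ] ℂ)) ∧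
        (¬(i = 0 ∧ l = mu) →
          Subsingleton (CategoryTheory.Abelian.Ext.{1}
            (⟨DeformedBGG.defVerma l, hV⟩ : DeformedBGG.Otil m)
            (⟨DeformedBGG.dual (DeformedBGG.verma mu), hD⟩ : DeformedBGG.Otil m) i)) := by
  refine ⟨DeformedBGG.otilProp_defVerma l, DeformedBGG.otilProp_dual_verma mu, fun i => ⟨?_, ?_⟩⟩
  · rintro ⟨rfl, rfl⟩
    exact (DeformedBGG.nonempty_hom_defVerma_dual_equiv _ _).map
      (CategoryTheory.Abelian.Ext.linearEquiv₀ (R := ℂ)).trans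
  · intro h
    cases i with
    | zero =>
      have := DeformedBGG.subsingleton_hom_defVerma_dual (fun hl => h ⟨rfl, hl⟩)
        (DeformedBGG.otilProp_defVerma l) (DeformedBGG.otilProp_dual_verma mu)
      exact CategoryTheory.Abelian.Ext.addEquiv₀.toEquiv.subsingleton
    | succ n => exact DeformedBGG.subsingleton_ext_defVerma_dual_succ _ _ n
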